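/- Let $q\ge 2$ and let $\mathfrak X$ be the (vertex set of the) $(q+1)$-regular tree with graph distance $d$ and a reference vertex $o$. Let $\Omega$ be its boundary, i.e. the set of half-geodesics starting at $o$; for $x\in\mathfrak X$ and $\omega\in\Omega$, $[x,\omega)$ denotes the half-geodesic from $x$ that eventually coincides (up to a shift) with $\omega$, and $\Omega(x,y)$ is the set of $\omega$ such that $[x,\omega)$ passes through $y$. The sets $\Omega(x,y)$ generate the topology of $\Omega$, and $\nu_x$ is the Borel probability measure on $\Omega$ with $\nu_x(\Omega(x,y))=\frac1{(q+1)q^{n-1}}$ whenever $d(x,y)=n\ge1$. For $\omega=(x_0,x_1,\dots)$ let $h_\omega(x)=\lim_m (m-d(x,x_m))$. For $n\in\mathbb N$ let $\Omega_n(x,\omega)=\Omega(x,x_n)$, where $x_n$ is the vertex of $[x,\omega)$ at distance $n$ from $x$, and $$\mathcal E^x_n\eta(\omega)=\frac1{\nu_x(\Omega_n(x,\omega))}\int_{\Omega_n(x,\omega)}\eta\,d\nu_x .$$ Let $\tau=\pi/\log q$ and let $\mu$ be the Plancherel measure on $[0,\tau]$, $$d\mu(s)=2c_P|\mathbf c(s)|^{-2}ds,\qquad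 c_P=\frac{q\log q}{4\pi(q+1)},\qquad \mathbf c(z)=\frac{q^{1/2}}{q+1}\,\frac{q^{1/2+iz}-q^{-1/2-iz}}{q^{iz}-q^{-iz}},$$ which is normalized so that the Fourier–Helgason transform is an isometry of $L^2(\mathfrak X)$ onto $L^2(\Omega\times[0,\tau],\nu_o\otimes\mu)$. For $a:\mathfrak X\times\Omega\times[0,\tau]\to\mathbb C$ and $u:\mathfrak X\to\mathbb C$ of finite support put $$\mathrm{Op}(a)u(x)=\sum_{y\in\mathfrak X}\int_\Omega\int_0^\tau q^{(\frac12+is)(h_\omega(y)-h_\omega(x))}a(x,\omega,s)u(y)\,d\mu(s)\,d\nu_x(\omega).$$ A family $(a_\varepsilon)_{\varepsilon>0}$ of functions on $\mathfrak X\times\Omega\times[0,\tau]$ is called *bounded in $S$* if, with constants independent of $\varepsilon$, 1. all derivatives $\partial_s^ka_\varepsilon(x,\omega,s)$ exist, are continuous on $\Omega\times[0,\tau]$ for each $x$, and for each $k$ satisfy $|\partial_s^ka_\varepsilon(x,\omega,s)|\le C_k$ for all $x,\omega,s$; and for every $l\in\mathbb N$ there is $C_l$ with $|(a_\varepsilon-\mathcal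 E^x_na_\varepsilon)(x,\omega,s)|\le C_l(1+n)^{-l}$ for all $n,x,\omega,s$; 2. $\partial_s^ka_\varepsilon(x,\omega,0)=\partial_s^ka_\varepsilon(x,\omega,\tau)=0$ for all $k,x,\omega$. For example, $a_\varepsilon=a$ may be a single symbol $a\in S$ that does not depend on $\varepsilon$. The family $b=(b_\varepsilon)_{\varepsilon>0}$ belongs to the class $S_{sc}$ of semi-classical symbols if it is bounded in $S$ and moreover 3. (a) for every $k$ there is $C_k$ (independent of $\varepsilon$) with $|\partial_s^kb_\varepsilon(x,\omega,s)-\partial_s^kb_\varepsilon(y,\omega,s)|\le C_k\,\varepsilon\,d(x,y)$ for all $x,y,\omega,s$; (b) for every $l$ there is a function $t\mapsto C_l(t)$ (independent of $\varepsilon$) with $$|(b_\varepsilon-\mathcal E^x_nb_\varepsilon)(x,\omega,s)-(b_\varepsilon-\mathcal E^x_nb_\varepsilon)(y,\omega,s)|\le\varepsilon\,\frac{C_l(d(x,y))}{(1+n)^l}\quad\text{for all }x,y,n,\omega,s .$$ **Theorem.** Let $a=(a_\varepsilon)$ be bounded in $S$ (in particular, any $a\in S$) and let $b=(b_\varepsilon)\in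 S_{sc}$. Then for every $\varepsilon>0$ the operators $\mathrm{Op}(a)$, $\mathrm{Op}(b)$, $\mathrm{Op}(ab)$ extend to bounded operators on $L^2(\mathfrak X)$, and $\mathrm{Op}(a)\mathrm{Op}(b)-\mathrm{Op}(ab)$ is $\varepsilon$-negligible: its kernel $K_\varepsilon(x,y)$ satisfies, for every $N\in\mathbb N$, $$|K_\varepsilon(x,y)|\le C_N(\varepsilon)\,\frac{q^{-d(x,y)/2}}{(1+d(x,y))^N}\quad(x,y\in\mathfrak X),\qquad C_N(\varepsilon)\to0\text{ as }\varepsilon\to0 .$$ In particular, $$\|\mathrm{Op}(a)\mathrm{Op}(b)-\mathrm{Op}(ab)\|_{L^2\to L^2}\to0\quad\text{as }\varepsilon\to0 .$$ -/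

import Mathlib

open Set Filter Topology MeasureTheory

namespace TreePDO

/-! ### The tree, its boundary, cylinders -/

section Boundary

variable {V : Type*} (G : SimpleGraph V)

/-- A half-geodesic `(γ 0, γ 1, γ 2, …)`. -/
def IsHalfGeodesic (γ : ℕ → V) : Prop :=
  ∀ m k : ℕ, G.dist (γ m) (γ (m + k)) = k

/-- Two sequences of vertices meet at infinity. -/
def MeetAtInfinity (γ γ' : ℕ → V) : Prop :=
  ∃ m k : ℕ, ∀ n : ℕ, γ (m + n) = γ' (k + n)

/-- The boundary `Ω`: half-geodesics starting at the reference vertex `o`. -/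
def Boundary (o : V) : Type _ :=
  {γ : ℕ → V // IsHalfGeodesic G γ ∧ γ 0 = o}

variable {G} {o : V}

/-- `γ` is the half-geodesic `[x, ω)`, starting at `x` and equivalent to `ω`. -/
def IsRay (x : V) (ω : Boundary G o) (γ : ℕ → V) : Prop :=
  IsHalfGeodesic G γ ∧ γ 0 = x ∧ MeetAtInfinity γ ω.1

variable (G o)

/-- The cylinder `Ω(x, y)`: the boundary points `ω` such that `[x, ω)` runs through `[x, y]`. -/
def cylinder (x y : V) : Set (Boundary G o) :=
  {ω | ∃ γ : ℕ → V, IsRay x ω γ ∧ γ (G.dist x y) = y}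

variable {G o}

/-- `Ω_n(x, ω) = Ω(x, x_n)`, where `x_n` is the vertex of `[x, ω)` at distance `n` from `x`. -/
def cylinderAt (x : V) (n : ℕ) (ω : Boundary G o) : Set (Boundary G o) :=
  {ω' | ∃ y : V, G.dist x y = n ∧ ω ∈ cylinder G o x y ∧ ω' ∈ cylinder G o x y}

/-- The topology of `Ω` is generated by the cylinders. -/
instance : TopologicalSpace (Boundary G o) :=
  TopologicalSpace.generateFrom {C | ∃ x y : V, C = cylinder G o x y}

instance : MeasurableSpace (Boundary G o) := borel _

instance : BorelSpace (Boundary G o) := ⟨rfl⟩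

/-- `ν` is a Borel probability measure on `Ω` that gives each of the `(q + 1) q ^ (n - 1)`
cylinders `Ω(x, y)` with `d(x, y) = n ≥ 1` the same mass. -/
def IsUniformFrom (q : ℕ) (x : V) (ν : Measure (Boundary G o)) : Prop :=
  IsProbabilityMeasure ν ∧ ∀ y : V, y ≠ x →
    ν (cylinder G o x y) = (((q + 1) * q ^ (G.dist x y - 1) : ℕ) : ENNReal)⁻¹

/-- The measure `ν_x` on `Ω`: the unique one with `IsUniformFrom q x`. On the homogeneous tree it
exists, see `isUniformFrom_nu`. -/
noncomputable def nu (q : ℕ) (x : V) : Measure (Boundary G o) :=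
  Classical.epsilon (IsUniformFrom q x)

end Boundary
/-! ### Existence of the measures `ν_x` -/

section Existence

variable {V : Type*} {G : SimpleGraph V} {o : V}

theorem isHalfGeodesic_of_adj (hG : G.Connected) {γ : ℕ → V}
    (hadj : ∀ n, G.Adj (γ n) (γ (n + 1))) (hd : ∀ n, G.dist (γ 0) (γ n) = n) :
    IsHalfGeodesic G γ := by
  intro m k
  have h1 : G.dist (γ m) (γ (m + k)) ≤ k := by
    induction k with
    | zero => simp
    | succ k ih =>
      have := hG.dist_triangle (u := γ m) (v := γ (m + k)) (w := γ (m + k + 1))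
      have h2 := SimpleGraph.dist_eq_one_iff_adj.2 (hadj (m + k))
      rw [← add_assoc]; omega
  have h2 := hG.dist_triangle (u := γ 0) (v := γ m) (w := γ (m + k))
  rw [hd, hd] at h2
  omega

theorem IsHalfGeodesic.adj {γ : ℕ → V} (h : IsHalfGeodesic G γ) (n : ℕ) :
    G.Adj (γ n) (γ (n + 1)) :=
  SimpleGraph.dist_eq_one_iff_adj.1 (h n 1)

theorem IsHalfGeodesic.dist_zero {γ : ℕ → V} (h : IsHalfGeodesic G γ) (n : ℕ) :
    G.dist (γ 0) (γ n) = n := by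
  simpa using h 0 n

/-- Along a half-geodesic the distance to a vertex eventually increases by one at each step. -/
theorem exists_dist_add (hG : G.Connected) {γ : ℕ → V} (h : IsHalfGeodesic G γ) (x : V) (L : ℕ) :
    ∃ M, L ≤ M ∧ ∀ n, G.dist x (γ (M + n)) = G.dist x (γ M) + n := by
  have key : ∀ m n, G.dist x (γ (m + n)) ≤ G.dist x (γ m) + n := fun m n => by
    have := hG.dist_triangle (u := x) (v := γ m) (w := γ (m + n))
    rwa [h m n] at this
  have lower : ∀ n, n ≤ G.dist x (γ n) + G.dist (γ 0) x := fun n => by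
    have := hG.dist_triangle (u := γ 0) (v := x) (w := γ n)
    rw [h.dist_zero] at this; omega
  let f : ℕ → ℕ := fun n => G.dist x (γ (L + n)) + G.dist (γ 0) x - (L + n)
  obtain ⟨M, hM⟩ : ∃ M, ∀ n, f M ≤ f n := by
    obtain ⟨_, ⟨M, rfl⟩, hM⟩ := wellFounded_lt.has_min (Set.range f) ⟨f 0, 0, rfl⟩
    exact ⟨M, fun n => not_lt.1 (hM _ ⟨n, rfl⟩)⟩
  refine ⟨L + M, by omega, fun n => ?_⟩
  have h1 := hM (M + n)
  have h2 := key (L + M) n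
  have h3 := lower (L + M)
  have h4 := lower (L + M + n)
  simp only [f] at h1
  rw [← add_assoc] at h1
  omega

/-- If `y` is eventually between `x` and `γ n`, there is a half-geodesic from `x` through `y`
that meets `γ` at infinity. -/
theorem exists_halfGeodesic (hG : G.Connected) {γ : ℕ → V} (h : IsHalfGeodesic G γ) (x y : V)
    (hy : ∀ᶠ n in atTop, G.dist x y + G.dist y (γ n) = G.dist x (γ n)) :
    ∃ γ' : ℕ → V, IsHalfGeodesic G γ' ∧ γ' 0 = x ∧ MeetAtInfinity γ' γ ∧
      γ' (G.dist x y) = y := by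
  obtain ⟨L, hL⟩ := eventually_atTop.1 hy
  obtain ⟨M, hLM, hM⟩ := exists_dist_add hG h x L
  obtain ⟨p, hp⟩ := hG.exists_walk_length_eq_dist x y
  obtain ⟨r, hr⟩ := hG.exists_walk_length_eq_dist y (γ M)
  have hlen : (p.append r).length = G.dist x (γ M) := by
    rw [SimpleGraph.Walk.length_append, hp, hr, hL M hLM]
  set w := p.append r with hw
  set D := G.dist x (γ M) with hD
  let γ' : ℕ → V := fun n => if n ≤ D then w.getVert n else γ (M + (n - D))
  have hγD : ∀ n, γ' (D + n) = γ (M + n) := by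
    intro n
    by_cases hn : n = 0
    · subst hn
      simp only [γ', add_zero, le_refl, if_true]
      rw [← hlen, SimpleGraph.Walk.getVert_length]
    · simp only [γ', show ¬ (D + n ≤ D) by omega, if_false, Nat.add_sub_cancel_left]
  have hγle : ∀ n, n ≤ D → γ' n = w.getVert n := fun n hn => by simp [γ', hn]
  have h0 : γ' 0 = x := by simp [γ']
  have hadj : ∀ n, G.Adj (γ' n) (γ' (n + 1)) := by
    intro n
    by_cases hn : n + 1 ≤ D
    · rw [hγle n (by omega), hγle (n + 1) hn]
      exact w.adj_getVert_succ (by omega)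
    · obtain ⟨k, rfl⟩ := Nat.exists_eq_add_of_le (show D ≤ n by omega)
      rw [add_assoc, hγD, hγD, ← add_assoc]
      exact h.adj _
  have hup : ∀ n, G.dist x (γ' n) ≤ n := by
    intro n
    induction n with
    | zero => simp [h0]
    | succ n ih =>
      have := hG.dist_triangle (u := x) (v := γ' n) (w := γ' (n + 1))
      have h2 := SimpleGraph.dist_eq_one_iff_adj.2 (hadj n)
      omega
  have hstep : ∀ n k, G.dist (γ' n) (γ' (n + k)) ≤ k := by
    intro n k
    induction k with
    | zero => simp
    | succ k ih =>
      have := hG.dist_triangle (u := γ' n) (v := γ' (n + k)) (w := γ' (n + k + 1))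
      have h2 := SimpleGraph.dist_eq_one_iff_adj.2 (hadj (n + k))
      rw [← add_assoc]; omega
  have hdist : ∀ n, G.dist (γ' 0) (γ' n) = n := by
    intro n
    rw [h0]
    by_cases hn : n ≤ D
    · have h1 := hup n
      have h2 := hstep n (D - n)
      rw [Nat.add_sub_cancel' hn] at h2
      have h3 := hG.dist_triangle (u := x) (v := γ' n) (w := γ' D)
      have h4 : γ' D = γ M := by simpa using hγD 0
      rw [h4] at h2 h3
      omega
    · obtain ⟨k, rfl⟩ := Nat.exists_eq_add_of_le (show D ≤ n by omega)
      rw [hγD, hM]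
  refine ⟨γ', isHalfGeodesic_of_adj hG hadj hdist, h0, ⟨D, M, hγD⟩, ?_⟩
  have hle : G.dist x y ≤ D := by rw [hD, ← hL M hLM]; omega
  rw [hγle _ hle, hw, SimpleGraph.Walk.getVert_append, hp]
  simp

/-- In a tree, a vertex has at most one neighbour that is closer to `x`. -/
theorem parent_unique (hG : G.IsTree) {x v w w' : V} (hw : G.Adj w v) (hw' : G.Adj w' v)
    (h : G.dist x w + 1 = G.dist x v) (h' : G.dist x w' + 1 = G.dist x v) : w = w' := by
  obtain ⟨p, hp⟩ := hG.1.exists_walk_length_eq_dist x w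
  obtain ⟨p', hp'⟩ := hG.1.exists_walk_length_eq_dist x w'
  have h1 : (p.concat hw).IsPath := (p.concat hw).isPath_of_length_eq_dist (by simp [hp, h])
  have h2 : (p'.concat hw').IsPath := (p'.concat hw').isPath_of_length_eq_dist (by simp [hp', h'])
  have h3 := (hG.existsUnique_path x v).unique h1 h2
  have := congrArg SimpleGraph.Walk.penultimate h3
  simpa using this

/-- In a tree, two half-geodesics from `x` that meet at infinity pass the same vertices. -/
theorem halfGeodesic_eq (hG : G.IsTree) {γ γ' : ℕ → V} (h : IsHalfGeodesic G γ)
    (h' : IsHalfGeodesic G γ') (h0 : γ 0 = γ' 0) (hm : MeetAtInfinity γ γ') : γ = γ' := by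
  obtain ⟨m, k, hmk⟩ := hm
  have hmk' : m = k := by
    have h1 := h.dist_zero m
    have h2 := h'.dist_zero k
    have h3 := hmk 0
    simp only [add_zero] at h3
    rw [h3, h0, h2] at h1
    exact h1.symm
  subst hmk'
  have key : ∀ j n, m ≤ n + j → γ n = γ' n := by
    intro j
    induction j with
    | zero =>
      intro n hn
      obtain ⟨k, rfl⟩ := Nat.exists_eq_add_of_le hn
      exact hmk k
    | succ j ih =>
      intro n hn
      have h1 := ih (n + 1) (by omega)
      have h2 := h'.adj n
      rw [← h1] at h2
      refine parent_unique hG (x := γ 0) (h.adj n) h2 ?_ ?_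
      · rw [h.dist_zero, h.dist_zero]
      · rw [h.dist_zero, h0, h'.dist_zero]
  exact funext fun n => key m n (by omega)

theorem mem_cylinder_iff (hG : G.Connected) (x y : V) (ω : Boundary G o) :
    ω ∈ cylinder G o x y ↔
      ∀ᶠ n in atTop, G.dist x y + G.dist y (ω.1 n) = G.dist x (ω.1 n) := by
  constructor
  · rintro ⟨γ, ⟨hγ, h0, m, k, hmk⟩, hy⟩
    refine eventually_atTop.2 ⟨k + G.dist x y, fun n hn => ?_⟩
    obtain ⟨j, rfl⟩ := Nat.exists_eq_add_of_le hn
    rw [show k + G.dist x y + j = k + (G.dist x y + j) by omega, ← hmk]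
    have h1 := hγ.dist_zero (m + (G.dist x y + j))
    have h2 := hγ (G.dist x y) (m + j)
    rw [h0] at h1
    rw [hy, show G.dist x y + (m + j) = m + (G.dist x y + j) by omega] at h2
    omega
  · intro h
    obtain ⟨γ, h1, h2, h3, h4⟩ := exists_halfGeodesic hG ω.2.1 x y h
    exact ⟨γ, ⟨h1, h2, h3⟩, h4⟩

theorem countable_of_locallyFinite [G.LocallyFinite] (hG : G.Connected) : Countable V := by
  obtain ⟨x⟩ := hG.nonempty
  have hfin : ∀ n, {v | G.dist x v ≤ n}.Finite := by
    intro n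
    induction n with
    | zero =>
      refine (Set.finite_singleton x).subset fun v hv => ?_
      have : G.dist x v = 0 := by simpa using hv
      exact (hG.dist_eq_zero_iff.1 this).symm
    | succ n ih =>
      refine (ih.union (ih.biUnion fun v _ => (G.neighborSet v).toFinite)).subset fun v hv => ?_
      by_cases hvn : G.dist x v ≤ n
      · exact Or.inl hvn
      · right
        have hv' : G.dist x v = n + 1 := le_antisymm hv (by omega)
        obtain ⟨p, hp⟩ := hG.exists_walk_length_eq_dist x v
        have hnil : ¬ p.Nil := by
          rw [← SimpleGraph.Walk.length_eq_zero_iff]; omega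
        simp only [Set.mem_iUnion, exists_prop]
        refine ⟨p.penultimate, ?_, p.adj_penultimate hnil⟩
        have h1 := G.dist_le p.dropLast
        have h2 : p.dropLast.length = p.length - 1 := by simp
        show G.dist x p.penultimate ≤ n
        omega
  have : (Set.univ : Set V) = ⋃ n, {v | G.dist x v ≤ n} := by
    ext v; simpa using ⟨_, le_refl (G.dist x v)⟩
  rw [← Set.countable_univ_iff, this]
  exact Set.countable_iUnion fun n => (hfin n).countable

variable (G) in
/-- The neighbours of `v` that are farther from `x` than `v`. -/
def children (x v : V) : Set V := {w | G.Adj v w ∧ G.dist x w = G.dist x v + 1}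

open Classical in
theorem ncard_children [G.LocallyFinite] (hG : G.IsTree) {q : ℕ}
    (hq : G.IsRegularOfDegree (q + 1)) (x v : V) :
    (children G x v).Finite ∧ (children G x v).ncard = if v = x then q + 1 else q := by
  have hnb : (G.neighborSet v).ncard = q + 1 := by
    rw [← hq v, ← SimpleGraph.card_neighborSet_eq_degree, Set.ncard_eq_toFinset_card',
      Set.toFinset_card]
  have hfin : (G.neighborSet v).Finite := Set.toFinite _
  have hsub : children G x v ⊆ G.neighborSet v := fun w hw => hw.1
  refine ⟨hfin.subset hsub, ?_⟩
  split_ifs with hv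
  · subst hv
    rw [← hnb]
    congr 1
    ext w
    constructor
    · exact fun h => h.1
    · intro h
      refine ⟨h, ?_⟩
      simp [SimpleGraph.dist_eq_one_iff_adj.2 h]
  · have hpos := hG.1.pos_dist_of_ne (Ne.symm hv)
    obtain ⟨p, hp⟩ := hG.1.exists_walk_length_eq_dist x v
    have hnil : ¬ p.Nil := by
      rw [← SimpleGraph.Walk.length_eq_zero_iff]; omega
    have hadj := p.adj_penultimate hnil
    have h1 := G.dist_le p.dropLast
    have h2 : p.dropLast.length = p.length - 1 := by simp
    have h3 := hG.1.dist_triangle (u := x) (v := p.penultimate) (w := v)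
    have h4 := SimpleGraph.dist_eq_one_iff_adj.2 hadj
    have h5 : G.dist x p.penultimate + 1 = G.dist x v := by omega
    have : children G x v = G.neighborSet v \ {p.penultimate} := by
      ext w
      constructor
      · rintro ⟨hw, hd⟩
        refine ⟨hw, fun hwp => ?_⟩
        rw [Set.mem_singleton_iff.1 hwp] at hd
        omega
      · rintro ⟨hw, hne⟩
        refine ⟨hw, ?_⟩
        rcases hG.dist_eq_dist_add_one_of_adj x hw with h | h
        · exact absurd (parent_unique hG (SimpleGraph.Adj.symm hw) hadj h.symm h5) hne
        · exact h
    rw [this, Set.ncard_sdiff_singleton_of_mem (show p.penultimate ∈ G.neighborSet v from hadj.symm),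
      hnb]
    simp

/-- The half-geodesic from `x` that at each vertex `v` follows the edge to `ξ v`. -/
def follow (x : V) (ξ : ∀ v, children G x v) : ℕ → V
  | 0 => x
  | n + 1 => (ξ (follow x ξ n)).1

theorem follow_dist (x : V) (ξ : ∀ v, children G x v) (n : ℕ) :
    G.dist x (follow x ξ n) = n := by
  induction n with
  | zero => simp [follow]
  | succ n ih =>
    have := (ξ (follow x ξ n)).2.2
    rw [ih] at this
    exact this

theorem follow_isHalfGeodesic (hG : G.Connected) (x : V) (ξ : ∀ v, children G x v) :
    IsHalfGeodesic G (follow x ξ) :=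
  isHalfGeodesic_of_adj hG (fun n => (ξ (follow x ξ n)).2.1) (fun n => follow_dist x ξ n)

theorem exists_isUniformFrom [G.LocallyFinite] (hG : G.IsTree) {q : ℕ} (hq1 : 1 ≤ q)
    (hq : G.IsRegularOfDegree (q + 1)) (x : V) :
    ∃ ν : Measure (Boundary G o), IsUniformFrom q x ν := by
  classical
  have hcount : Countable V := countable_of_locallyFinite hG.1
  have hch : ∀ v, Fintype (children G x v) := fun v => (ncard_children hG hq x v).1.fintype
  have hcard : ∀ v, Fintype.card (children G x v) = if v = x then q + 1 else q := fun v => by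
    rw [← (ncard_children hG hq x v).2, ← Nat.card_coe_set_eq, Nat.card_eq_fintype_card]
  have hne : ∀ v, Nonempty (children G x v) := fun v => by
    rw [← Fintype.card_pos_iff, hcard]
    split_ifs <;> omega
  let _ : ∀ v, MeasurableSpace (children G x v) := fun v => ⊤
  let P : Measure (∀ v, children G x v) :=
    Measure.infinitePi fun v => (PMF.uniformOfFintype (children G x v)).toMeasure
  have hex : ∀ ξ : ∀ v, children G x v, ∃ ω : Boundary G o,
      MeetAtInfinity ω.1 (follow x ξ) := fun ξ => by
    obtain ⟨γ, h1, h2, h3, -⟩ :=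
      exists_halfGeodesic hG.1 (follow_isHalfGeodesic hG.1 x ξ) o o (by simp)
    exact ⟨⟨γ, h1, h2⟩, h3⟩
  choose W hW using hex
  have hev : ∀ (ξ : ∀ v, children G x v) (u v : V), W ξ ∈ cylinder G o u v ↔
      ∀ᶠ n in atTop, G.dist u v + G.dist v (follow x ξ n) = G.dist u (follow x ξ n) := by
    intro ξ u v
    rw [mem_cylinder_iff hG.1]
    obtain ⟨m, k, hmk⟩ := hW ξ
    let Q : V → Prop := fun z => G.dist u v + G.dist v z = G.dist u z
    change (∀ᶠ n in atTop, Q ((W ξ).1 n)) ↔ ∀ᶠ n in atTop, Q (follow x ξ n)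
    have shift : ∀ (R : ℕ → Prop) (j : ℕ),
        (∀ᶠ n in atTop, R n) ↔ ∀ᶠ n in atTop, R (j + n) := by
      intro R j
      conv_lhs => rw [← map_add_atTop_eq_nat j, eventually_map]
      simp only [add_comm]
    rw [shift (fun n => Q ((W ξ).1 n)) m, shift (fun n => Q (follow x ξ n)) k]
    simp only [hmk]
  have hmeas : ∀ (n : ℕ) (z : V), MeasurableSet {ξ : ∀ v, children G x v | follow x ξ n = z} := by
    intro n
    induction n with
    | zero => intro z; by_cases h : x = z <;> simp [follow, h]
    | succ n ih =>
      intro z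
      have : {ξ : ∀ v, children G x v | follow x ξ (n + 1) = z} =
          ⋃ v, {ξ | follow x ξ n = v} ∩ (fun ξ : ∀ v, children G x v => ξ v) ⁻¹' {w | w.1 = z} := by
        ext ξ
        simp [follow]
      rw [this]
      refine MeasurableSet.iUnion fun v => (ih v).inter ?_
      exact (measurable_pi_apply v) trivial
  have hmeasQ : ∀ (n : ℕ) (Q : V → Prop),
      MeasurableSet {ξ : ∀ v, children G x v | Q (follow x ξ n)} := by
    intro n Q
    have : {ξ : ∀ v, children G x v | Q (follow x ξ n)} =
        ⋃ z ∈ {z | Q z}, {ξ | follow x ξ n = z} := by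
      ext ξ; simp
    rw [this]
    exact MeasurableSet.biUnion (Set.to_countable _) fun z _ => hmeas n z
  have hWmeas : Measurable W := by
    have hc : {C : Set (Boundary G o) | ∃ x y : V, C = cylinder G o x y}.Countable := by
      have : {C : Set (Boundary G o) | ∃ x y : V, C = cylinder G o x y} =
          Set.range fun p : V × V => cylinder G o p.1 p.2 := by
        ext C; simp [eq_comm]
      rw [this]
      exact Set.countable_range _
    have : SecondCountableTopology (Boundary G o) := ⟨⟨_, hc, rfl⟩⟩
    have hb := borel_eq_generateFrom_of_subbasis (α := Boundary G o) (s := {C | ∃ x y : V, C = cylinder G o x y}) rfl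
    change @Measurable _ _ _ (borel _) W
    rw [hb]
    refine measurable_generateFrom ?_
    rintro _ ⟨u, v, rfl⟩
    have : W ⁻¹' cylinder G o u v = ⋃ N, ⋂ n ∈ {n | N ≤ n},
        {ξ | G.dist u v + G.dist v (follow x ξ n) = G.dist u (follow x ξ n)} := by
      ext ξ
      simp [hev ξ u v, eventually_atTop]
    rw [this]
    exact MeasurableSet.iUnion fun N => MeasurableSet.biInter (Set.to_countable _) fun n _ =>
      hmeasQ n fun z => G.dist u v + G.dist v z = G.dist u z
  have hprob : IsProbabilityMeasure P := by
    infer_instance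
  refine ⟨P.map W, Measure.isProbabilityMeasure_map hWmeas.aemeasurable, fun y hy => ?_⟩
  have hcm : MeasurableSet (cylinder G o x y) := by
    refine IsOpen.measurableSet ?_
    exact TopologicalSpace.isOpen_generateFrom_of_mem ⟨x, y, rfl⟩
  rw [Measure.map_apply hWmeas hcm]
  obtain ⟨p, hp⟩ := hG.1.exists_walk_length_eq_dist x y
  set d := G.dist x y with hd
  have hdpos : 0 < d := hG.1.pos_dist_of_ne (Ne.symm hy)
  have hpd : ∀ i, i ≤ d → G.dist x (p.getVert i) = i := by
    intro i hi
    have h1 := G.dist_le (p.take i)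
    have h2 := G.dist_le (p.drop i)
    have h3 := hG.1.dist_triangle (u := x) (v := p.getVert i) (w := y)
    simp only [SimpleGraph.Walk.take_length, SimpleGraph.Walk.drop_length] at h1 h2
    rw [hp] at h1 h2
    omega
  have hpa : ∀ i, i < d → G.Adj (p.getVert i) (p.getVert (i + 1)) :=
    fun i hi => p.adj_getVert_succ (by omega)
  have hset : W ⁻¹' cylinder G o x y = Set.pi ((Finset.range d).image p.getVert : Finset V)
      (fun v => {w : children G x v | w.1 = p.getVert (G.dist x v + 1)}) := by
    ext ξ
    have hfol : W ξ ∈ cylinder G o x y ↔ follow x ξ d = y := by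
      constructor
      · rw [hev]
        intro h
        obtain ⟨γ, h1, h2, h3, h4⟩ :=
          exists_halfGeodesic hG.1 (follow_isHalfGeodesic hG.1 x ξ) x y h
        rw [← halfGeodesic_eq hG h1 (follow_isHalfGeodesic hG.1 x ξ) (by simp [h2, follow]) h3]
        exact h4
      · intro h
        rw [hev]
        refine eventually_atTop.2 ⟨d, fun n hn => ?_⟩
        obtain ⟨k, rfl⟩ := Nat.exists_eq_add_of_le hn
        have := follow_isHalfGeodesic hG.1 x ξ d k
        rw [h] at this
        rw [this, follow_dist]
    rw [Set.mem_preimage, hfol]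
    simp only [Set.mem_pi, Finset.coe_image, Set.mem_image, Finset.coe_range, Set.mem_Iio,
      Set.mem_ofPred_eq, forall_exists_index, and_imp, forall_apply_eq_imp_iff₂]
    constructor
    · intro h i hi
      have key : ∀ j i, d ≤ i + j → i ≤ d → follow x ξ i = p.getVert i := by
        intro j
        induction j with
        | zero =>
          intro i h1 h2
          obtain rfl : i = d := by omega
          rw [h, ← hp, SimpleGraph.Walk.getVert_length]
        | succ j ih =>
          intro i h1 h2
          by_cases hid : i = d
          · exact ih i (by omega) h2
          · have h3 := ih (i + 1) (by omega) (by omega)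
            have h4 := (follow_isHalfGeodesic hG.1 x ξ).adj i
            rw [h3] at h4
            refine parent_unique hG (x := x) h4 (hpa i (by omega)) ?_ ?_
            · rw [follow_dist, hpd _ (by omega)]
            · rw [hpd _ h2, hpd _ (by omega)]
      have h1 := key d i (by omega) (by omega)
      have h2 := key d (i + 1) (by omega) (by omega)
      rw [hpd i (by omega), ← h2, ← h1]
      rfl
    · intro h
      have key : ∀ i, i ≤ d → follow x ξ i = p.getVert i := by
        intro i
        induction i with
        | zero => intro _; simp [follow]
        | succ i ih =>
          intro hi
          have h1 := h i (by omega)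
          rw [hpd i (by omega)] at h1
          rw [← h1]
          show (ξ (follow x ξ i)).1 = _
          rw [ih (by omega)]
      rw [key d le_rfl, ← hp, SimpleGraph.Walk.getVert_length]
  rw [hset, Measure.infinitePi_pi (fun v => (PMF.uniformOfFintype (children G x v)).toMeasure)
    (fun _ _ => trivial), Finset.prod_image]
  · have hfac : ∀ i ∈ Finset.range d,
        (PMF.uniformOfFintype (children G x (p.getVert i))).toMeasure
          {w | w.1 = p.getVert (G.dist x (p.getVert i) + 1)} =
        ((if i = 0 then q + 1 else q : ℕ) : ENNReal)⁻¹ := by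
      intro i hi
      have hi' := Finset.mem_range.1 hi
      have hmem : p.getVert (i + 1) ∈ children G x (p.getVert i) :=
        ⟨hpa i hi', by rw [hpd _ (by omega), hpd _ (by omega)]⟩
      have hs : {w : children G x (p.getVert i) | w.1 = p.getVert (G.dist x (p.getVert i) + 1)} =
          {⟨p.getVert (i + 1), hmem⟩} := by
        ext w
        rw [hpd i (by omega)]
        simp [Subtype.ext_iff]
      rw [hs, PMF.toMeasure_apply_singleton _ _ (by trivial), PMF.uniformOfFintype_apply, hcard]
      have : p.getVert i = x ↔ i = 0 := by
        constructor
        · intro h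
          have := hpd i (by omega)
          rw [h] at this
          simpa using this.symm
        · rintro rfl; simp
      simp only [this]
    rw [Finset.prod_congr rfl hfac]
    obtain ⟨e, he⟩ : ∃ e, d = e + 1 := ⟨d - 1, by omega⟩
    rw [he, Finset.prod_range_succ']
    simp only [Nat.add_sub_cancel, Nat.succ_ne_zero, if_false, if_true, Finset.prod_const,
      Finset.card_range]
    rw [Nat.cast_mul, ENNReal.mul_inv, Nat.cast_pow, ENNReal.inv_pow, mul_comm]
    · left; simp
    · left; exact ENNReal.natCast_ne_top _
  · intro i hi j hj hij
    have hi' := Finset.mem_range.1 (Finset.mem_coe.1 hi)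
    have hj' := Finset.mem_range.1 (Finset.mem_coe.1 hj)
    have h1 := hpd i (by omega)
    have h2 := hpd j (by omega)
    rw [hij] at h1
    omega

/-- On the `(q + 1)`-regular tree, `ν_x` has its defining property. -/
theorem isUniformFrom_nu [G.LocallyFinite] (hG : G.IsTree) {q : ℕ} (hq1 : 1 ≤ q)
    (hq : G.IsRegularOfDegree (q + 1)) (x : V) :
    IsUniformFrom q x (nu q x : Measure (Boundary G o)) :=
  Classical.epsilon_spec (exists_isUniformFrom hG hq1 hq x)

end Existence

/-! ### Height functions, Plancherel measure, pseudo-differential operators -/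

section Operators

variable {V : Type*} {G : SimpleGraph V} {o : V}

/-- The height function `h_ω(x) = lim_m (m - d(x, x_m))`, where `ω = (x_0, x_1, …)`, `x_0 = o`. -/
noncomputable def height (ω : Boundary G o) (x : V) : ℤ :=
  limUnder atTop fun m : ℕ => (m : ℤ) - (G.dist x (ω.1 m) : ℤ)

/-- `τ = π / log q`. -/
noncomputable def tau (q : ℕ) : ℝ := Real.pi / Real.log q

/-- The function `𝐜(z)` of the homogeneous tree. -/
noncomputable def cFun (q : ℕ) (z : ℂ) : ℂ :=
  (q : ℂ) ^ (1 / 2 : ℂ) / ((q : ℂ) + 1) *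
    (((q : ℂ) ^ (1 / 2 + Complex.I * z) - (q : ℂ) ^ (-(1 / 2) - Complex.I * z)) /
      ((q : ℂ) ^ (Complex.I * z) - (q : ℂ) ^ (-(Complex.I * z))))

/-- `c_P = q log q / (4 π (q + 1))`. -/
noncomputable def cPlancherel (q : ℕ) : ℝ :=
  q * Real.log q / (4 * Real.pi * (q + 1))

/-- The Plancherel measure on `[0, τ]`, with density `2 c_P |𝐜(s)|⁻²`. With the factor `2`, which
accounts for the half `[-τ, 0]` of the circle, the Fourier-Helgason transform is an isometry of
`L²(𝔛)` onto `L²(Ω × [0, τ])`, and the symbol `1` gives the identity operator. -/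
noncomputable def plancherel (q : ℕ) : Measure ℝ :=
  (volume.restrict (Icc 0 (tau q))).withDensity fun s =>
    ENNReal.ofReal (2 * cPlancherel q * (‖cFun q (s : ℂ)‖ ^ 2)⁻¹)

/-- `Op(a) u` for a finitely supported function `u` on the vertices. -/
noncomputable def Op (q : ℕ) (a : V → Boundary G o → ℝ → ℂ) (u : V →₀ ℂ) (x : V) : ℂ :=
  ∑ y ∈ u.support, ∫ ω, ∫ s,
    (q : ℂ) ^ ((1 / 2 + Complex.I * (s : ℂ)) * ((height ω y - height ω x : ℤ) : ℂ)) *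
      a x ω s * u y ∂(plancherel q) ∂(nu q x)

/-- The Hilbert space `L²(𝔛)` for the counting measure on the vertices. -/
abbrev L2 (V : Type*) : Type _ := lp (fun _ : V => ℂ) 2

/-- The bounded operator `A` on `L²(𝔛)` extends `T`, which is given on finitely supported
functions. -/
def Extends (A : L2 V →L[ℂ] L2 V) (T : (V →₀ ℂ) → V → ℂ) : Prop :=
  ∀ (u : V →₀ ℂ) (f : L2 V), (∀ x, f x = u x) → ∀ x, A f x = T u x

open Classical in
/-- The kernel `K_A(x, y) = (A δ_y)(x)`. -/
noncomputable def opKernel (A : L2 V →L[ℂ] L2 V) (x y : V) : ℂ :=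
  A (lp.single 2 y (1 : ℂ)) x

variable (G) in
/-- The family of operators `A_ε`, `ε > 0`, is `ε`-negligible. -/
def IsNegligible (q : ℕ) (A : ℝ → L2 V →L[ℂ] L2 V) : Prop :=
  ∀ N : ℕ, ∃ C : ℝ → ℝ, Tendsto C (𝓝[>] 0) (𝓝 0) ∧ ∀ ε > 0, ∀ x y : V,
    ‖opKernel (A ε) x y‖ ≤
      C ε * ((q : ℝ) ^ (-(G.dist x y : ℝ) / 2) / (1 + (G.dist x y : ℝ)) ^ N)

end Operators

/-! ### Symbol classes -/

section Symbols

variable {V : Type*} {G : SimpleGraph V} {o : V}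

/-- The average `ℰ_n^x η(ω)` of `η` over `Ω_n(x, ω)` with respect to `ν_x`. -/
noncomputable def average (q : ℕ) (x : V) (n : ℕ) (η : Boundary G o → ℂ) (ω : Boundary G o) : ℂ :=
  ⨍ ω' in cylinderAt x n ω, η ω' ∂(nu q x)

/-- The derivative `∂_s^k a (x, ω, s)` on `[0, τ]` (one-sided at the endpoints). -/
noncomputable def partialS (q : ℕ) (k : ℕ) (a : V → Boundary G o → ℝ → ℂ)
    (x : V) (ω : Boundary G o) (s : ℝ) : ℂ :=
  iteratedDerivWithin k (a x ω) (Icc 0 (tau q)) s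

/-- The family `(a_ε)`, `ε > 0`, is bounded in the symbol class `S`: each `a_ε` satisfies the
conditions of `S`, with constants that do not depend on `ε`. A single symbol `a` is in `S` if and
only if the constant family `fun _ => a` has this property. -/
structure IsSymbolFamily (q : ℕ) (a : ℝ → V → Boundary G o → ℝ → ℂ) : Prop where
  smooth : ∀ ε > 0, ∀ x ω, ContDiffOn ℝ ((⊤ : ℕ∞) : WithTop ℕ∞) (a ε x ω) (Icc 0 (tau q))
  continuous : ∀ ε > 0, ∀ (k : ℕ) (x : V),
    ContinuousOn (fun p : Boundary G o × ℝ => partialS q k (a ε) x p.1 p.2)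
      (univ ×ˢ Icc 0 (tau q))
  bounded : ∀ k : ℕ, ∃ C : ℝ, ∀ ε > 0, ∀ (x : V) (ω : Boundary G o), ∀ s ∈ Icc 0 (tau q),
    ‖partialS q k (a ε) x ω s‖ ≤ C
  regular : ∀ l : ℕ, ∃ C : ℝ, ∀ ε > 0, ∀ (n : ℕ) (x : V) (ω : Boundary G o),
    ∀ s ∈ Icc 0 (tau q),
      ‖a ε x ω s - average q x n (fun ω' => a ε x ω' s) ω‖ ≤ C / (1 + (n : ℝ)) ^ l
  flat : ∀ ε > 0, ∀ (k : ℕ) (x : V) (ω : Boundary G o),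
    partialS q k (a ε) x ω 0 = 0 ∧ partialS q k (a ε) x ω (tau q) = 0

/-- The family `b = (b_ε)`, `ε > 0`, is in the class `S_sc` of semi-classical symbols. -/
structure IsSemiclassical (q : ℕ) (b : ℝ → V → Boundary G o → ℝ → ℂ) : Prop
    extends IsSymbolFamily q b where
  lipschitz : ∀ k : ℕ, ∃ C : ℝ, ∀ ε > 0, ∀ (x y : V) (ω : Boundary G o), ∀ s ∈ Icc 0 (tau q),
    ‖partialS q k (b ε) x ω s - partialS q k (b ε) y ω s‖ ≤ C * ε * G.dist x y
  cross : ∀ l : ℕ, ∃ C : ℕ → ℝ, ∀ ε > 0, ∀ (x y : V) (n : ℕ) (ω : Boundary G o),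
    ∀ s ∈ Icc 0 (tau q),
      ‖(b ε x ω s - average q x n (fun ω' => b ε x ω' s) ω) -
          (b ε y ω s - average q x n (fun ω' => b ε y ω' s) ω)‖ ≤
        ε * (C (G.dist x y) / (1 + (n : ℝ)) ^ l)

end Symbols

end TreePDO

/-! The composition formula is exact when `b` does not depend on the vertex. For a base vertex x the
plane waves e_z(ω, s) = q^((1/2 - is)(h_ω(z) - h_ω(x))) are orthonormal in L²(Ω × [0, τ], ν_x ⊗ μ);
this is the Plancherel formula in the form Op(1) = 1 (`kernel_one`). Since ν_z has density q^(h_ω(z)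
- h_ω(x)) with respect to ν_x, the kernel of a symbol c is the matrix coefficient K_c(z, y) = ∫∫
conj(e_y) c e_z. As e_x = 1, Parseval's identity gives Σ_z K_a(x, z) K_b(z, y) = K_ab(x, y) for
symbols frozen at x (`hasSum_kernel_mul_kernel`). Completeness of the plane waves is not needed,
only that `a` lies in their closed span; this follows by approximation with polynomials in cos(s log
q) and with indicators of cylinders.

Hence the kernel of Op(a)Op(b) - Op(ab) is Σ_z K_a(x, z) K_{b_z - b_x}(z, y), where b_x is `b`
frozen at x. Seen from z, the symbol b_z - b_x is bounded both by ε F(d(x, z)), where F may grow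
arbitrarily, and by a power of 1 + d(x, z). The minimum of the two, divided by a higher power of 1 +
d(x, z), tends to 0 uniformly as ε → 0 (`exists_tendsto_zero_of_min`), and the rapid decay of K_a
absorbs that power.

The decay of kernels is `exists_norm_kernel_le`, linear in the bound of the symbol. Sorting ω by the
distance j at which [x, ω) leaves [x, y], with d = d(x, y), yields q^(-d/2) times a sum over j of
bounded weights times mean Fourier coefficients of frequency 2j - d. These decay for small j because
the symbol is flat at 0 and τ. For larger j the symbol is replaced by its value at one boundary
point; then the factor q^(2is) - 1 of the Plancherel density makes every coefficient a difference of
consecutive terms, the interior weights are constant, and the sum telescopes to terms that are small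
again.

Boundedness on L² is Schur's test with the weight q^(h_ω/2). Schur sums and convolutions of kernels
are both computed by sorting the vertices according to where they branch off from a ray or a
segment. -/

namespace TreePDO

/-! ### Geodesics, medians and spheres in a tree -/

section Geodesics

variable {V : Type*} {G : SimpleGraph V}

theorem exists_dist_eq_of_le (hG : G.Connected) (x y : V) {j : ℕ} (hj : j ≤ G.dist x y) :
    ∃ p, G.dist x p = j ∧ G.dist x p + G.dist p y = G.dist x y := by
  obtain ⟨p, hp⟩ := hG.exists_walk_length_eq_dist x y
  have h1 := G.dist_le (p.take j)
  have h2 := G.dist_le (p.drop j)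
  have h3 := hG.dist_triangle (u := x) (v := p.getVert j) (w := y)
  simp only [SimpleGraph.Walk.take_length, SimpleGraph.Walk.drop_length] at h1 h2
  rw [hp] at h1 h2
  exact ⟨p.getVert j, by omega, by omega⟩

theorem exists_adj_dist_add_one (hG : G.Connected) {v y : V} (h : v ≠ y) :
    ∃ w, G.Adj v w ∧ G.dist w y + 1 = G.dist v y := by
  obtain ⟨w, h1, h2⟩ := exists_dist_eq_of_le hG v y (j := 1) (hG.pos_dist_of_ne h)
  exact ⟨w, SimpleGraph.dist_eq_one_iff_adj.1 h1, by omega⟩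

/-- In a tree, a vertex between `x` and `y` is determined by its distance to `x`. -/
theorem eq_of_dist_eq (hG : G.IsTree) {x y v v' : V}
    (hv : G.dist x v + G.dist v y = G.dist x y) (hv' : G.dist x v' + G.dist v' y = G.dist x y)
    (h : G.dist x v = G.dist x v') : v = v' := by
  obtain ⟨k, hk⟩ : ∃ k, G.dist v y = k := ⟨_, rfl⟩
  induction k generalizing v v' with
  | zero =>
    rw [hG.1.dist_eq_zero_iff.1 hk, hG.1.dist_eq_zero_iff.1 (show G.dist v' y = 0 by omega)]
  | succ k ih =>
    have hne : ∀ u, G.dist u y = k + 1 → u ≠ y := by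
      rintro u hu rfl
      simp at hu
    obtain ⟨w, hw1, hw2⟩ := exists_adj_dist_add_one hG.1 (hne v hk)
    obtain ⟨w', hw1', hw2'⟩ := exists_adj_dist_add_one hG.1 (hne v' (by omega))
    have t1 := hG.1.dist_triangle (u := x) (v := w) (w := y)
    have t2 := hG.1.dist_triangle (u := x) (v := w') (w := y)
    have t3 := hG.1.dist_triangle (u := x) (v := v) (w := w)
    have t4 := hG.1.dist_triangle (u := x) (v := v') (w := w')
    have a1 := SimpleGraph.dist_eq_one_iff_adj.2 hw1
    have a2 := SimpleGraph.dist_eq_one_iff_adj.2 hw1'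
    have e : w = w' := ih (by omega) (by omega) (by omega) (by omega)
    subst e
    exact parent_unique hG hw1 hw1' (x := x) (by omega) (by omega)

/-- Vertices between `x` and `u` are ordered by their distance to `x`. -/
theorem dist_add_dist_of_le (hG : G.IsTree) {x u m v : V}
    (hm : G.dist x m + G.dist m u = G.dist x u) (hv : G.dist x v + G.dist v u = G.dist x u)
    (h : G.dist x m ≤ G.dist x v) : G.dist x m + G.dist m v = G.dist x v := by
  obtain ⟨p, h1, h2⟩ := exists_dist_eq_of_le hG.1 x v h
  have t1 := hG.1.dist_triangle (u := p) (v := v) (w := u)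
  have t2 := hG.1.dist_triangle (u := x) (v := p) (w := u)
  rwa [eq_of_dist_eq hG hm (v' := p) (by omega) h1.symm]

/-- Induction on d(x, y), moving y one step to its neighbour w on the side of x. If y is farther
from u than w, the median for w still works. Otherwise the median for w must be w itself, since a
step from w towards it would lead to y, and then y is the new median. -/
theorem exists_median (hG : G.IsTree) (x y u : V) :
    ∃ m, G.dist x m + G.dist m y = G.dist x y ∧ G.dist x m + G.dist m u = G.dist x u ∧
      G.dist y m + G.dist m u = G.dist y u := by
  obtain ⟨k, hk⟩ : ∃ k, G.dist x y = k := ⟨_, rfl⟩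
  induction k generalizing y with
  | zero =>
    obtain rfl := hG.1.dist_eq_zero_iff.1 hk
    exact ⟨x, by simp, by simp, by simp⟩
  | succ k ih =>
    have hne : y ≠ x := by
      rintro rfl
      simp at hk
    obtain ⟨w, hw1, hw2⟩ := exists_adj_dist_add_one hG.1 hne
    have a1 := SimpleGraph.dist_eq_one_iff_adj.2 hw1
    rw [G.dist_comm (u := y) (v := x), G.dist_comm (u := w) (v := x)] at hw2
    obtain ⟨m, h1, h2, h3⟩ := ih w (by omega)
    have t1 := hG.1.dist_triangle (u := m) (v := w) (w := y)
    have t2 := hG.1.dist_triangle (u := x) (v := m) (w := y)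
    have c1 := G.dist_comm (u := w) (v := m)
    have c2 := G.dist_comm (u := y) (v := m)
    have c3 := G.dist_comm (u := w) (v := y)
    have c4 := G.dist_comm (u := u) (v := y)
    have c5 := G.dist_comm (u := u) (v := w)
    rcases hG.dist_eq_dist_add_one_of_adj u hw1.symm with h | h
    · -- `y` is closer to `u` than `w`
      have hmw : m = w := by
        by_contra hmw
        obtain ⟨n, hn1, hn2⟩ := exists_adj_dist_add_one hG.1 (Ne.symm hmw)
        have a2 := SimpleGraph.dist_eq_one_iff_adj.2 hn1
        have t3 := hG.1.dist_triangle (u := n) (v := m) (w := u)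
        have t4 := hG.1.dist_triangle (u := w) (v := n) (w := u)
        have t5 := hG.1.dist_triangle (u := x) (v := m) (w := n)
        have c6 := G.dist_comm (u := n) (v := m)
        have c7 := G.dist_comm (u := n) (v := u)
        have e : n = y := parent_unique hG (x := u) hn1.symm hw1 (by omega) (by omega)
        subst e
        omega
      subst hmw
      refine ⟨y, by simp, ?_, by simp⟩
      omega
    · have t3 := hG.1.dist_triangle (u := y) (v := m) (w := u)
      exact ⟨m, by omega, h2, by omega⟩

theorem finite_sphere [G.LocallyFinite] (hG : G.Connected) (x : V) (k : ℕ) :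
    {v | G.dist x v = k}.Finite := by
  induction k with
  | zero =>
    refine (Set.finite_singleton x).subset fun v hv => ?_
    exact (hG.dist_eq_zero_iff.1 hv).symm
  | succ k ih =>
    refine (ih.biUnion fun v _ => (G.neighborSet v).toFinite).subset fun v hv => ?_
    obtain ⟨w, h1, h2⟩ := exists_dist_eq_of_le hG x v (j := k)
      (by rw [show G.dist x v = k + 1 from hv]; omega)
    have hv' : G.dist x v = k + 1 := hv
    simp only [mem_iUnion, exists_prop]
    exact ⟨w, h1, SimpleGraph.dist_eq_one_iff_adj.1 (by omega)⟩

/-- The count obtained for k ≥ 1 is (q + 1) q^(k - 1); the weaker bound has the same form for k = 0.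
-/
theorem ncard_sphere_le [G.LocallyFinite] (hG : G.IsTree) {q : ℕ} (hq1 : 1 ≤ q)
    (hq : G.IsRegularOfDegree (q + 1)) (x : V) (k : ℕ) :
    {v | G.dist x v = k}.ncard ≤ 2 * q ^ k := by
  classical
  have hsub : ∀ k, {v | G.dist x v = k + 1} ⊆ ⋃ v ∈ (finite_sphere hG.1 x k).toFinset,
      children G x v := by
    intro k v hv
    have hv' : G.dist x v = k + 1 := hv
    obtain ⟨w, h1, h2⟩ := exists_dist_eq_of_le hG.1 x v (j := k) (by omega)
    simp only [mem_iUnion, exists_prop, Set.Finite.mem_toFinset]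
    exact ⟨w, h1, SimpleGraph.dist_eq_one_iff_adj.1 (by omega), by omega⟩
  have hstep : ∀ k c, (∀ v, G.dist x v = k → (children G x v).ncard ≤ c) →
      {v | G.dist x v = k + 1}.ncard ≤ {v | G.dist x v = k}.ncard * c := by
    intro k c hc
    refine (Set.ncard_le_ncard (hsub k) (Set.Finite.biUnion (Finset.finite_toSet _)
      fun v _ => (ncard_children hG hq x v).1)).trans ?_
    refine (Finset.set_ncard_biUnion_le _ _).trans ?_
    rw [Set.ncard_eq_toFinset_card _ (finite_sphere hG.1 x k), ← smul_eq_mul]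
    exact Finset.sum_le_card_nsmul _ _ _ fun v hv => hc v (by simpa using hv)
  have h0 : {v | G.dist x v = 0}.ncard = 1 := by
    rw [Set.ncard_eq_one]
    exact ⟨x, by ext v; simp [hG.1.dist_eq_zero_iff, eq_comm]⟩
  have key : ∀ k, {v | G.dist x v = k + 1}.ncard ≤ (q + 1) * q ^ k := by
    intro k
    induction k with
    | zero =>
      have := hstep 0 (q + 1) fun v _ => by
        rw [(ncard_children hG hq x v).2]; split_ifs <;> omega
      rw [h0] at this
      simpa using this
    | succ k ih =>
      have := hstep (k + 1) q fun v hv => by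
        rw [(ncard_children hG hq x v).2, if_neg]
        rintro rfl
        simp at hv
      calc _ ≤ _ := this
        _ ≤ ((q + 1) * q ^ k) * q := by gcongr
        _ = _ := by ring
  cases k with
  | zero => rw [h0]; simp
  | succ k =>
    refine (key k).trans ?_
    calc (q + 1) * q ^ k ≤ (q + q) * q ^ k := by gcongr
      _ = _ := by ring

end Geodesics

/-! ### Height functions and cylinders -/

section Heights

variable {V : Type*} {G : SimpleGraph V} {o : V}

theorem mem_cylinder_self (hG : G.Connected) (x : V) (ω : Boundary G o) :
    ω ∈ cylinder G o x x := by
  simp [mem_cylinder_iff hG]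

/-- The sequence that defines the height is eventually constant, because the distance to x finally
grows by one at each step. So the limit can be replaced by any late term, and heights become integer
arithmetic of distances. -/
theorem eventually_height_eq (hG : G.Connected) (ω : Boundary G o) (x : V) :
    ∀ᶠ n : ℕ in atTop, height ω x = (n : ℤ) - G.dist x (ω.1 n) := by
  obtain ⟨M, -, hM⟩ := exists_dist_add hG ω.2.1 x 0
  have hc : ∀ n ≥ M, ((n : ℤ) - G.dist x (ω.1 n)) = M - G.dist x (ω.1 M) := by
    intro n hn
    obtain ⟨k, rfl⟩ := Nat.exists_eq_add_of_le hn
    rw [hM]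
    push_cast
    ring
  have hlim : height ω x = M - G.dist x (ω.1 M) := by
    refine Tendsto.limUnder_eq (tendsto_const_nhds.congr' ?_)
    exact eventually_atTop.2 ⟨M, fun n hn => (hc n hn).symm⟩
  exact eventually_atTop.2 ⟨M, fun n hn => by rw [hlim, hc n hn]⟩

theorem height_sub_height (hG : G.Connected) {ω : Boundary G o} {x y v : V}
    (hx : ω ∈ cylinder G o x v) (hy : ω ∈ cylinder G o y v) :
    height ω y - height ω x = G.dist x v - G.dist y v := by
  obtain ⟨n, h1, h2, h3, h4⟩ := (((mem_cylinder_iff hG _ _ _).1 hx).and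
    (((mem_cylinder_iff hG _ _ _).1 hy).and ((eventually_height_eq hG ω x).and
      (eventually_height_eq hG ω y)))).exists
  rw [h3, h4, ← h1, ← h2]
  push_cast
  ring

/-- The vertex at which `[x, ω)` and `[y, ω)` leave the segment `[x, y]`. -/
theorem exists_median_boundary (hG : G.IsTree) (x y : V) (ω : Boundary G o) :
    ∃ m, G.dist x m + G.dist m y = G.dist x y ∧ ω ∈ cylinder G o x m ∧
      ω ∈ cylinder G o y m := by
  obtain ⟨M, -, hM⟩ := exists_dist_add hG.1 ω.2.1 x 0
  obtain ⟨M', hMM, hM'⟩ := exists_dist_add hG.1 ω.2.1 y M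
  obtain ⟨m, h1, h2, h3⟩ := exists_median hG x y (ω.1 M')
  refine ⟨m, h1, ?_, ?_⟩
  · refine (mem_cylinder_iff hG.1 _ _ _).2 (eventually_atTop.2 ⟨M', fun n hn => ?_⟩)
    obtain ⟨k, rfl⟩ := Nat.exists_eq_add_of_le hn
    obtain ⟨l, rfl⟩ := Nat.exists_eq_add_of_le hMM
    have t1 := hG.1.dist_triangle (u := m) (v := ω.1 (M + l)) (w := ω.1 (M + l + k))
    have t2 := hG.1.dist_triangle (u := x) (v := m) (w := ω.1 (M + l + k))
    have e1 := ω.2.1 (M + l) k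
    have e2 := hM l
    have e3 := hM (l + k)
    rw [← add_assoc] at e3
    omega
  · refine (mem_cylinder_iff hG.1 _ _ _).2 (eventually_atTop.2 ⟨M', fun n hn => ?_⟩)
    obtain ⟨k, rfl⟩ := Nat.exists_eq_add_of_le hn
    have t1 := hG.1.dist_triangle (u := m) (v := ω.1 M') (w := ω.1 (M' + k))
    have t2 := hG.1.dist_triangle (u := y) (v := m) (w := ω.1 (M' + k))
    have e1 := ω.2.1 M' k
    have e2 := hM' k
    omega

theorem eq_of_mem_cylinder (hG : G.IsTree) {x v v' : V} {ω : Boundary G o}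
    (h : ω ∈ cylinder G o x v) (h' : ω ∈ cylinder G o x v') (hd : G.dist x v = G.dist x v') :
    v = v' := by
  obtain ⟨n, h1, h2⟩ := (((mem_cylinder_iff hG.1 _ _ _).1 h).and
    ((mem_cylinder_iff hG.1 _ _ _).1 h')).exists
  exact eq_of_dist_eq hG h1 h2 hd

theorem mem_cylinder_of_between (hG : G.Connected) {x p v : V} {ω : Boundary G o}
    (h : ω ∈ cylinder G o x v) (hp : G.dist x p + G.dist p v = G.dist x v) :
    ω ∈ cylinder G o x p := by
  rw [mem_cylinder_iff hG] at h ⊢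
  filter_upwards [h] with n hn
  have t1 := hG.dist_triangle (u := p) (v := v) (w := ω.1 n)
  have t2 := hG.dist_triangle (u := x) (v := p) (w := ω.1 n)
  omega

theorem dist_add_dist_of_mem_cylinder (hG : G.IsTree) {x m v : V} {ω : Boundary G o}
    (hm : ω ∈ cylinder G o x m) (hv : ω ∈ cylinder G o x v) (h : G.dist x m ≤ G.dist x v) :
    G.dist x m + G.dist m v = G.dist x v := by
  obtain ⟨n, h1, h2⟩ := (((mem_cylinder_iff hG.1 _ _ _).1 hm).and
    ((mem_cylinder_iff hG.1 _ _ _).1 hv)).exists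
  exact dist_add_dist_of_le hG h1 h2 h

/-- The ray `[x, ω)`. -/
theorem exists_ray (hG : G.IsTree) (x : V) (ω : Boundary G o) :
    ∃ p : ℕ → V, (∀ n, G.dist x (p n) = n) ∧ ∀ n, ω ∈ cylinder G o x (p n) := by
  obtain ⟨γ, h1, h2, h3, -⟩ := exists_halfGeodesic hG.1 ω.2.1 x x (by simp)
  have hd : ∀ n, G.dist x (γ n) = n := fun n => by rw [← h2]; exact h1.dist_zero n
  exact ⟨γ, hd, fun n => ⟨γ, ⟨h1, h2, h3⟩, by rw [hd]⟩⟩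

theorem height_sub_le (hG : G.IsTree) (x y : V) (ω : Boundary G o) :
    |height ω y - height ω x| ≤ G.dist x y := by
  obtain ⟨m, h1, h2, h3⟩ := exists_median_boundary hG x y ω
  rw [height_sub_height hG.1 h2 h3, G.dist_comm (u := y), abs_le]
  omega

/-- The rays [x, ω) and [z, ω) merge at a vertex m of [x, z]. A vertex v farther from x than z can
only lie behind m, where the two rays agree. This change of base point is what makes ν_x and ν_z
comparable. -/
theorem cylinder_eq_of_dist_lt (hG : G.IsTree) {x z v : V} (h : G.dist x z < G.dist x v) :
    cylinder G o x v = cylinder G o z v := by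
  ext ω
  obtain ⟨m, h1, h2, h3⟩ := exists_median_boundary hG x z ω
  have c1 := G.dist_comm (u := m) (v := z)
  constructor
  · intro hv
    have h4 := dist_add_dist_of_mem_cylinder hG h2 hv (by omega)
    rw [mem_cylinder_iff hG.1] at h2 h3 hv ⊢
    filter_upwards [h2, h3, hv] with n e1 e2 e3
    have t1 := hG.1.dist_triangle (u := z) (v := m) (w := v)
    have t2 := hG.1.dist_triangle (u := z) (v := v) (w := ω.1 n)
    omega
  · intro hv
    -- If v came before m on [z, ω), it would lie on [z, m], hence within distance d(x, z) of x.
    have h5 : G.dist z m ≤ G.dist z v := by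
      by_contra hlt
      have h4 := dist_add_dist_of_mem_cylinder hG hv h3 (by omega)
      have t1 := hG.1.dist_triangle (u := x) (v := m) (w := v)
      have c2 := G.dist_comm (u := m) (v := v)
      omega
    have h4 := dist_add_dist_of_mem_cylinder hG h3 hv h5
    rw [mem_cylinder_iff hG.1] at h2 h3 hv ⊢
    filter_upwards [h2, h3, hv] with n e1 e2 e3
    have t1 := hG.1.dist_triangle (u := x) (v := m) (w := v)
    have t2 := hG.1.dist_triangle (u := x) (v := v) (w := ω.1 n)
    omega

/-- The height increases by `2 j - d(x, y)` or more exactly if `ω` is behind the `j`-th vertex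
of `[x, y]`. -/
theorem mem_cylinder_iff_height (hG : G.IsTree) {x y p : V}
    (hp : G.dist x p + G.dist p y = G.dist x y) (ω : Boundary G o) :
    ω ∈ cylinder G o x p ↔
      2 * (G.dist x p : ℤ) - G.dist x y ≤ height ω y - height ω x := by
  obtain ⟨m, h1, h2, h3⟩ := exists_median_boundary hG x y ω
  have hH := height_sub_height hG.1 h2 h3
  have c1 := G.dist_comm (u := m) (v := y)
  constructor
  · intro h
    obtain ⟨n, e1, e2, e3⟩ := (((mem_cylinder_iff hG.1 _ _ _).1 h).and
      ((eventually_height_eq hG.1 ω x).and (eventually_height_eq hG.1 ω y))).exists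
    have t1 := hG.1.dist_triangle (u := y) (v := p) (w := ω.1 n)
    have c2 := G.dist_comm (u := p) (v := y)
    omega
  · intro h
    exact mem_cylinder_of_between hG.1 h2 (dist_add_dist_of_le hG hp h1 (by omega))

theorem exists_height_sub_eq (hG : G.IsTree) (x y : V) (ω : Boundary G o) :
    ∃ j ≤ G.dist x y, height ω y - height ω x = 2 * (j : ℤ) - G.dist x y := by
  obtain ⟨m, h1, h2, h3⟩ := exists_median_boundary hG x y ω
  have c1 := G.dist_comm (u := m) (v := y)
  exact ⟨G.dist x m, by omega, by rw [height_sub_height hG.1 h2 h3]; omega⟩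

/-- Exactly one neighbour of `z` is closer to `ω`. -/
theorem exists_unique_closer (hG : G.IsTree) (z : V) (ω : Boundary G o) :
    ∃ w, G.Adj z w ∧ height ω w - height ω z = 1 ∧
      ∀ w', G.Adj z w' → w' ≠ w → height ω w' - height ω z = -1 := by
  obtain ⟨p, hp, hω⟩ := exists_ray hG z ω
  refine ⟨p 1, SimpleGraph.dist_eq_one_iff_adj.1 (hp 1), ?_, fun w' hw' hne => ?_⟩
  · rw [height_sub_height hG.1 (hω 1) (mem_cylinder_self hG.1 _ _), hp 1]
    simp
  · obtain ⟨m, h1, h2, h3⟩ := exists_median_boundary hG z w' ω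
    have a1 := SimpleGraph.dist_eq_one_iff_adj.2 hw'
    by_cases hm : G.dist z m = 0
    · obtain rfl := hG.1.dist_eq_zero_iff.1 hm
      rw [height_sub_height hG.1 h2 h3, G.dist_comm (u := w'), a1]
      simp
    · have e : m = w' := hG.1.dist_eq_zero_iff.1 (by omega)
      subst e
      exact absurd (eq_of_mem_cylinder hG h2 (hω 1) (by rw [hp, a1])) hne

end Heights

/-! ### Topology of the boundary -/

section Topology

variable {V : Type*} {G : SimpleGraph V} {o : V}

theorem isOpen_cylinder (x y : V) : IsOpen (cylinder G o x y) :=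
  TopologicalSpace.isOpen_generateFrom_of_mem ⟨x, y, rfl⟩

theorem isLocallyConstant_height_sub (hG : G.IsTree) (x y : V) :
    IsLocallyConstant fun ω : Boundary G o => height ω y - height ω x := by
  rw [IsLocallyConstant.iff_exists_open]
  intro ω
  obtain ⟨m, h1, h2, h3⟩ := exists_median_boundary hG x y ω
  refine ⟨_, (isOpen_cylinder x m).inter (isOpen_cylinder y m), ⟨h2, h3⟩, fun ω' h' => ?_⟩
  rw [height_sub_height hG.1 h2 h3, height_sub_height hG.1 h'.1 h'.2]

theorem secondCountable_boundary [Countable V] : SecondCountableTopology (Boundary G o) := by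
  refine ⟨{C | ∃ x y : V, C = cylinder G o x y}, ?_, rfl⟩
  have : {C | ∃ x y : V, C = cylinder G o x y} =
      range fun p : V × V => cylinder G o p.1 p.2 := by
    ext C
    simp [eq_comm]
  rw [this]
  exact countable_range _

end Topology

/-! ### The measures ν_x and their mutual densities -/

section Measures

variable {V : Type*} {G : SimpleGraph V} {o : V} {q : ℕ}

theorem isProbabilityMeasure_nu [G.LocallyFinite] (hG : G.IsTree) (hq1 : 1 ≤ q)
    (hq : G.IsRegularOfDegree (q + 1))
    (x : V) : IsProbabilityMeasure (nu q x : Measure (Boundary G o)) :=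
  (isUniformFrom_nu hG hq1 hq x).1

theorem cylinder_self (hG : G.Connected) (x : V) : cylinder G o x x = univ :=
  eq_univ_of_forall (mem_cylinder_self hG x)

theorem nu_real_cylinder [G.LocallyFinite] (hG : G.IsTree) (hq1 : 1 ≤ q)
    (hq : G.IsRegularOfDegree (q + 1))
    {x y : V} (h : y ≠ x) :
    (nu q x : Measure (Boundary G o)).real (cylinder G o x y) * q ^ G.dist x y = q / (q + 1) := by
  have hpos := hG.1.pos_dist_of_ne h.symm
  obtain ⟨n, hn⟩ : ∃ n, G.dist x y = n + 1 := ⟨G.dist x y - 1, by omega⟩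
  rw [measureReal_def, (isUniformFrom_nu hG hq1 hq x).2 y h, hn]
  have : (q : ℝ) ≠ 0 := by positivity
  simp only [Nat.add_sub_cancel, ENNReal.toReal_inv, ENNReal.toReal_natCast]
  push_cast
  field_simp
  ring

/-- A set of positive mass is not empty, so no ray has to be constructed. -/
theorem cylinder_nonempty [G.LocallyFinite] (hG : G.IsTree) (hq1 : 1 ≤ q)
    (hq : G.IsRegularOfDegree (q + 1))
    (x y : V) : (cylinder G o x y).Nonempty := by
  have := isProbabilityMeasure_nu (o := o) hG hq1 hq x
  by_cases h : y = x
  · subst h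
    rw [cylinder_self hG.1]
    exact (nu q y : Measure (Boundary G o)).nonempty_of_neZero |>.elim fun ω => ⟨ω, trivial⟩
  · rw [nonempty_iff_ne_empty]
    intro he
    have h1 := nu_real_cylinder (o := o) hG hq1 hq h
    rw [he, measureReal_empty, zero_mul] at h1
    have : (0 : ℝ) < q / (q + 1) := by positivity
    linarith

theorem cylinder_subset_cylinder (hG : G.Connected) {x p v : V}
    (hp : G.dist x p + G.dist p v = G.dist x v) : cylinder G o x v ⊆ cylinder G o x p :=
  fun _ h => mem_cylinder_of_between hG h hp

/-- Cylinders with the same base point are nested or disjoint. The lower bound `R` restricts to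
cylinders that are small enough for a change of base point; they still generate the σ-algebra. -/
theorem isPiSystem_cylinder (hG : G.IsTree) (x : V) (R : ℕ) :
    IsPiSystem {C : Set (Boundary G o) | ∃ v, R < G.dist x v ∧ C = cylinder G o x v} := by
  rintro _ ⟨v, hv, rfl⟩ _ ⟨v', hv', rfl⟩ ⟨ω, h1, h2⟩
  rcases le_total (G.dist x v) (G.dist x v') with h | h
  · rw [inter_eq_self_of_subset_right
      (cylinder_subset_cylinder hG.1 (dist_add_dist_of_mem_cylinder hG h1 h2 h))]
    exact ⟨v', hv', rfl⟩
  · rw [inter_eq_self_of_subset_left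
      (cylinder_subset_cylinder hG.1 (dist_add_dist_of_mem_cylinder hG h2 h1 h))]
    exact ⟨v, hv, rfl⟩

/-- Each boundary point of `Ω(u, w)` lies in a small cylinder based at `x` within `Ω(u, w)`. -/
theorem exists_cylinder_subset (hG : G.IsTree) (x u w : V) (R : ℕ) {ω : Boundary G o}
    (h : ω ∈ cylinder G o u w) :
    ∃ v, R < G.dist x v ∧ ω ∈ cylinder G o x v ∧ cylinder G o x v ⊆ cylinder G o u w := by
  obtain ⟨p, hp, hω⟩ := exists_ray hG x ω
  obtain ⟨n, hn⟩ : ∃ n, n = R + G.dist x u + G.dist u w + 1 := ⟨_, rfl⟩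
  have hv := hp n
  have t1 := hG.1.dist_triangle (u := x) (v := u) (w := p n)
  have e : cylinder G o x (p n) = cylinder G o u (p n) :=
    cylinder_eq_of_dist_lt hG (by omega)
  refine ⟨p n, by omega, hω n, ?_⟩
  have h2 := hω n
  rw [e] at h2 ⊢
  exact cylinder_subset_cylinder hG.1 (dist_add_dist_of_mem_cylinder hG h h2 (by omega))

theorem measurableSpace_eq_generateFrom [G.LocallyFinite] (hG : G.IsTree) (x : V) (R : ℕ) :
    (inferInstance : MeasurableSpace (Boundary G o)) = MeasurableSpace.generateFrom
      {C : Set (Boundary G o) | ∃ v, R < G.dist x v ∧ C = cylinder G o x v} := by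
  have : Countable V := countable_of_locallyFinite hG.1
  have := secondCountable_boundary (G := G) (o := o)
  have hb : (inferInstance : MeasurableSpace (Boundary G o)) =
      MeasurableSpace.generateFrom {C | ∃ x y : V, C = cylinder G o x y} :=
    borel_eq_generateFrom_of_subbasis rfl
  refine le_antisymm ?_ ?_
  · rw [hb]
    refine MeasurableSpace.generateFrom_le ?_
    rintro _ ⟨u, w, rfl⟩
    have : cylinder G o u w = ⋃ v ∈ {v | R < G.dist x v ∧
        cylinder G o x v ⊆ cylinder G o u w}, cylinder G o x v := by
      ext ω
      simp only [mem_iUnion, exists_prop]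
      constructor
      · intro h
        obtain ⟨v, h1, h2, h3⟩ := exists_cylinder_subset hG x u w R h
        exact ⟨v, ⟨h1, h3⟩, h2⟩
      · rintro ⟨v, ⟨-, h3⟩, h2⟩
        exact h3 h2
    rw [this]
    exact MeasurableSet.biUnion (Set.to_countable _) fun v hv =>
      MeasurableSpace.measurableSet_generateFrom ⟨v, hv.1, rfl⟩
  · refine MeasurableSpace.generateFrom_le ?_
    rintro _ ⟨v, -, rfl⟩
    exact (isOpen_cylinder x v).measurableSet

theorem measurable_height_sub (hG : G.IsTree) (x y : V) :
    Measurable fun ω : Boundary G o => height ω y - height ω x :=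
  (isLocallyConstant_height_sub hG x y).continuous.measurable

open scoped NNReal in
/-- The measures `ν_x` are mutually absolutely continuous with explicit density. -/
theorem nu_eq_withDensity [G.LocallyFinite] (hG : G.IsTree) (hq1 : 1 ≤ q)
    (hq : G.IsRegularOfDegree (q + 1))
    (x z : V) : (nu q z : Measure (Boundary G o)) = (nu q x).withDensity
      fun ω => (((q : ℝ≥0) ^ (height ω z - height ω x) : ℝ≥0) : ENNReal) := by
  have hc : Countable V := countable_of_locallyFinite hG.1
  have := isProbabilityMeasure_nu (o := o) hG hq1 hq z
  refine Measure.ext_of_generateFrom_of_cover_subset (S := _) (T := _)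
    (measurableSpace_eq_generateFrom hG x (G.dist x z))
    (isPiSystem_cylinder hG x (G.dist x z)) subset_rfl ?_ ?_ (fun _ _ => measure_ne_top _ _) ?_
  · have : {C : Set (Boundary G o) | ∃ v, G.dist x z < G.dist x v ∧ C = cylinder G o x v} ⊆
        range fun v => cylinder G o x v := by
      rintro _ ⟨v, -, rfl⟩
      exact ⟨v, rfl⟩
    exact (countable_range _).mono this
  · refine eq_univ_of_forall fun ω => ?_
    obtain ⟨v, h1, h2, -⟩ := exists_cylinder_subset hG x x x (G.dist x z)
      (mem_cylinder_self hG.1 x ω)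
    exact ⟨_, ⟨v, h1, rfl⟩, h2⟩
  · rintro _ ⟨v, hv, rfl⟩
    have hm : MeasurableSet (cylinder G o x v) := (isOpen_cylinder x v).measurableSet
    have he := cylinder_eq_of_dist_lt (o := o) hG hv
    have hvx : v ≠ x := by rintro rfl; simp at hv
    have hvz : v ≠ z := by rintro rfl; simp at hv
    -- On a cylinder deeper than d(x, z) the density is constant, so only the two masses have to be
    -- compared.
    have hH : ∀ ω ∈ cylinder G o x v, (((q : ℝ≥0) ^ (height ω z - height ω x) : ℝ≥0) : ENNReal) =
        (((q : ℝ≥0) ^ ((G.dist x v : ℤ) - G.dist z v) : ℝ≥0) : ENNReal) := by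
      intro ω hω
      rw [height_sub_height hG.1 hω (he ▸ hω)]
    rw [withDensity_apply _ hm, setLIntegral_congr_fun hm hH, setLIntegral_const,
      (isUniformFrom_nu hG hq1 hq x).2 v hvx, he, (isUniformFrom_nu hG hq1 hq z).2 v hvz]
    have h1 := hG.1.pos_dist_of_ne hvx.symm
    have h2 := hG.1.pos_dist_of_ne hvz.symm
    obtain ⟨n, hn⟩ : ∃ n, G.dist x v = n + 1 := ⟨G.dist x v - 1, by omega⟩
    obtain ⟨m, hm⟩ : ∃ n, G.dist z v = n + 1 := ⟨G.dist z v - 1, by omega⟩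
    rw [hn, hm]
    have hq0 : (q : ℝ≥0) ≠ 0 := by positivity
    have hcast : ∀ k : ℕ, ((((q + 1) * q ^ k : ℕ) : ENNReal))⁻¹ =
        (((((q : ℝ≥0) + 1) * (q : ℝ≥0) ^ k)⁻¹ : ℝ≥0) : ENNReal) := by
      intro k
      rw [ENNReal.coe_inv (by positivity)]
      norm_cast
    rw [Nat.add_sub_cancel, Nat.add_sub_cancel, hcast, hcast, ← ENNReal.coe_mul]
    congr 1
    rw [zpow_sub₀ hq0]
    push_cast
    rw [zpow_add₀ hq0, zpow_add₀ hq0]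
    simp only [zpow_natCast, zpow_one]
    field_simp

theorem integral_nu [G.LocallyFinite] (hG : G.IsTree) (hq1 : 1 ≤ q)
    (hq : G.IsRegularOfDegree (q + 1))
    (x z : V) (φ : Boundary G o → ℂ) :
    ∫ ω, φ ω ∂(nu q z) = ∫ ω, (q : ℂ) ^ (height ω z - height ω x) * φ ω ∂(nu q x) := by
  rw [nu_eq_withDensity hG hq1 hq x z, integral_withDensity_eq_integral_smul]
  · refine integral_congr_ae (Eventually.of_forall fun ω => ?_)
    simp [NNReal.smul_def]
  · exact (measurable_of_countable (fun m : ℤ => (q : NNReal) ^ m)).comp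
      (measurable_height_sub hG x z)

end Measures

/-! ### Decomposition of the boundary along a segment -/

section Levels

variable {V : Type*} {G : SimpleGraph V} {o : V} {q : ℕ}

variable (G o) in
/-- The boundary points `ω` for which `[x, ω)` leaves the segment `[x, y]` at distance `j`. -/
def level (x y : V) (j : ℕ) : Set (Boundary G o) :=
  {ω | height ω y - height ω x = 2 * (j : ℤ) - G.dist x y}

theorem measurableSet_level [G.LocallyFinite] (hG : G.IsTree) (x y : V) (j : ℕ) :
    MeasurableSet (level G o x y j) :=
  measurable_height_sub hG x y (measurableSet_singleton _)

theorem level_subset_cylinder (hG : G.IsTree) {x y p : V}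
    (hp : G.dist x p + G.dist p y = G.dist x y) {j : ℕ} (hj : G.dist x p ≤ j) :
    level G o x y j ⊆ cylinder G o x p := by
  intro ω hω
  rw [mem_cylinder_iff_height hG hp, show height ω y - height ω x = _ from hω]
  omega

/-- The mass of the `j`-th level, normalized by `q ^ j`. -/
noncomputable def levelWeight (q d j : ℕ) : ℝ :=
  if d = 0 then 1 else if j = 0 ∨ j = d then q / (q + 1) else (q - 1) / (q + 1)

theorem levelWeight_nonneg (hq1 : 1 ≤ q) (d j : ℕ) : 0 ≤ levelWeight q d j := by
  have : (1 : ℝ) ≤ q := by exact_mod_cast hq1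
  unfold levelWeight
  split_ifs <;> positivity

theorem levelWeight_le_one (d j : ℕ) : levelWeight q d j ≤ 1 := by
  have : (0 : ℝ) ≤ q := by positivity
  unfold levelWeight
  split_ifs
  · rfl
  · rw [div_le_one (by linarith)]; linarith
  · rw [div_le_one (by linarith)]; linarith

/-- A level is the difference of two consecutive cylinders along [x, y], except for the last one,
which is a whole cylinder. In the interior this gives q/(q + 1) - 1/(q + 1); at j = 0 the larger
cylinder is all of Ω, and at j = d(x, y) nothing is removed. -/
theorem nu_real_level [G.LocallyFinite] (hG : G.IsTree) (hq1 : 1 ≤ q)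
    (hq : G.IsRegularOfDegree (q + 1)) (x y : V) {j : ℕ} (hj : j ≤ G.dist x y) :
    (nu q x : Measure (Boundary G o)).real (level G o x y j) * q ^ j =
      levelWeight q (G.dist x y) j := by
  have := isProbabilityMeasure_nu (o := o) hG hq1 hq x
  have hq0 : (q : ℝ) ≠ 0 := by positivity
  have hcyl : ∀ p, G.dist x p ≠ 0 → (nu q x : Measure (Boundary G o)).real (cylinder G o x p) *
      q ^ G.dist x p = q / (q + 1) := by
    intro p hp
    refine nu_real_cylinder hG hq1 hq ?_
    rintro rfl
    simp at hp
  have hcyl0 : ∀ p, G.dist x p = 0 → (nu q x : Measure (Boundary G o)).real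
      (cylinder G o x p) = 1 := by
    intro p hp
    rw [hG.1.dist_eq_zero_iff] at hp
    subst hp
    rw [cylinder_self hG.1, probReal_univ]
  obtain ⟨p, hp1, hp2⟩ := exists_dist_eq_of_le hG.1 x y hj
  rcases hj.lt_or_eq with hlt | heq
  · obtain ⟨p', hp1', hp2'⟩ := exists_dist_eq_of_le hG.1 x y (j := j + 1) hlt
    have hs : level G o x y j = cylinder G o x p \ cylinder G o x p' := by
      ext ω
      rw [Set.mem_sdiff, mem_cylinder_iff_height hG hp2, mem_cylinder_iff_height hG hp2', hp1, hp1']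
      obtain ⟨i, hi, he⟩ := exists_height_sub_eq hG x y ω
      show height ω y - height ω x = _ ↔ _
      rw [he]
      push_cast
      omega
    have hsub : cylinder G o x p' ⊆ cylinder G o x p :=
      cylinder_subset_cylinder hG.1 (dist_add_dist_of_le hG hp2 hp2' (by omega))
    have hc := hcyl p' (by omega)
    rw [hs, measureReal_sdiff hsub (isOpen_cylinder x p').measurableSet, levelWeight,
      if_neg (by omega)]
    rw [hp1'] at hc
    have hc' : (nu q x : Measure (Boundary G o)).real (cylinder G o x p') * q ^ j =
        1 / (q + 1) := by
      have h2 : (nu q x : Measure (Boundary G o)).real (cylinder G o x p') * q ^ j * q =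
        1 / (q + 1) * q := by rw [mul_assoc, ← pow_succ, hc]; ring
      exact mul_right_cancel₀ hq0 h2
    rw [sub_mul, hc']
    by_cases h0 : j = 0
    · rw [if_pos (Or.inl h0), hcyl0 p (by omega), h0]
      field_simp
      ring
    · have := hcyl p (by omega)
      rw [hp1] at this
      rw [if_neg (by omega), this]
      ring
  · have hs : level G o x y j = cylinder G o x p := by
      ext ω
      rw [mem_cylinder_iff_height hG hp2, hp1]
      obtain ⟨i, hi, he⟩ := exists_height_sub_eq hG x y ω
      show height ω y - height ω x = _ ↔ _
      rw [he]
      omega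
    rw [hs, levelWeight]
    split_ifs with h1 h2
    · rw [hcyl0 p (by omega)]
      simp [show j = 0 by omega]
    · have := hcyl p (by omega)
      rwa [hp1] at this
    · omega

theorem integral_height [G.LocallyFinite] (hG : G.IsTree) (x y : V)
    (φ : Boundary G o → ℤ → ℂ) (ν : Measure (Boundary G o))
    (hφ : ∀ m, Integrable (fun ω => φ ω m) ν) :
    ∫ ω, φ ω (height ω y - height ω x) ∂ν =
      ∑ j ∈ Finset.range (G.dist x y + 1),
        ∫ ω in level G o x y j, φ ω (2 * (j : ℤ) - G.dist x y) ∂ν := by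
  have h : ∀ ω, φ ω (height ω y - height ω x) = ∑ j ∈ Finset.range (G.dist x y + 1),
      (level G o x y j).indicator (fun ω => φ ω (2 * (j : ℤ) - G.dist x y)) ω := by
    intro ω
    obtain ⟨i, hi, he⟩ := exists_height_sub_eq hG x y ω
    rw [Finset.sum_eq_single i]
    · rw [indicator_of_mem (show ω ∈ level G o x y i from he), he]
    · intro j _ hj
      rw [indicator_of_notMem]
      intro hω
      have : height ω y - height ω x = _ := hω
      omega
    · intro h
      exact absurd (Finset.mem_range.2 (by omega)) h
  simp_rw [h]
  rw [integral_finsetSum _ fun j _ => (hφ _).indicator (measurableSet_level hG x y j)]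
  exact Finset.sum_congr rfl fun j _ => integral_indicator (measurableSet_level hG x y j)

end Levels

/-! ### The exponentials q^(ims) -/

section Waves

variable {q : ℕ}

/-- The oscillating factor `q ^ (i m s)`. -/
noncomputable def wave (q : ℕ) (m : ℤ) (s : ℝ) : ℂ :=
  Complex.exp ((m * (Real.log q * s) : ℝ) * Complex.I)

theorem norm_wave (m : ℤ) (s : ℝ) : ‖wave q m s‖ = 1 :=
  Complex.norm_exp_ofReal_mul_I _

theorem wave_ne_zero (m : ℤ) (s : ℝ) : wave q m s ≠ 0 := Complex.exp_ne_zero _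

theorem wave_zero (s : ℝ) : wave q 0 s = 1 := by simp [wave]

theorem wave_add (m n : ℤ) (s : ℝ) : wave q (m + n) s = wave q m s * wave q n s := by
  rw [wave, wave, wave, ← Complex.exp_add]
  congr 1
  push_cast
  ring

theorem wave_neg (m : ℤ) (s : ℝ) : wave q (-m) s = (wave q m s)⁻¹ := by
  rw [wave, wave, ← Complex.exp_neg]
  congr 1
  push_cast
  ring

theorem wave_neg_right (m : ℤ) (s : ℝ) : wave q m (-s) = wave q (-m) s := by
  rw [wave, wave]
  congr 2
  push_cast
  ring

theorem conj_wave (m : ℤ) (s : ℝ) : (starRingEnd ℂ) (wave q m s) = wave q (-m) s := by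
  rw [wave, wave, ← Complex.exp_conj, map_mul, Complex.conj_ofReal, Complex.conj_I]
  congr 1
  push_cast
  ring

theorem contDiff_wave (m : ℤ) : ContDiff ℝ ((⊤ : ℕ∞) : WithTop ℕ∞) (wave q m) := by
  unfold wave
  have : ContDiff ℝ ((⊤ : ℕ∞) : WithTop ℕ∞) fun s : ℝ => ((m * (Real.log q * s) : ℝ) : ℂ) :=
    Complex.ofRealCLM.contDiff.comp
      (contDiff_const.mul (contDiff_const.mul contDiff_id))
  exact (this.mul contDiff_const).cexp

theorem continuous_wave (m : ℤ) : Continuous (wave q m) := (contDiff_wave m).continuous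

theorem hasDerivAt_wave (m : ℤ) (s : ℝ) :
    HasDerivAt (wave q m) (wave q m s * ((m * Real.log q : ℝ) * Complex.I)) s := by
  have h1 : HasDerivAt (fun s : ℝ => m * (Real.log q * s)) (m * Real.log q) s := by
    simpa [mul_assoc] using ((hasDerivAt_id s).const_mul (Real.log q)).const_mul (m : ℝ)
  have h2 := (h1.ofReal_comp.mul_const Complex.I).cexp
  exact h2

theorem cpow_eq_wave (hq1 : 1 ≤ q) (m : ℤ) (s : ℝ) :
    (q : ℂ) ^ ((1 / 2 + Complex.I * (s : ℂ)) * (m : ℂ)) =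
      (((q : ℝ) ^ ((m : ℝ) / 2) : ℝ) : ℂ) * wave q m s := by
  have hq0 : (0 : ℝ) < q := by exact_mod_cast hq1
  have hq0' : (q : ℂ) ≠ 0 := by exact_mod_cast hq0.ne'
  rw [Complex.cpow_def_of_ne_zero hq0', ← Complex.natCast_log, Real.rpow_def_of_pos hq0, wave,
    Complex.ofReal_exp, ← Complex.exp_add]
  congr 1
  push_cast
  ring

theorem log_pos_of_two_le (hq : 2 ≤ q) : 0 < Real.log q :=
  Real.log_pos (by exact_mod_cast hq)

theorem tau_pos (hq : 2 ≤ q) : 0 < tau q := div_pos Real.pi_pos (log_pos_of_two_le hq)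

theorem norm_one_sub_wave_div_pos (hq : 2 ≤ q) (m : ℤ) (s : ℝ) :
    1 / 2 ≤ ‖1 - wave q m s / q‖ := by
  have hq' : (2 : ℝ) ≤ q := by exact_mod_cast hq
  have h1 : ‖wave q m s / q‖ ≤ 1 / 2 := by
    rw [norm_div, norm_wave, Complex.norm_natCast]
    exact one_div_le_one_div_of_le (by norm_num) hq'
  have h2 := norm_sub_norm_le (1 : ℂ) (wave q m s / q)
  rw [norm_one] at h2
  linarith

theorem one_sub_wave_div_ne_zero (hq : 2 ≤ q) (m : ℤ) (s : ℝ) : 1 - wave q m s / q ≠ 0 := by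
  have := norm_one_sub_wave_div_pos hq m s
  rw [← norm_pos_iff]
  linarith

end Waves

/-! ### The Plancherel density -/

section Density

variable {q : ℕ}

/-- The constant `2 c_P (q + 1)² / q²`. -/
noncomputable def kappa (q : ℕ) : ℝ := 2 * cPlancherel q * (q + 1) ^ 2 / q ^ 2

/-- A smooth quotient of the Plancherel density, see `dens_eq`. -/
noncomputable def densQuot (q : ℕ) (s : ℝ) : ℂ :=
  kappa q * (wave q (-2) s - 1) * ((1 - wave q 2 s / q) * (1 - wave q (-2) s / q))⁻¹

/-- The Plancherel density. -/
noncomputable def dens (q : ℕ) (s : ℝ) : ℂ := (wave q 2 s - 1) * densQuot q s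

/-- The factors in the denominator are 1 minus a number of modulus 1/q, hence never 0. -/
theorem contDiff_densQuot (hq : 2 ≤ q) :
    ContDiff ℝ ((⊤ : ℕ∞) : WithTop ℕ∞) (densQuot q) := by
  unfold densQuot
  have h : ∀ m, ContDiff ℝ ((⊤ : ℕ∞) : WithTop ℕ∞) fun s => 1 - wave q m s / q := fun m =>
    contDiff_const.sub ((contDiff_wave m).div_const _)
  refine (contDiff_const.mul ((contDiff_wave _).sub contDiff_const)).mul
    (((h _).mul (h _)).inv fun s => ?_)
  exact mul_ne_zero (one_sub_wave_div_ne_zero hq _ _) (one_sub_wave_div_ne_zero hq _ _)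

theorem continuous_dens (hq : 2 ≤ q) : Continuous (dens q) :=
  ((continuous_wave 2).sub continuous_const).mul (contDiff_densQuot hq).continuous

/-- Valid also at s = 0 and s = τ, where the denominators vanish: by the convention for division by
zero both sides are 0. The inverse of 0 is then 0, which is also the limit of |𝐜(s)|⁻², so the
density has no exceptional values at the ends. -/
theorem norm_cFun_sq (hq : 2 ≤ q) (s : ℝ) :
    ‖cFun q (s : ℂ)‖ ^ 2 =
      (q / (q + 1)) ^ 2 * (‖1 - wave q (-2) s / q‖ ^ 2 / ‖1 - wave q (-2) s‖ ^ 2) := by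
  have hq0 : (0 : ℝ) < q := by positivity
  have hq0' : (q : ℂ) ≠ 0 := by exact_mod_cast hq0.ne'
  have e1 : (q : ℂ) ^ (Complex.I * (s : ℂ)) = wave q 1 s := by
    rw [Complex.cpow_def_of_ne_zero hq0', ← Complex.natCast_log, wave]
    congr 1
    push_cast
    ring
  have e2 : (q : ℂ) ^ (-(Complex.I * (s : ℂ))) = (wave q 1 s)⁻¹ := by
    rw [Complex.cpow_neg, e1]
  have e3 : wave q (-2) s = ((wave q 1 s)⁻¹) ^ 2 := by
    rw [← wave_neg, pow_two, ← wave_add]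
    rfl
  have e4 : (q : ℂ) ^ (1 / 2 : ℂ) * (q : ℂ) ^ (1 / 2 : ℂ) = q := by
    rw [← Complex.cpow_add _ _ hq0']
    norm_num
  have hr : (q : ℂ) ^ (1 / 2 : ℂ) ≠ 0 := fun h => by
    rw [h, zero_mul] at e4
    exact hq0' e4.symm
  have hw := wave_ne_zero (q := q) 1 s
  have e5 : ‖(q : ℂ) ^ (1 / 2 : ℂ)‖ ^ 2 = q := by
    rw [pow_two, ← norm_mul, e4, Complex.norm_natCast]
  have e6 : ‖(q : ℂ) + 1‖ = q + 1 := by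
    rw [← Nat.cast_add_one, Complex.norm_natCast]
    push_cast
    ring
  unfold cFun
  rw [Complex.cpow_add _ _ hq0', Complex.cpow_sub _ _ hq0', Complex.cpow_neg, e1, e2]
  have n1 : (q : ℂ) ^ (1 / 2 : ℂ) * wave q 1 s -
      ((q : ℂ) ^ (1 / 2 : ℂ))⁻¹ / wave q 1 s =
      (q : ℂ) ^ (1 / 2 : ℂ) * wave q 1 s * (1 - wave q (-2) s / q) := by
    rw [e3]
    generalize (q : ℂ) ^ (1 / 2 : ℂ) = r at e4 hr
    rw [← e4]
    field_simp
  have n2 : wave q 1 s - (wave q 1 s)⁻¹ = wave q 1 s * (1 - wave q (-2) s) := by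
    rw [e3]
    field_simp
  rw [n1, n2]
  simp only [norm_mul, norm_div, norm_wave, e6, mul_pow, div_pow, e5, one_mul, mul_one]
  ring

theorem continuous_densReal (hq : 2 ≤ q) :
    Continuous fun s : ℝ => 2 * cPlancherel q * (‖cFun q (s : ℂ)‖ ^ 2)⁻¹ := by
  have hq0 : (0 : ℝ) < q := by positivity
  have : (fun s : ℝ => 2 * cPlancherel q * (‖cFun q (s : ℂ)‖ ^ 2)⁻¹) = fun s : ℝ =>
      2 * cPlancherel q * ((((q : ℝ) / (q + 1)) ^ 2)⁻¹ *
        (‖1 - wave q (-2) s‖ ^ 2 / ‖1 - wave q (-2) s / q‖ ^ 2)) := by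
    funext s
    rw [norm_cFun_sq hq, mul_inv, inv_div]
  rw [this]
  refine continuous_const.mul (continuous_const.mul (Continuous.div₀ ?_ ?_ fun s => ?_))
  · exact ((continuous_const.sub (continuous_wave _)).norm).pow 2
  · exact ((continuous_const.sub ((continuous_wave _).div_const _)).norm).pow 2
  · exact pow_ne_zero 2 (norm_ne_zero_iff.2 (one_sub_wave_div_ne_zero hq _ _))

theorem cPlancherel_nonneg : 0 ≤ cPlancherel q := by
  unfold cPlancherel
  have := Real.log_natCast_nonneg q
  positivity

/-- Writing squared moduli as z times its conjugate splits off the factor `wave q 2 s - 1`, the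
source of the telescoping in `coef_eq`. -/
theorem dens_eq (hq : 2 ≤ q) (s : ℝ) :
    dens q s = ((2 * cPlancherel q * (‖cFun q (s : ℂ)‖ ^ 2)⁻¹ : ℝ) : ℂ) := by
  have hq0 : (q : ℂ) ≠ 0 := by
    have : q ≠ 0 := by omega
    exact_mod_cast this
  have hq1 : (q : ℂ) + 1 ≠ 0 := by
    have : q + 1 ≠ 0 := by omega
    exact_mod_cast this
  rw [norm_cFun_sq hq, mul_inv, inv_div]
  have hn : ∀ z : ℂ, ((‖z‖ ^ 2 : ℝ) : ℂ) = z * (starRingEnd ℂ) z := fun z => by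
    rw [Complex.mul_conj, Complex.normSq_eq_norm_sq]
  have c1 : (starRingEnd ℂ) (1 - wave q (-2) s) = 1 - wave q 2 s := by
    rw [map_sub, conj_wave, map_one]; rfl
  have c2 : (starRingEnd ℂ) (1 - wave q (-2) s / q) = 1 - wave q 2 s / q := by
    rw [map_sub, map_div₀, conj_wave, map_one, map_natCast]; rfl
  have h1 := one_sub_wave_div_ne_zero hq 2 s
  have h2 := one_sub_wave_div_ne_zero hq (-2) s
  rw [Complex.ofReal_mul, Complex.ofReal_mul _ (_ / _), Complex.ofReal_div (_ ^ 2), hn, hn, c1, c2,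
    dens, densQuot, kappa, mul_inv]
  push_cast
  generalize (1 - wave q 2 s / (q : ℂ)) = A at *
  generalize (1 - wave q (-2) s / (q : ℂ)) = B at *
  field_simp
  ring

theorem integral_plancherel (hq : 2 ≤ q) (f : ℝ → ℂ) :
    ∫ s, f s ∂(plancherel q) = ∫ s in (0 : ℝ)..tau q, dens q s * f s := by
  rw [plancherel, integral_withDensity_eq_integral_toReal_smul]
  · rw [intervalIntegral.integral_of_le (tau_pos hq).le, ← integral_Icc_eq_integral_Ioc]
    refine integral_congr_ae (Eventually.of_forall fun s => ?_)
    show (ENNReal.ofReal _).toReal • f s = dens q s * f s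
    rw [ENNReal.toReal_ofReal (mul_nonneg (mul_nonneg (by norm_num) cPlancherel_nonneg)
      (by positivity)), dens_eq hq, Complex.real_smul]
  · exact (continuous_densReal hq).measurable.ennreal_ofReal
  · exact Eventually.of_forall fun s => ENNReal.ofReal_lt_top

theorem isFiniteMeasure_plancherel (hq : 2 ≤ q) : IsFiniteMeasure (plancherel q) := by
  refine isFiniteMeasure_withDensity_ofReal ?_
  exact ((continuous_densReal hq).continuousOn.integrableOn_Icc).2

theorem ae_mem_Icc_plancherel : ∀ᵐ s ∂(plancherel q), s ∈ Icc 0 (tau q) :=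
  (withDensity_absolutelyContinuous _ _).ae_le (ae_restrict_mem measurableSet_Icc)

end Density

/-! ### The Plancherel formula for the constant symbol -/

section Orthogonality

variable {q : ℕ}

theorem integral_wave (hq : 2 ≤ q) {m : ℤ} (hm : m ≠ 0) :
    ∫ s in (-tau q)..tau q, wave q m s = 0 := by
  have hl := (log_pos_of_two_le hq).ne'
  have hc : (((m * Real.log q : ℝ) : ℂ) * Complex.I) ≠ 0 := by
    simp [hm, hl, -Complex.ofReal_mul]
  have h1 : ∀ s ∈ Set.uIcc (-tau q) (tau q), HasDerivAt
      (fun s => wave q m s / (((m * Real.log q : ℝ) : ℂ) * Complex.I)) (wave q m s) s := by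
    intro s _
    have := (hasDerivAt_wave (q := q) m s).div_const (((m * Real.log q : ℝ) : ℂ) * Complex.I)
    rwa [mul_div_cancel_right₀ _ hc] at this
  rw [intervalIntegral.integral_eq_sub_of_hasDerivAt h1
    ((continuous_wave m).intervalIntegrable _ _), wave_neg_right, wave_neg, div_sub_div_same]
  have h2 : wave q m (tau q) * wave q m (tau q) = 1 := by
    rw [← wave_add, wave, Complex.exp_eq_one_iff]
    refine ⟨m, ?_⟩
    rw [tau, mul_div_cancel₀ _ hl]
    push_cast
    ring
  rw [← mul_left_cancel₀ (wave_ne_zero m (tau q)) (h2.trans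
    (mul_inv_cancel₀ (wave_ne_zero (q := q) m (tau q))).symm), sub_self, zero_div]

/-- The Fourier coefficients of the analytic function `1 / (1 - v ^ 2 / q)`. -/
theorem integral_wave_div (hq : 2 ≤ q) (k : ℕ) :
    ∫ s in (-tau q)..tau q, wave q k s * (1 - wave q 2 s / q)⁻¹ =
      if k = 0 then 2 * (tau q : ℂ) else 0 := by
  set J : ℕ → ℂ := fun k => ∫ s in (-tau q)..tau q, wave q k s * (1 - wave q 2 s / q)⁻¹ with hJ
  have hcont : ∀ m : ℤ, Continuous fun s => wave q m s * (1 - wave q 2 s / q)⁻¹ := fun m =>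
    (continuous_wave m).mul ((continuous_const.sub ((continuous_wave 2).div_const _)).inv₀
      (one_sub_wave_div_ne_zero hq 2))
  -- For k ≠ 0 the right-hand side is 0, so ‖J k‖ is at most half of ‖J (k + 2)‖. Iterating and
  -- using that J is bounded gives J k = 0 without expanding into a series.
  have hrec : ∀ k, J k - J (k + 2) / q = ∫ s in (-tau q)..tau q, wave q k s := by
    intro k
    have : J (k + 2) / q = ∫ s in (-tau q)..tau q,
        wave q (k + 2 : ℕ) s * (1 - wave q 2 s / q)⁻¹ / q := by
      rw [intervalIntegral.integral_div]
    rw [this, ← intervalIntegral.integral_sub ((hcont _).intervalIntegrable _ _)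
      (((hcont _).div_const _).intervalIntegrable _ _)]
    refine intervalIntegral.integral_congr fun s _ => ?_
    have h1 := one_sub_wave_div_ne_zero hq 2 s
    show wave q k s * (1 - wave q 2 s / q)⁻¹ - wave q (k + 2 : ℕ) s * (1 - wave q 2 s / q)⁻¹ / q = _
    rw [Nat.cast_add, wave_add, Nat.cast_ofNat]
    calc _ = wave q k s * ((1 - wave q 2 s / q) * (1 - wave q 2 s / q)⁻¹) := by ring
      _ = _ := by rw [mul_inv_cancel₀ h1, mul_one]
  have hbd : ∃ C, ∀ k, ‖J k‖ ≤ C := by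
    refine ⟨2 * |tau q - -tau q|, fun k => intervalIntegral.norm_integral_le_of_norm_le_const
      fun s _ => ?_⟩
    rw [norm_mul, norm_wave, one_mul, norm_inv]
    exact inv_le_of_inv_le₀ (by norm_num) (by linarith [norm_one_sub_wave_div_pos hq 2 s])
  have hzero : ∀ k, k ≠ 0 → J k = 0 := by
    obtain ⟨C, hC⟩ := hbd
    have hq' : (2 : ℝ) ≤ q := by exact_mod_cast hq
    have hn : ∀ n k, k ≠ 0 → ‖J k‖ ≤ C * (1 / 2) ^ n := by
      intro n
      induction n with
      | zero => intro k _; simpa using hC k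
      | succ n ih =>
        intro k hk
        have h1 := hrec k
        rw [integral_wave hq (by exact_mod_cast hk), sub_eq_zero] at h1
        rw [h1, norm_div, Complex.norm_natCast, pow_succ, ← mul_assoc, div_eq_mul_one_div]
        have h0 := (norm_nonneg (J (k + 2))).trans (ih (k + 2) (by omega))
        exact mul_le_mul (ih _ (by omega)) (one_div_le_one_div_of_le (by norm_num) hq')
          (by positivity) h0
    intro k hk
    have hlim : Tendsto (fun n : ℕ => C * (1 / 2 : ℝ) ^ n) atTop (𝓝 0) := by
      simpa using (tendsto_pow_atTop_nhds_zero_of_lt_one (by norm_num : (0 : ℝ) ≤ 1 / 2)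
        (by norm_num)).const_mul C
    exact norm_le_zero_iff.1 (ge_of_tendsto' hlim fun n => hn n k hk)
  show J k = _
  split_ifs with hk
  · subst hk
    have h := hrec 0
    rw [hzero (0 + 2) (by omega), zero_div, sub_zero] at h
    rw [h]
    simp only [Nat.cast_zero, wave_zero, intervalIntegral.integral_const]
    rw [Complex.real_smul]
    push_cast
    ring
  · exact hzero k hk

/-- Frequencies of consecutive levels differ by 2 and the interior weights are equal, so the factor
`wave q 2 s - 1` makes the interior telescope; only contributions of the two ends remain. -/
theorem sum_levelWeight_wave (d : ℕ) (s : ℝ) :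
    (∑ j ∈ Finset.range (d + 1), (levelWeight q d j : ℂ) * wave q (2 * (j : ℤ) - d) s) *
      (wave q 2 s - 1) =
    (q + 1 : ℂ)⁻¹ * (q * (wave q (d + 2) s - wave q (-d) s) -
      (wave q d s - wave q (2 - d) s)) := by
  have hq1 : (q : ℂ) + 1 ≠ 0 := by exact_mod_cast Nat.succ_ne_zero q
  cases d with
  | zero =>
    simp [levelWeight, wave_zero]
    field_simp
    ring
  | succ e =>
    have hs : ∀ m, wave q m s * (wave q 2 s - 1) = wave q (m + 2) s - wave q m s := fun m => by
      rw [wave_add]; ring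
    rw [Finset.sum_range_succ, Finset.sum_range_succ']
    have h0 : levelWeight q (e + 1) 0 = q / (q + 1) := by simp [levelWeight]
    have h1 : levelWeight q (e + 1) (e + 1) = q / (q + 1) := by simp [levelWeight]
    have h2 : ∀ j ∈ Finset.range e, (levelWeight q (e + 1) (j + 1) : ℂ) *
        wave q (2 * ((j + 1 : ℕ) : ℤ) - (e + 1 : ℕ)) s =
        ((q - 1) / (q + 1) : ℂ) * wave q (2 * (j : ℤ) + 1 - e) s := by
      intro j hj
      have := Finset.mem_range.1 hj
      rw [levelWeight, if_neg (by omega), if_neg (by omega)]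
      push_cast
      congr 2
      ring
    have h3 : (∑ j ∈ Finset.range e, wave q (2 * (j : ℤ) + 1 - e) s) * (wave q 2 s - 1) =
        wave q (e + 1) s - wave q (1 - e) s := by
      rw [Finset.sum_mul]
      have : ∀ j ∈ Finset.range e, wave q (2 * (j : ℤ) + 1 - e) s * (wave q 2 s - 1) =
          (fun j : ℕ => wave q (2 * (j : ℤ) + 1 - e) s) (j + 1) -
          (fun j : ℕ => wave q (2 * (j : ℤ) + 1 - e) s) j := by
        intro j _
        rw [hs]
        congr 2
        push_cast
        ring
      rw [Finset.sum_congr rfl this,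
        Finset.sum_range_sub (fun j : ℕ => wave q (2 * (j : ℤ) + 1 - e) s)]
      congr 2
      ring
    rw [Finset.sum_congr rfl h2, ← Finset.mul_sum, add_mul, add_mul, mul_assoc, h3, mul_assoc,
      hs, mul_assoc, hs, h0, h1]
    push_cast
    rw [show (0 - ((e : ℤ) + 1)) = -(e + 1) by ring,
      show (-((e : ℤ) + 1)) + 2 = 1 - e by ring,
      show (2 * ((e : ℤ) + 1) - (e + 1)) = e + 1 by ring,
      show (2 - ((e : ℤ) + 1)) = 1 - e by ring]
    field_simp
    ring

theorem kappa_mul_tau (hq : 2 ≤ q) : kappa q * tau q = (q + 1) / (2 * q) := by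
  have hl := (log_pos_of_two_le hq).ne'
  have hq0 : (q : ℝ) ≠ 0 := by positivity
  have hq1 : (q : ℝ) + 1 ≠ 0 := by positivity
  rw [kappa, tau, cPlancherel]
  field_simp [Real.pi_ne_zero]
  norm_num

/-- The left-hand side is the kernel of Op(1) at distance d, up to the factor q^(-d/2). Multiplied
by the density, the sum over the levels takes the form F(s) + F(-s), so the integral over [0, τ]
becomes the integral of F over a full period. F contains only nonnegative frequencies, and a
constant term only for d = 0. -/
theorem integral_sum_levelWeight (hq : 2 ≤ q) (d : ℕ) :
    ∑ j ∈ Finset.range (d + 1), (levelWeight q d j : ℂ) *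
      ∫ s, wave q (2 * (j : ℤ) - d) s ∂(plancherel q) = if d = 0 then 1 else 0 := by
  have hq0 : (q : ℂ) ≠ 0 := by
    have : q ≠ 0 := by omega
    exact_mod_cast this
  have hq1 : (q : ℂ) + 1 ≠ 0 := by exact_mod_cast Nat.succ_ne_zero q
  have hcont : ∀ m : ℤ, Continuous fun s => wave q m s * (1 - wave q 2 s / q)⁻¹ := fun m =>
    (continuous_wave m).mul ((continuous_const.sub ((continuous_wave 2).div_const _)).inv₀
      (one_sub_wave_div_ne_zero hq 2))
  set F : ℝ → ℂ := fun s => wave q d s * (1 - wave q 2 s / q)⁻¹ -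
    wave q (d + 2 : ℕ) s * (1 - wave q 2 s / q)⁻¹ with hF
  have hFc : Continuous F := (hcont _).sub (hcont _)
  have hpt : ∀ s, (∑ j ∈ Finset.range (d + 1), (levelWeight q d j : ℂ) *
      wave q (2 * (j : ℤ) - d) s) * dens q s = (kappa q * q / (q + 1) : ℂ) * (F s + F (-s)) := by
    intro s
    have h1 := one_sub_wave_div_ne_zero hq 2 s
    have h2 := one_sub_wave_div_ne_zero hq (-2) s
    have e1 : wave q (d + 2) s = wave q d s * wave q 2 s := wave_add _ _ _
    have e2 : wave q (2 - d) s = wave q (-d) s * wave q 2 s := by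
      rw [← wave_add]; congr 1; ring
    have e3 : wave q (-(d + 2)) s = wave q (-d) s * wave q (-2) s := by
      rw [← wave_add]; congr 1; ring
    have e4 : wave q 2 s * wave q (-2) s = 1 := by
      rw [← wave_add]; exact wave_zero s
    rw [dens, ← mul_assoc, sum_levelWeight_wave, hF, densQuot]
    simp only [wave_neg_right, Nat.cast_add, Nat.cast_ofNat]
    rw [e1, e2, e3]
    generalize wave q (-d) s = u at *
    generalize wave q d s = v at *
    generalize wave q 2 s = w at *
    generalize wave q (-2) s = w' at *
    rw [mul_inv]
    have k1 : (q : ℂ) - w ≠ 0 := by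
      intro h
      apply h1
      field_simp
      simpa using h
    have k2 : (q : ℂ) - w' ≠ 0 := by
      intro h
      apply h2
      field_simp
      simpa using h
    have f1 : (1 - w / (q : ℂ))⁻¹ = q * ((q : ℂ) - w)⁻¹ := by field_simp
    have f2 : (1 - w' / (q : ℂ))⁻¹ = q * ((q : ℂ) - w')⁻¹ := by field_simp
    rw [f1, f2]
    field_simp
    linear_combination v * (kappa q : ℂ) * (q - 1) * e4
  have hint : ∀ j, (levelWeight q d j : ℂ) * ∫ s, wave q (2 * (j : ℤ) - d) s ∂(plancherel q) =
      ∫ s in (0 : ℝ)..tau q, (levelWeight q d j : ℂ) * wave q (2 * (j : ℤ) - d) s * dens q s := by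
    intro j
    rw [integral_plancherel hq, ← intervalIntegral.integral_const_mul]
    refine intervalIntegral.integral_congr fun s _ => ?_
    show _ * (_ * _) = _ * _ * _
    ring
  simp_rw [hint]
  rw [← intervalIntegral.integral_finsetSum (f := fun (j : ℕ) s =>
    (levelWeight q d j : ℂ) * wave q (2 * (j : ℤ) - d) s * dens q s)
      fun j _ => ((continuous_const.mul
    (continuous_wave _)).mul (continuous_dens hq)).intervalIntegrable _ _]
  simp_rw [← Finset.sum_mul, hpt]
  rw [intervalIntegral.integral_const_mul, intervalIntegral.integral_add
    (hFc.intervalIntegrable _ _)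
    ((show Continuous fun s => F (-s) from hFc.comp continuous_neg).intervalIntegrable _ _),
    intervalIntegral.integral_comp_neg (fun s => F s), neg_zero,
    add_comm (∫ s in (0 : ℝ)..tau q, F s),
    intervalIntegral.integral_add_adjacent_intervals (hFc.intervalIntegrable _ _)
    (hFc.intervalIntegrable _ _), hF, intervalIntegral.integral_sub
    ((hcont _).intervalIntegrable _ _) ((hcont _).intervalIntegrable _ _),
    integral_wave_div hq, integral_wave_div hq]
  have hk : (kappa q : ℂ) * tau q = (q + 1) / (2 * q) := by
    rw [← Complex.ofReal_mul, kappa_mul_tau hq]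
    push_cast
    rfl
  rw [if_neg (show d + 2 ≠ 0 by omega), sub_zero]
  split_ifs with h
  · rw [show (kappa q * q / (q + 1) : ℂ) * (2 * tau q) =
      (kappa q * tau q) * (2 * q / (q + 1)) by ring, hk]
    field_simp
  · rw [mul_zero]

end Orthogonality

/-! ### Fourier coefficients of flat functions -/

section FlatFunctions

variable {q : ℕ}

/-- `f` is smooth on `[0, τ]`, vanishes to infinite order at both ends, and its derivatives of order
at most `N` are bounded by `B`. -/
structure IsFlat (q N : ℕ) (B : ℝ) (f : ℝ → ℂ) : Prop where
  smooth : ContDiffOn ℝ ((⊤ : ℕ∞) : WithTop ℕ∞) f (Icc 0 (tau q))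
  flat : ∀ k, iteratedDerivWithin k f (Icc 0 (tau q)) 0 = 0 ∧
    iteratedDerivWithin k f (Icc 0 (tau q)) (tau q) = 0
  bound : ∀ k ≤ N, ∀ s ∈ Icc 0 (tau q), ‖iteratedDerivWithin k f (Icc 0 (tau q)) s‖ ≤ B

theorem uniqueDiffOn_Icc_tau (hq : 2 ≤ q) : UniqueDiffOn ℝ (Icc 0 (tau q)) :=
  uniqueDiffOn_Icc (tau_pos hq)

theorem IsFlat.bound_zero {N : ℕ} {B : ℝ} {f : ℝ → ℂ} (hf : IsFlat q N B f) {s : ℝ}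
    (hs : s ∈ Icc 0 (tau q)) : ‖f s‖ ≤ B := by
  simpa using hf.bound 0 (Nat.zero_le _) s hs

theorem IsFlat.nonneg (hq : 2 ≤ q) {N : ℕ} {B : ℝ} {f : ℝ → ℂ} (hf : IsFlat q N B f) : 0 ≤ B :=
  (norm_nonneg _).trans (hf.bound_zero (left_mem_Icc.2 (tau_pos hq).le))

/-- Integration by parts, k times; flatness removes the boundary terms. Without it the decay would
stop at the first order, as [0, τ] is not a period of all the waves and `f` need not be periodic. -/
theorem integral_mul_wave (hq : 2 ≤ q) {N : ℕ} {B : ℝ} {f : ℝ → ℂ} (hf : IsFlat q N B f)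
    (m : ℤ) (k : ℕ) :
    (∫ s in (0 : ℝ)..tau q, f s * wave q m s) * (((m * Real.log q : ℝ) : ℂ) * Complex.I) ^ k =
      (-1) ^ k * ∫ s in (0 : ℝ)..tau q,
        iteratedDerivWithin k f (Icc 0 (tau q)) s * wave q m s := by
  have hu := uniqueDiffOn_Icc_tau hq
  have hI : Set.uIcc 0 (tau q) = Icc 0 (tau q) := uIcc_of_le (tau_pos hq).le
  have hc : ∀ k, ContinuousOn (iteratedDerivWithin k f (Icc 0 (tau q))) (Icc 0 (tau q)) :=
    fun k => hf.smooth.continuousOn_iteratedDerivWithin (by exact_mod_cast le_top) hu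
  induction k with
  | zero => simp
  | succ k ih =>
    rw [pow_succ, ← mul_assoc, ih, mul_assoc, ← intervalIntegral.integral_mul_const]
    have h1 := intervalIntegral.integral_mul_deriv_eq_deriv_mul_of_hasDerivWithinAt
      (a := 0) (b := tau q) (u := iteratedDerivWithin k f (Icc 0 (tau q)))
      (u' := iteratedDerivWithin (k + 1) f (Icc 0 (tau q))) (v := wave q m)
      (v' := fun s => wave q m s * (((m * Real.log q : ℝ) : ℂ) * Complex.I)) ?_ ?_ ?_ ?_
    · simp_rw [mul_assoc]
      rw [h1, (hf.flat k).1, (hf.flat k).2]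
      ring
    · rw [hI]
      intro s hs
      have h2 : DifferentiableOn ℝ (iteratedDerivWithin k f (Icc 0 (tau q))) (Icc 0 (tau q)) :=
        hf.smooth.differentiableOn_iteratedDerivWithin
          (by exact_mod_cast WithTop.coe_lt_top k) hu
      have h3 := (h2 s hs).hasDerivWithinAt
      rwa [← iteratedDerivWithin_succ] at h3
    · intro s _
      exact (hasDerivAt_wave m s).hasDerivWithinAt
    · refine ContinuousOn.intervalIntegrable ?_
      rw [hI]
      exact hc _
    · exact ((continuous_wave m).mul continuous_const).intervalIntegrable _ _

theorem norm_integral_mul_wave_le (hq : 2 ≤ q) {N : ℕ} {B : ℝ} {f : ℝ → ℂ}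
    (hf : IsFlat q N B f) (m : ℤ) {k : ℕ} (hk : k ≤ N) :
    ‖∫ s in (0 : ℝ)..tau q, f s * wave q m s‖ * (|(m : ℝ)| * Real.log q) ^ k ≤ B * tau q := by
  have h1 := congrArg norm (integral_mul_wave hq hf m k)
  have hl := (log_pos_of_two_le hq).le
  rw [norm_mul, norm_mul, norm_pow, norm_pow, norm_neg, norm_one, one_pow, one_mul, norm_mul,
    Complex.norm_I, mul_one, Complex.norm_real, Real.norm_eq_abs, abs_mul, abs_of_nonneg hl] at h1
  rw [h1]
  have h2 := intervalIntegral.norm_integral_le_of_norm_le_const (a := 0) (b := tau q) (C := B)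
    (f := fun s => iteratedDerivWithin k f (Icc 0 (tau q)) s * wave q m s) fun s hs => ?_
  · rwa [sub_zero, abs_of_pos (tau_pos hq)] at h2
  · rw [uIoc_of_le (tau_pos hq).le] at hs
    rw [norm_mul, norm_wave, mul_one]
    exact hf.bound k hk s (Ioc_subset_Icc_self hs)

theorem exists_norm_integral_mul_wave_le (hq : 2 ≤ q) (N : ℕ) :
    ∃ C, 0 ≤ C ∧ ∀ B f, IsFlat q N B f → ∀ m : ℤ,
      ‖∫ s in (0 : ℝ)..tau q, f s * wave q m s‖ ≤ C * B / (1 + |(m : ℝ)|) ^ N := by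
  have hl := log_pos_of_two_le hq
  have ht := tau_pos hq
  -- The summand 1 serves m = 0; for m ≠ 0 the factor 2 comes from 1 + |m| ≤ 2|m|.
  refine ⟨tau q * (1 + (2 / Real.log q) ^ N), by positivity, fun B f hf m => ?_⟩
  have hB := hf.nonneg hq
  rw [le_div_iff₀ (by positivity)]
  by_cases hm : m = 0
  · subst hm
    have := norm_integral_mul_wave_le hq hf 0 (Nat.zero_le N)
    rw [pow_zero, mul_one] at this
    simp only [Int.cast_zero, abs_zero, add_zero, one_pow, mul_one]
    have h2 : 0 ≤ (2 / Real.log q) ^ N := by positivity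
    nlinarith [mul_nonneg (mul_nonneg hB ht.le) h2]
  · have hm1 : (1 : ℝ) ≤ |(m : ℝ)| := by exact_mod_cast Int.one_le_abs hm
    have h1 := norm_integral_mul_wave_le hq hf m le_rfl
    have h2 : 1 + |(m : ℝ)| ≤ (|(m : ℝ)| * Real.log q) * (2 / Real.log q) := by
      rw [show (|(m : ℝ)| * Real.log q) * (2 / Real.log q) = 2 * |(m : ℝ)| by field_simp]
      linarith
    calc _ ≤ ‖∫ s in (0 : ℝ)..tau q, f s * wave q m s‖ *
          ((|(m : ℝ)| * Real.log q) * (2 / Real.log q)) ^ N := by gcongr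
      _ = (‖∫ s in (0 : ℝ)..tau q, f s * wave q m s‖ * (|(m : ℝ)| * Real.log q) ^ N) *
          (2 / Real.log q) ^ N := by rw [mul_pow]; ring
      _ ≤ (B * tau q) * (2 / Real.log q) ^ N := by gcongr
      _ ≤ _ := by nlinarith [mul_nonneg hB ht.le]

theorem IsFlat.mul_densQuot (hq : 2 ≤ q) (N : ℕ) :
    ∃ A, 0 ≤ A ∧ ∀ B f, IsFlat q N B f → IsFlat q N (A * B) fun s => f s * densQuot q s := by
  have hu := uniqueDiffOn_Icc_tau hq
  have hg := (contDiff_densQuot hq).contDiffOn (s := Icc 0 (tau q))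
  have hgb : ∀ k, ∃ D, ∀ s ∈ Icc 0 (tau q),
      ‖iteratedDerivWithin k (densQuot q) (Icc 0 (tau q)) s‖ ≤ D := fun k =>
    isCompact_Icc.exists_bound_of_continuousOn
      (hg.continuousOn_iteratedDerivWithin (m := k) (by exact_mod_cast le_top) hu)
  choose D hD using hgb
  have h0 : (0 : ℝ) ∈ Icc 0 (tau q) := left_mem_Icc.2 (tau_pos hq).le
  have hD0 : ∀ k, 0 ≤ D k := fun k => (norm_nonneg _).trans (hD k 0 h0)
  set A : ℕ → ℝ := fun k => ∑ i ∈ Finset.range (k + 1), (k.choose i : ℝ) * D (k - i) with hA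
  have hA0 : ∀ k, 0 ≤ A k := fun k =>
    Finset.sum_nonneg fun i _ => mul_nonneg (Nat.cast_nonneg _) (hD0 _)
  -- The Leibniz bound is kept pointwise in `s`: with B = 0 at the two ends it also yields the
  -- flatness of the product.
  have key : ∀ f, ContDiffOn ℝ ((⊤ : ℕ∞) : WithTop ℕ∞) f (Icc 0 (tau q)) → ∀ k B s,
      s ∈ Icc 0 (tau q) → (∀ i ≤ k, ‖iteratedDerivWithin i f (Icc 0 (tau q)) s‖ ≤ B) →
      ‖iteratedDerivWithin k (fun s => f s * densQuot q s) (Icc 0 (tau q)) s‖ ≤ A k * B := by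
    intro f hf k B s hs hB
    have h := norm_iteratedFDerivWithin_mul_le hf hg hu hs (n := k) (by exact_mod_cast le_top)
    simp only [norm_iteratedFDerivWithin_eq_norm_iteratedDerivWithin] at h
    refine h.trans ?_
    rw [hA, Finset.sum_mul]
    refine Finset.sum_le_sum fun i hi => ?_
    have h1 := hB i (by have := Finset.mem_range.1 hi; omega)
    have h2 := hD (k - i) s hs
    calc _ ≤ (k.choose i : ℝ) * B * D (k - i) := by
          have := (norm_nonneg _).trans h1
          gcongr
      _ = _ := by ring
  refine ⟨∑ k ∈ Finset.range (N + 1), A k, Finset.sum_nonneg fun k _ => hA0 k,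
    fun B f hf => ⟨hf.smooth.mul hg, fun k => ⟨?_, ?_⟩, fun k hk s hs => ?_⟩⟩
  · have := key f hf.smooth k 0 0 h0 fun i _ => by rw [(hf.flat i).1, norm_zero]
    rwa [mul_zero, norm_le_zero_iff] at this
  · have := key f hf.smooth k 0 (tau q) (right_mem_Icc.2 (tau_pos hq).le)
      fun i _ => by rw [(hf.flat i).2, norm_zero]
    rwa [mul_zero, norm_le_zero_iff] at this
  · refine (key f hf.smooth k B s hs fun i hi => hf.bound i (by omega) s hs).trans ?_
    exact mul_le_mul_of_nonneg_right (Finset.single_le_sum (f := A) (fun k _ => hA0 k)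
      (Finset.mem_range.2 (by omega))) (hf.nonneg hq)

/-- The Fourier coefficients of `f` for the Plancherel measure. -/
noncomputable def coef (q : ℕ) (f : ℝ → ℂ) (m : ℤ) : ℂ :=
  ∫ s, wave q m s * f s ∂(plancherel q)

/-- The Fourier coefficients of `f` times `densQuot`. -/
noncomputable def coefQuot (q : ℕ) (f : ℝ → ℂ) (m : ℤ) : ℂ :=
  ∫ s in (0 : ℝ)..tau q, f s * densQuot q s * wave q m s

/-- The factor `wave q 2 s - 1` of the density shifts the frequency by 2, which is exactly one step
from a level to the next. Sums over levels with constant weight therefore telescope. -/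
theorem coef_eq (hq : 2 ≤ q) {f : ℝ → ℂ} (hf : ContinuousOn f (Icc 0 (tau q))) (m : ℤ) :
    coef q f m = coefQuot q f (m + 2) - coefQuot q f m := by
  have hI : Set.uIcc 0 (tau q) = Icc 0 (tau q) := uIcc_of_le (tau_pos hq).le
  have hi : ∀ m, IntervalIntegrable (fun s => f s * densQuot q s * wave q m s) volume 0 (tau q) :=
    fun m => ContinuousOn.intervalIntegrable (by
      rw [hI]
      exact (hf.mul (contDiff_densQuot hq).continuous.continuousOn).mul
        (continuous_wave m).continuousOn)
  rw [coef, coefQuot, coefQuot, ← intervalIntegral.integral_sub (hi _) (hi _),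
    integral_plancherel hq]
  refine intervalIntegral.integral_congr fun s _ => ?_
  show dens q s * (wave q m s * f s) = _
  rw [wave_add, dens]
  ring

theorem exists_norm_coef_le (hq : 2 ≤ q) (N : ℕ) :
    ∃ C, 0 ≤ C ∧ ∀ B f, IsFlat q N B f → ∀ m : ℤ,
      ‖coef q f m‖ ≤ C * B / (1 + |(m : ℝ)|) ^ N ∧
      ‖coefQuot q f m‖ ≤ C * B / (1 + |(m : ℝ)|) ^ N := by
  obtain ⟨C, hC0, hC⟩ := exists_norm_integral_mul_wave_le hq N
  obtain ⟨A, hA0, hA⟩ := IsFlat.mul_densQuot hq N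
  -- The shifted term costs 3^N because 1 + |m| ≤ 3 (1 + |m + 2|).
  refine ⟨C * A * (3 ^ N + 1), by positivity, fun B f hf m => ?_⟩
  have hB := hf.nonneg hq
  have hQ : ∀ m, ‖coefQuot q f m‖ ≤ C * (A * B) / (1 + |(m : ℝ)|) ^ N := fun m =>
    hC _ _ (hA B f hf) m
  have hle : C * (A * B) / (1 + |(m : ℝ)|) ^ N ≤
      C * A * (3 ^ N + 1) * B / (1 + |(m : ℝ)|) ^ N := by
    refine div_le_div_of_nonneg_right ?_ (by positivity)
    have h3 : (0 : ℝ) ≤ 3 ^ N := by positivity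
    nlinarith [mul_nonneg (mul_nonneg (mul_nonneg hC0 hA0) hB) h3]
  refine ⟨?_, (hQ m).trans hle⟩
  rw [coef_eq hq hf.smooth.continuousOn]
  have h2 : C * (A * B) / (1 + |((m + 2 : ℤ) : ℝ)|) ^ N ≤
      C * (A * B) * 3 ^ N / (1 + |(m : ℝ)|) ^ N := by
    rw [div_le_div_iff₀ (by positivity) (by positivity), mul_assoc (C * (A * B)), ← mul_pow]
    gcongr
    have h4 : |(m : ℝ)| ≤ |((m + 2 : ℤ) : ℝ)| + 2 := by
      push_cast
      calc |(m : ℝ)| = |(m + 2 : ℝ) + (-2)| := by ring_nf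
        _ ≤ |(m + 2 : ℝ)| + |(-2 : ℝ)| := abs_add_le _ _
        _ = _ := by norm_num
    have h5 := abs_nonneg ((m + 2 : ℤ) : ℝ)
    linarith
  calc _ ≤ ‖coefQuot q f (m + 2)‖ + ‖coefQuot q f m‖ := norm_sub_le _ _
    _ ≤ C * (A * B) * 3 ^ N / (1 + |(m : ℝ)|) ^ N + C * (A * B) / (1 + |(m : ℝ)|) ^ N :=
      add_le_add ((hQ _).trans h2) (hQ m)
    _ = _ := by ring

theorem integrable_wave_mul (hq : 2 ≤ q) {f : ℝ → ℂ} (hf : ContinuousOn f (Icc 0 (tau q)))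
    (m : ℤ) : Integrable (fun s => wave q m s * f s) (plancherel q) := by
  have := isFiniteMeasure_plancherel hq
  have hc : ContinuousOn (fun s => wave q m s * f s) (Icc 0 (tau q)) :=
    (continuous_wave m).continuousOn.mul hf
  obtain ⟨C, hC⟩ := isCompact_Icc.exists_bound_of_continuousOn hc
  refine Integrable.of_bound ?_ C (ae_mem_Icc_plancherel.mono fun s hs => hC s hs)
  exact (hc.aestronglyMeasurable measurableSet_Icc).mono_ac (withDensity_absolutelyContinuous _ _)

theorem norm_coef_sub_le (hq : 2 ≤ q) {f g : ℝ → ℂ} (hf : ContinuousOn f (Icc 0 (tau q)))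
    (hg : ContinuousOn g (Icc 0 (tau q))) {δ : ℝ}
    (h : ∀ s ∈ Icc 0 (tau q), ‖f s - g s‖ ≤ δ) (m : ℤ) :
    ‖coef q f m - coef q g m‖ ≤ δ * (plancherel q).real univ := by
  have := isFiniteMeasure_plancherel hq
  rw [coef, coef, ← integral_sub (integrable_wave_mul hq hf m) (integrable_wave_mul hq hg m)]
  refine norm_integral_le_of_norm_le_const (ae_mem_Icc_plancherel.mono fun s hs => ?_)
  rw [← mul_sub, norm_mul, norm_wave, one_mul]
  exact h s hs

end FlatFunctions

/-! ### Rapid decay of kernels -/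

section Kernels

variable {V : Type*} {G : SimpleGraph V} {o : V} {q : ℕ}

/-- The kernel at `(x, y)` of the operator whose symbol at `x` is `c`. -/
noncomputable def kernel (q : ℕ) (c : Boundary G o → ℝ → ℂ) (x y : V) : ℂ :=
  ∫ ω, ∫ s, (q : ℂ) ^ ((1 / 2 + Complex.I * (s : ℂ)) * ((height ω y - height ω x : ℤ) : ℂ)) *
    c ω s ∂(plancherel q) ∂(nu q x)

theorem kernel_eq_integral_coef (hq1 : 1 ≤ q) (c : Boundary G o → ℝ → ℂ) (x y : V) :
    kernel q c x y = ∫ ω, (((q : ℝ) ^ (((height ω y - height ω x : ℤ) : ℝ) / 2) : ℝ) : ℂ) *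
      coef q (c ω) (height ω y - height ω x) ∂(nu q x) := by
  unfold kernel coef
  refine integral_congr_ae (Eventually.of_forall fun ω => ?_)
  show ∫ s, _ ∂_ = _ * ∫ s, _ ∂_
  simp_rw [cpow_eq_wave hq1]
  rw [← integral_const_mul]
  simp_rw [mul_assoc]

theorem rpow_level (hq1 : 1 ≤ q) (j d : ℕ) :
    (q : ℝ) ^ (((2 * (j : ℤ) - d : ℤ) : ℝ) / 2) = (q : ℝ) ^ (-(d : ℝ) / 2) * q ^ j := by
  have hq0 : (0 : ℝ) < q := by exact_mod_cast hq1
  rw [← Real.rpow_natCast, ← Real.rpow_add hq0]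
  congr 1
  push_cast
  ring

/-- Decomposition of a kernel according to the vertex where `[x, ω)` leaves `[x, y]`. -/
theorem kernel_eq_sum [G.LocallyFinite] (hG : G.IsTree) (hq1 : 1 ≤ q)
    (c : Boundary G o → ℝ → ℂ) (x y : V)
    (hc : ∀ m, Integrable (fun ω => coef q (c ω) m) (nu q x)) :
    kernel q c x y = (((q : ℝ) ^ (-(G.dist x y : ℝ) / 2) : ℝ) : ℂ) *
      ∑ j ∈ Finset.range (G.dist x y + 1), (q : ℂ) ^ j *
        ∫ ω in level G o x y j, coef q (c ω) (2 * (j : ℤ) - G.dist x y) ∂(nu q x) := by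
  rw [kernel_eq_integral_coef hq1, integral_height hG x y (fun ω m =>
    (((q : ℝ) ^ ((m : ℝ) / 2) : ℝ) : ℂ) * coef q (c ω) m) _ fun m => (hc m).const_mul _,
    Finset.mul_sum]
  refine Finset.sum_congr rfl fun j _ => ?_
  rw [integral_const_mul, rpow_level hq1]
  push_cast
  ring

/-- Supplies the measurability in ω that all integrals over levels rely on. The exponent N + 1
ensures that the oscillation tends to 0. -/
theorem continuous_coef [G.LocallyFinite] (hG : G.IsTree) (hq : 2 ≤ q) {x : V}
    {c : Boundary G o → ℝ → ℂ} (hc : ∀ ω, ContinuousOn (c ω) (Icc 0 (tau q))) {B : ℝ} {N : ℕ}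
    (hosc : ∀ v, ∀ ω ∈ cylinder G o x v, ∀ ω' ∈ cylinder G o x v, ∀ s ∈ Icc 0 (tau q),
      ‖c ω s - c ω' s‖ ≤ B / (1 + (G.dist x v : ℝ)) ^ (N + 1)) (m : ℤ) :
    Continuous fun ω => coef q (c ω) m := by
  rw [continuous_iff_continuousAt]
  intro ω
  rw [ContinuousAt, Metric.tendsto_nhds]
  intro δ hδ
  have hlim : Tendsto (fun n : ℕ => |B| / (1 + (n : ℝ)) * (plancherel q).real univ) atTop
      (𝓝 0) := by
    have h1 : Tendsto (fun n : ℕ => 1 + (n : ℝ)) atTop atTop :=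
      tendsto_atTop_add_const_left _ _ tendsto_natCast_atTop_atTop
    simpa using (h1.const_div_atTop |B|).mul_const ((plancherel q).real univ)
  obtain ⟨n, hn⟩ := (hlim.eventually (gt_mem_nhds hδ)).exists
  obtain ⟨p, hp, hω⟩ := exists_ray hG x ω
  filter_upwards [(isOpen_cylinder x (p n)).mem_nhds (hω n)] with ω' hω'
  rw [dist_eq_norm]
  refine (norm_coef_sub_le hq (hc ω') (hc ω) (hosc (p n) ω' hω' ω (hω n)) m).trans_lt
    (lt_of_le_of_lt ?_ hn)
  rw [hp]
  gcongr
  · exact le_abs_self B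
  · exact le_self_pow₀ (by linarith [(Nat.cast_nonneg n : (0 : ℝ) ≤ n)]) (by omega)

/-- Absolute values do not suffice: near the middle levels, 2j = d, the Fourier coefficients are not
small. For levels below about d/4 the frequency is of order d and the coefficients are small. All
other levels lie in one cylinder of depth about d/4, on which the symbol is almost constant in ω;
replacing it by a constant, the sum telescopes to terms of frequency of order d. -/
theorem exists_norm_kernel_le [G.LocallyFinite] (hG : G.IsTree) (hq : 2 ≤ q)
    (hreg : G.IsRegularOfDegree (q + 1)) (N : ℕ) :
    ∃ C, 0 ≤ C ∧ ∀ (B : ℝ) (x : V) (c : Boundary G o → ℝ → ℂ),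
      (∀ ω, IsFlat q (N + 1) B (c ω)) →
      (∀ v, ∀ ω ∈ cylinder G o x v, ∀ ω' ∈ cylinder G o x v, ∀ s ∈ Icc 0 (tau q),
        ‖c ω s - c ω' s‖ ≤ B / (1 + (G.dist x v : ℝ)) ^ (N + 1)) → ∀ y,
      ‖kernel q c x y‖ ≤
        C * B * ((q : ℝ) ^ (-(G.dist x y : ℝ) / 2) / (1 + (G.dist x y : ℝ)) ^ N) := by
  obtain ⟨C, hC0, hC⟩ := exists_norm_coef_le hq (N + 1)
  set M := (plancherel q).real univ with hM
  have hM0 : 0 ≤ M := measureReal_nonneg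
  -- `C + M` bounds each of the d + 1 comparisons with the frozen symbol, whose number costs one
  -- power of 1 + d; `3 * C` bounds the telescoped sum; 8 is the loss in comparing the frequencies
  -- with d.
  refine ⟨(4 * C + M) * 8 ^ (N + 1), by positivity, fun B x c hc hosc y => ?_⟩
  have hq1 : 1 ≤ q := by omega
  have := isProbabilityMeasure_nu (o := o) hG hq1 hreg x
  have hcont := continuous_coef hG hq (fun ω => (hc ω).smooth.continuousOn) hosc
  obtain ⟨ω₀, -⟩ := cylinder_nonempty (o := o) hG hq1 hreg x x
  have hB : 0 ≤ B := (hc ω₀).nonneg hq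
  have hbd : ∀ m ω, ‖coef q (c ω) m‖ ≤ C * B := fun m ω =>
    ((hC B _ (hc ω) m).1).trans (div_le_self (by positivity)
      (one_le_pow₀ (by linarith [abs_nonneg (m : ℝ)])))
  have hint : ∀ m, Integrable (fun ω => coef q (c ω) m) (nu q x) := fun m => by
    have : Countable V := countable_of_locallyFinite hG.1
    have := secondCountable_boundary (G := G) (o := o)
    exact Integrable.of_bound (hcont m).aestronglyMeasurable (C * B)
      (Eventually.of_forall fun ω => hbd m ω)
  obtain ⟨d, hd⟩ : ∃ d, d = G.dist x y := ⟨_, rfl⟩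
  rw [kernel_eq_sum hG hq1 c x y hint, ← hd, norm_mul, Complex.norm_real, Real.norm_of_nonneg
    (by positivity)]
  -- The summand 1 keeps j = 0, whose weight is exceptional, out of the telescoping range. For d = 0
  -- it makes that range empty.
  set n := d / 4 + 1 with hn
  have hD : (0 : ℝ) < 1 + d := by positivity
  -- the scale at which the bounds for the single terms are compared
  have hscale : ∀ m : ℤ, 1 + (d : ℤ) ≤ 8 * (1 + m) ∨ 1 + (d : ℤ) ≤ 8 * (1 - m) → ∀ K : ℝ, 0 ≤ K →
      K / (1 + |(m : ℝ)|) ^ (N + 1) ≤ K * 8 ^ (N + 1) / (1 + (d : ℝ)) ^ (N + 1) := by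
    intro m hm K hK
    rw [div_le_div_iff₀ (by positivity) (by positivity), mul_assoc, ← mul_pow]
    gcongr
    have h1 := le_abs_self (m : ℝ)
    have h2 := neg_abs_le (m : ℝ)
    rcases hm with hm | hm
    · have h3 : (1 : ℝ) + d ≤ 8 * (1 + m) := by exact_mod_cast hm
      linarith
    · have h3 : (1 : ℝ) + d ≤ 8 * (1 - m) := by exact_mod_cast hm
      linarith
  -- A single boundary point serves all levels from n on, since they lie behind the vertex of [x, y]
  -- at distance n from x. Telescoping needs the same point on each level.
  obtain ⟨ω₁, hω₁⟩ : ∃ ω₁, ∀ j, n ≤ j → j ≤ d → ∀ ω ∈ level G o x y j, ∀ s ∈ Icc 0 (tau q),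
      ‖c ω s - c ω₁ s‖ ≤ B / (1 + (n : ℝ)) ^ (N + 1) := by
    by_cases hnd : n ≤ d
    · obtain ⟨p, hp1, hp2⟩ := exists_dist_eq_of_le hG.1 x y (j := n) (by omega)
      obtain ⟨ω₁, hω₁⟩ := cylinder_nonempty (o := o) hG hq1 hreg x p
      refine ⟨ω₁, fun j hj _ ω hω s hs => ?_⟩
      have := hosc p ω (level_subset_cylinder hG hp2 (by omega) hω) ω₁ hω₁ s hs
      rwa [hp1] at this
    · exact ⟨ω₀, fun j h1 h2 => absurd (h1.trans h2) hnd⟩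
  set U : ℕ → ℂ := fun j => if j < n then 0 else
    (levelWeight q d j : ℂ) * coef q (c ω₁) (2 * (j : ℤ) - d) with hU
  have hlev : ∀ j ≤ d, (nu q x : Measure (Boundary G o)).real (level G o x y j) * q ^ j =
      levelWeight q d j := fun j hj => by
    rw [hd]; exact nu_real_level hG hq1 hreg x y (hd ▸ hj)
  -- each integral over a level, compared with its value for a frozen symbol
  have hterm : ∀ j ∈ Finset.range (d + 1), ‖(q : ℂ) ^ j * ∫ ω in level G o x y j,
      coef q (c ω) (2 * (j : ℤ) - d) ∂(nu q x) - U j‖ ≤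
      (C + M) * B * 8 ^ (N + 1) / (1 + (d : ℝ)) ^ (N + 1) := by
    intro j hj
    have hjd : j ≤ d := by have := Finset.mem_range.1 hj; omega
    have hw := levelWeight_le_one (q := q) d j
    have hw0 := levelWeight_nonneg hq1 d j
    by_cases hjn : j < n
    · rw [hU]
      simp only [hjn, if_true, sub_zero]
      have h1 : ‖∫ ω in level G o x y j, coef q (c ω) (2 * (j : ℤ) - d) ∂(nu q x)‖ ≤
          C * B / (1 + |((2 * (j : ℤ) - d : ℤ) : ℝ)|) ^ (N + 1) *
            (nu q x : Measure (Boundary G o)).real (level G o x y j) :=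
        norm_setIntegral_le_of_norm_le_const (measure_lt_top _ _)
          fun ω _ => (hC B _ (hc ω) _).1
      have h2 := hscale (2 * (j : ℤ) - d) (by omega) (C * B) (by positivity)
      rw [norm_mul, norm_pow, Complex.norm_natCast]
      calc _ ≤ (q : ℝ) ^ j * (C * B / (1 + |((2 * (j : ℤ) - d : ℤ) : ℝ)|) ^ (N + 1) *
            (nu q x : Measure (Boundary G o)).real (level G o x y j)) := by gcongr
        _ = C * B / (1 + |((2 * (j : ℤ) - d : ℤ) : ℝ)|) ^ (N + 1) * levelWeight q d j := by
          rw [← hlev j hjd]; ring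
        _ ≤ C * B / (1 + |((2 * (j : ℤ) - d : ℤ) : ℝ)|) ^ (N + 1) :=
          mul_le_of_le_one_right (by positivity) hw
        _ ≤ C * B * 8 ^ (N + 1) / (1 + (d : ℝ)) ^ (N + 1) := h2
        _ ≤ _ := by gcongr; linarith
    · have hjn' : n ≤ j := not_lt.1 hjn
      rw [hU]
      simp only [hjn, if_false]
      have h1 : (q : ℂ) ^ j * ∫ ω in level G o x y j, coef q (c ω) (2 * (j : ℤ) - d) ∂(nu q x) -
          (levelWeight q d j : ℂ) * coef q (c ω₁) (2 * (j : ℤ) - d) =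
          (q : ℂ) ^ j * ∫ ω in level G o x y j, (coef q (c ω) (2 * (j : ℤ) - d) -
            coef q (c ω₁) (2 * (j : ℤ) - d)) ∂(nu q x) := by
        rw [integral_sub (hint _).integrableOn (integrable_const _), setIntegral_const,
          ← hlev j hjd, Complex.real_smul]
        push_cast
        ring
      have h2 : ‖∫ ω in level G o x y j, (coef q (c ω) (2 * (j : ℤ) - d) -
            coef q (c ω₁) (2 * (j : ℤ) - d)) ∂(nu q x)‖ ≤ B / (1 + (n : ℝ)) ^ (N + 1) * M *
            (nu q x : Measure (Boundary G o)).real (level G o x y j) :=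
        norm_setIntegral_le_of_norm_le_const (measure_lt_top _ _)
          fun ω hω => norm_coef_sub_le hq (hc ω).smooth.continuousOn
            (hc ω₁).smooth.continuousOn (hω₁ j hjn' hjd ω hω) _
      have h3 := hscale n (by omega) (B * M) (by positivity)
      rw [Int.cast_natCast, abs_of_nonneg (by positivity : (0 : ℝ) ≤ n)] at h3
      rw [h1, norm_mul, norm_pow, Complex.norm_natCast]
      calc _ ≤ (q : ℝ) ^ j * (B / (1 + (n : ℝ)) ^ (N + 1) * M *
            (nu q x : Measure (Boundary G o)).real (level G o x y j)) := by gcongr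
        _ = B * M / (1 + (n : ℝ)) ^ (N + 1) * levelWeight q d j := by
          rw [← hlev j hjd]; ring
        _ ≤ B * M / (1 + (n : ℝ)) ^ (N + 1) := mul_le_of_le_one_right (by positivity) hw
        _ ≤ B * M * 8 ^ (N + 1) / (1 + (d : ℝ)) ^ (N + 1) := h3
        _ ≤ _ := by
          rw [mul_comm B M]
          gcongr
          linarith
  -- the frozen terms telescope
  have hsumU : ‖∑ j ∈ Finset.range (d + 1), U j‖ ≤
      3 * C * B * 8 ^ (N + 1) / (1 + (d : ℝ)) ^ (N + 1) := by
    by_cases hd0 : d = 0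
    · have : ∑ j ∈ Finset.range (d + 1), U j = 0 := by
        refine Finset.sum_eq_zero fun j hj => ?_
        have := Finset.mem_range.1 hj
        rw [hU]
        simp only [if_pos (show j < n by omega)]
      rw [this, norm_zero]
      positivity
    · have hnd : n ≤ d := by omega
      -- The last level has another weight than the interior ones and is kept apart.
      have h1 : ∑ j ∈ Finset.range (d + 1), U j =
          ((q - 1) / (q + 1) : ℝ) * (coefQuot q (c ω₁) d - coefQuot q (c ω₁) (2 * (n : ℤ) - d)) +
            levelWeight q d d * coef q (c ω₁) d := by
        rw [Finset.sum_range_succ, ← Finset.sum_range_add_sum_Ico _ hnd,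
          Finset.sum_eq_zero (s := Finset.range n), zero_add]
        · congr 1
          · have h2 : ∀ j ∈ Finset.Ico n d, U j = ((q - 1) / (q + 1) : ℝ) *
                ((fun j : ℕ => coefQuot q (c ω₁) (2 * (j : ℤ) - d)) (j + 1) -
                  (fun j : ℕ => coefQuot q (c ω₁) (2 * (j : ℤ) - d)) j) := by
              intro j hj
              have hj' := Finset.mem_Ico.1 hj
              rw [hU]
              simp only [if_neg (show ¬ j < n by omega)]
              rw [levelWeight, if_neg hd0, if_neg (by omega),
                coef_eq hq (hc ω₁).smooth.continuousOn]
              congr 3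
              push_cast
              ring
            rw [Finset.sum_congr rfl h2, ← Finset.mul_sum, Finset.sum_Ico_sub
              (fun j : ℕ => coefQuot q (c ω₁) (2 * (j : ℤ) - d)) hnd]
            congr 3
            ring
          · rw [hU]
            simp only [if_neg (show ¬ d < n by omega)]
            congr 2
            ring
        · intro j hj
          rw [hU]
          simp only [if_pos (Finset.mem_range.1 hj)]
      have hr : ‖(((q - 1) / (q + 1) : ℝ) : ℂ)‖ ≤ 1 := by
        have : (1 : ℝ) ≤ q := by exact_mod_cast hq1
        rw [Complex.norm_real, Real.norm_of_nonneg (div_nonneg (by linarith) (by linarith)),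
          div_le_one (by linarith)]
        linarith
      have hr' : ‖(levelWeight q d d : ℂ)‖ ≤ 1 := by
        rw [Complex.norm_real, Real.norm_of_nonneg (levelWeight_nonneg hq1 d d)]
        exact levelWeight_le_one d d
      have b1 := ((hC B _ (hc ω₁) d).2).trans (hscale d (by omega) (C * B) (by positivity))
      have b2 := ((hC B _ (hc ω₁) (2 * (n : ℤ) - d)).2).trans
        (hscale (2 * (n : ℤ) - d) (by omega) (C * B) (by positivity))
      have b3 := ((hC B _ (hc ω₁) d).1).trans (hscale d (by omega) (C * B) (by positivity))
      rw [h1]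
      calc _ ≤ ‖(((q - 1) / (q + 1) : ℝ) : ℂ)‖ *
            (‖coefQuot q (c ω₁) d‖ + ‖coefQuot q (c ω₁) (2 * (n : ℤ) - d)‖) +
            ‖(levelWeight q d d : ℂ)‖ * ‖coef q (c ω₁) d‖ := by
            refine (norm_add_le _ _).trans ?_
            rw [norm_mul, norm_mul]
            gcongr
            exact norm_sub_le _ _
        _ ≤ 1 * (C * B * 8 ^ (N + 1) / (1 + (d : ℝ)) ^ (N + 1) +
            C * B * 8 ^ (N + 1) / (1 + (d : ℝ)) ^ (N + 1)) +
            1 * (C * B * 8 ^ (N + 1) / (1 + (d : ℝ)) ^ (N + 1)) := by gcongr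
        _ = _ := by ring
  have hsum : ‖∑ j ∈ Finset.range (d + 1), (q : ℂ) ^ j * ∫ ω in level G o x y j,
      coef q (c ω) (2 * (j : ℤ) - d) ∂(nu q x)‖ ≤
      (4 * C + M) * 8 ^ (N + 1) * B / (1 + (d : ℝ)) ^ N := by
    have h1 : ∑ j ∈ Finset.range (d + 1), (q : ℂ) ^ j * ∫ ω in level G o x y j,
        coef q (c ω) (2 * (j : ℤ) - d) ∂(nu q x) =
        ∑ j ∈ Finset.range (d + 1), ((q : ℂ) ^ j * ∫ ω in level G o x y j,
          coef q (c ω) (2 * (j : ℤ) - d) ∂(nu q x) - U j) +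
          ∑ j ∈ Finset.range (d + 1), U j := by
      rw [← Finset.sum_add_distrib]
      simp
    have h2 := Finset.sum_le_card_nsmul (Finset.range (d + 1)) _ _ hterm
    rw [Finset.card_range, nsmul_eq_mul] at h2
    rw [h1]
    calc _ ≤ ((d + 1 : ℕ) : ℝ) * ((C + M) * B * 8 ^ (N + 1) / (1 + (d : ℝ)) ^ (N + 1)) +
          3 * C * B * 8 ^ (N + 1) / (1 + (d : ℝ)) ^ (N + 1) :=
          (norm_add_le _ _).trans (add_le_add ((norm_sum_le _ _).trans h2) hsumU)
      _ ≤ ((d + 1 : ℕ) : ℝ) * ((C + M) * B * 8 ^ (N + 1) / (1 + (d : ℝ)) ^ (N + 1)) +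
          ((d + 1 : ℕ) : ℝ) * (3 * C * B * 8 ^ (N + 1) / (1 + (d : ℝ)) ^ (N + 1)) := by
          gcongr
          refine le_mul_of_one_le_left (by positivity) ?_
          push_cast
          linarith [(Nat.cast_nonneg d : (0 : ℝ) ≤ d)]
      _ = _ := by
          push_cast
          rw [pow_succ (1 + (d : ℝ))]
          field_simp
          ring
  calc _ ≤ (q : ℝ) ^ (-(d : ℝ) / 2) * ((4 * C + M) * 8 ^ (N + 1) * B / (1 + (d : ℝ)) ^ N) := by
        gcongr
    _ = _ := by ring

end Kernels

/-! ### Parseval's identity without completeness -/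

section Parseval

/-- Parseval's identity for an orthonormal family that need not be complete. -/
theorem hasSum_inner_mul_inner_of_mem_closure {ι E : Type*} [NormedAddCommGroup E]
    [InnerProductSpace ℂ E] [CompleteSpace E] {e : ι → E} (he : Orthonormal ℂ e) {f : E}
    (hf : f ∈ (Submodule.span ℂ (range e)).topologicalClosure) (g : E) :
    HasSum (fun i => inner ℂ g (e i) * inner ℂ (e i) f) (inner ℂ g f) := by
  obtain ⟨w, b, hw, hb⟩ := he.toSubtypeRange.exists_hilbertBasis_extension
  have h := b.hasSum_inner_mul_inner g f
  have hinj : Function.Injective fun i => (⟨e i, hw ⟨i, rfl⟩⟩ : w) := fun i j hij =>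
    he.linearIndependent.injective (congrArg Subtype.val hij)
  have hbe : ∀ i, b ⟨e i, hw ⟨i, rfl⟩⟩ = e i := fun i => by rw [hb]
  refine (hinj.hasSum_iff (f := fun i => inner ℂ g (b i) * inner ℂ (b i) f) ?_).2 h |>.congr_fun
    ?_
  · intro v hv
    -- A basis vector outside the given family is orthogonal to its closed span, hence to `f`, and
    -- contributes nothing to the sum.
    have hperp : Submodule.span ℂ (range e) ≤ (ℂ ∙ b v)ᗮ := by
      rw [Submodule.span_le]
      rintro _ ⟨i, rfl⟩
      rw [SetLike.mem_coe, Submodule.mem_orthogonal_singleton_iff_inner_right, ← hbe i]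
      exact b.orthonormal.2 fun hvi => hv ⟨i, hvi.symm⟩
    have hf' := Submodule.topologicalClosure_minimal _ hperp
      (Submodule.isClosed_orthogonal _) hf
    rw [Submodule.mem_orthogonal_singleton_iff_inner_right] at hf'
    show inner ℂ g (b v) * inner ℂ (b v) f = 0
    rw [hf', mul_zero]
  · intro i
    simp [hbe]

end Parseval

/-! ### Plane waves -/

section PlaneWaves

variable {V : Type*} {G : SimpleGraph V} {o : V} {q : ℕ}

/-- `q ^ ((1/2 - i s) m)`. -/
noncomputable def growth (q : ℕ) (m : ℤ) (s : ℝ) : ℂ :=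
  (((q : ℝ) ^ ((m : ℝ) / 2) : ℝ) : ℂ) * wave q (-m) s

/-- The plane wave `q ^ ((1/2 - i s) (h_ω(z) - h_ω(x)))`. -/
noncomputable def planeWave (q : ℕ) (x z : V) (ω : Boundary G o) (s : ℝ) : ℂ :=
  growth q (height ω z - height ω x) s

theorem norm_growth (m : ℤ) (s : ℝ) : ‖growth q m s‖ = (q : ℝ) ^ ((m : ℝ) / 2) := by
  rw [growth, norm_mul, norm_wave, mul_one, Complex.norm_real, Real.norm_of_nonneg (by positivity)]

theorem growth_add (hq1 : 1 ≤ q) (m n : ℤ) (s : ℝ) :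
    growth q (m + n) s = growth q m s * growth q n s := by
  have hq0 : (0 : ℝ) < q := by exact_mod_cast hq1
  rw [growth, growth, growth, neg_add, wave_add, Int.cast_add, add_div, Real.rpow_add hq0]
  push_cast
  ring

theorem growth_zero (s : ℝ) : growth q 0 s = 1 := by simp [growth, wave_zero]

theorem continuous_growth (m : ℤ) : Continuous (growth q m) :=
  continuous_const.mul (continuous_wave _)

theorem norm_planeWave_le (hG : G.IsTree) (hq1 : 1 ≤ q) (x z : V) (ω : Boundary G o) (s : ℝ) :
    ‖planeWave q x z ω s‖ ≤ (q : ℝ) ^ ((G.dist x z : ℝ) / 2) := by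
  rw [planeWave, norm_growth]
  have h1 : (height ω z - height ω x : ℤ) ≤ G.dist x z := (le_abs_self _).trans
    (height_sub_le hG x z ω)
  have h2 : ((height ω z - height ω x : ℤ) : ℝ) ≤ G.dist x z := by exact_mod_cast h1
  exact Real.rpow_le_rpow_of_exponent_le (by exact_mod_cast hq1) (by linarith)

theorem continuous_planeWave (hG : G.IsTree) (x z : V) :
    Continuous fun p : Boundary G o × ℝ => planeWave q x z p.1 p.2 := by
  have h1 : Continuous fun p : Boundary G o × ℝ => (height p.1 z - height p.1 x, p.2) :=
    ((isLocallyConstant_height_sub hG x z).continuous.comp continuous_fst).prodMk continuous_snd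
  have h2 : Continuous fun p : ℤ × ℝ => growth q p.1 p.2 := by
    rw [continuous_prod_of_discrete_left]
    exact continuous_growth
  have h3 := h2.comp h1
  simpa only [planeWave, Function.comp_def] using h3

/-- Summing a plane wave over the neighbours of a vertex multiplies it by a function of `s`. -/
theorem sum_neighbors_planeWave [G.LocallyFinite] (hG : G.IsTree) (hq1 : 1 ≤ q)
    (hreg : G.IsRegularOfDegree (q + 1)) (x z : V) (ω : Boundary G o) (s : ℝ) :
    ∑ w ∈ G.neighborFinset z, planeWave q x w ω s =
      (2 * (q : ℂ) ^ (1 / 2 : ℂ) * Real.cos (Real.log q * s)) * planeWave q x z ω s := by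
  classical
  obtain ⟨w, hw1, hw2, hw3⟩ := exists_unique_closer hG z ω
  have hq0 : (0 : ℝ) < q := by exact_mod_cast hq1
  have hstep : ∀ w' k, height ω w' - height ω z = k →
      planeWave q x w' ω s = planeWave q x z ω s * growth q k s := by
    intro w' k h
    rw [planeWave, planeWave, ← growth_add hq1, ← h]
    congr 1
    ring
  have hmem : w ∈ G.neighborFinset z := by simpa using hw1
  rw [← Finset.add_sum_erase _ _ hmem, hstep w 1 hw2, Finset.sum_congr rfl fun w' hw' =>
    hstep w' (-1) (hw3 w' (by simpa using (Finset.mem_erase.1 hw').2) (Finset.mem_erase.1 hw').1),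
    Finset.sum_const, Finset.card_erase_of_mem hmem, SimpleGraph.card_neighborFinset_eq_degree,
    hreg z, Nat.add_sub_cancel, nsmul_eq_mul]
  have e1 : (q : ℂ) ^ (1 / 2 : ℂ) = (((q : ℝ) ^ (1 / 2 : ℝ) : ℝ) : ℂ) := by
    rw [Complex.ofReal_cpow hq0.le]
    push_cast
    rfl
  have e2 : (q : ℝ) * (q : ℝ) ^ (-1 / 2 : ℝ) = (q : ℝ) ^ (1 / 2 : ℝ) := by
    conv_lhs => rw [← Real.rpow_one (q : ℝ), ← Real.rpow_mul hq0.le, ← Real.rpow_add hq0]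
    norm_num
  have e3 : growth q 1 s = (((q : ℝ) ^ (1 / 2 : ℝ) : ℝ) : ℂ) * wave q (-1) s := by
    simp [growth]
  have e4 : (q : ℂ) * growth q (-1) s = (((q : ℝ) ^ (1 / 2 : ℝ) : ℝ) : ℂ) * wave q 1 s := by
    rw [← e2, growth]
    push_cast
    rw [mul_assoc]
  have e5 : 2 * ((Real.cos (Real.log q * s) : ℝ) : ℂ) = wave q 1 s + wave q (-1) s := by
    rw [Complex.ofReal_cos, Complex.two_cos, wave, wave]
    congr 2
    · push_cast; ring
    · push_cast; ring
  calc _ = planeWave q x z ω s * (growth q 1 s + q * growth q (-1) s) := by ring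
    _ = planeWave q x z ω s * ((((q : ℝ) ^ (1 / 2 : ℝ) : ℝ) : ℂ) *
        (2 * ((Real.cos (Real.log q * s) : ℝ) : ℂ))) := by rw [e3, e4, e5]; ring
    _ = _ := by rw [e1]; ring

/-- Passing from a vertex `p` to a vertex `v` farther from `x` isolates the cylinder `Ω(x, v)`. -/
theorem planeWave_sub [G.LocallyFinite] (hG : G.IsTree) (hq1 : 1 ≤ q) {x p v : V}
    (hpv : G.Adj v p) (hd : G.dist x p + 1 = G.dist x v) (ω : Boundary G o) (s : ℝ) :
    planeWave q x v ω s - growth q (-1) s * planeWave q x p ω s =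
      (growth q (G.dist x v) s - growth q (G.dist x v - 2) s) *
        (cylinder G o x v).indicator 1 ω := by
  have a1 := SimpleGraph.dist_eq_one_iff_adj.2 hpv
  have a2 := G.dist_comm (u := p) (v := v)
  by_cases hω : ω ∈ cylinder G o x v
  · have hp : ω ∈ cylinder G o x p := mem_cylinder_of_between hG.1 hω (by omega)
    rw [indicator_of_mem hω, Pi.one_apply, mul_one, planeWave, planeWave,
      height_sub_height hG.1 hω (mem_cylinder_self hG.1 v ω),
      height_sub_height hG.1 hp (mem_cylinder_self hG.1 p ω), ← growth_add hq1]
    simp only [SimpleGraph.dist_self, Nat.cast_zero, sub_zero]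
    congr 2
    omega
  -- Off the cylinder, [v, ω) starts with the edge to p; so v is exactly one lower than p and the
  -- two terms cancel.
  · obtain ⟨m, h1, h2, h3⟩ := exists_median_boundary hG x v ω
    have hne : m ≠ v := by
      rintro rfl
      exact hω h2
    have hpos := hG.1.pos_dist_of_ne hne
    have c1 := G.dist_comm (u := m) (v := v)
    have c2 := G.dist_comm (u := m) (v := p)
    have h4 := dist_add_dist_of_le hG h1 (v := p) (by omega) (by omega)
    have h5 : ω ∈ cylinder G o v p := mem_cylinder_of_between hG.1 h3 (by omega)
    have h6 := height_sub_height hG.1 h5 (mem_cylinder_self hG.1 p ω)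
    rw [SimpleGraph.dist_self, a1] at h6
    rw [indicator_of_notMem hω, mul_zero, planeWave, planeWave, ← growth_add hq1, sub_eq_zero]
    congr 1
    push_cast at h6
    linarith

end PlaneWaves

/-! ### Uniform approximation by plane waves -/

section Approximation

variable {V : Type*} {G : SimpleGraph V} {o : V} {q : ℕ}

variable (G o) in
/-- The finite linear combinations of plane waves. -/
def waveSpan (q : ℕ) (x : V) : Submodule ℂ (Boundary G o → ℝ → ℂ) :=
  Submodule.span ℂ (range (planeWave q x))

/-- `F` is a uniform limit on `Ω × [0, τ]` of linear combinations of plane waves. -/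
def IsWaveLimit (q : ℕ) (x : V) (F : Boundary G o → ℝ → ℂ) : Prop :=
  ∀ δ > 0, ∃ f ∈ waveSpan G o q x, ∀ ω, ∀ s ∈ Icc 0 (tau q), ‖F ω s - f ω s‖ ≤ δ

theorem isWaveLimit_of_mem {x : V} {f : Boundary G o → ℝ → ℂ} (hf : f ∈ waveSpan G o q x) :
    IsWaveLimit q x f := fun δ hδ => ⟨f, hf, fun ω s _ => by simpa using hδ.le⟩

theorem IsWaveLimit.add {x : V} {F F' : Boundary G o → ℝ → ℂ} (hF : IsWaveLimit q x F)
    (hF' : IsWaveLimit q x F') : IsWaveLimit q x fun ω s => F ω s + F' ω s := by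
  intro δ hδ
  obtain ⟨f, h1, h2⟩ := hF (δ / 2) (by positivity)
  obtain ⟨f', h1', h2'⟩ := hF' (δ / 2) (by positivity)
  refine ⟨f + f', Submodule.add_mem _ h1 h1', fun ω s hs => ?_⟩
  calc ‖F ω s + F' ω s - (f + f') ω s‖ = ‖(F ω s - f ω s) + (F' ω s - f' ω s)‖ := by
        congr 1
        simp only [Pi.add_apply]
        ring
    _ ≤ δ / 2 + δ / 2 := norm_add_le_of_le (h2 ω s hs) (h2' ω s hs)
    _ = δ := by ring

theorem IsWaveLimit.sum {ι : Type*} {x : V} (t : Finset ι) {F : ι → Boundary G o → ℝ → ℂ}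
    (hF : ∀ i ∈ t, IsWaveLimit q x (F i)) : IsWaveLimit q x fun ω s => ∑ i ∈ t, F i ω s := by
  classical
  induction t using Finset.induction_on with
  | empty =>
    simp only [Finset.sum_empty]
    exact isWaveLimit_of_mem (Submodule.zero_mem (waveSpan G o q x))
  | insert i t hi ih =>
    simp only [Finset.sum_insert hi]
    exact (hF i (Finset.mem_insert_self i t)).add
      (ih fun j hj => hF j (Finset.mem_insert_of_mem hj))

theorem isWaveLimit_of_approx {x : V} {F : Boundary G o → ℝ → ℂ}
    (h : ∀ δ > 0, ∃ F', IsWaveLimit q x F' ∧ ∀ ω, ∀ s ∈ Icc 0 (tau q), ‖F ω s - F' ω s‖ ≤ δ) :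
    IsWaveLimit q x F := by
  intro δ hδ
  obtain ⟨F', h1, h2⟩ := h (δ / 2) (by positivity)
  obtain ⟨f, h3, h4⟩ := h1 (δ / 2) (by positivity)
  refine ⟨f, h3, fun ω s hs => ?_⟩
  calc ‖F ω s - f ω s‖ = ‖(F ω s - F' ω s) + (F' ω s - f ω s)‖ := by ring_nf
    _ ≤ δ / 2 + δ / 2 := norm_add_le_of_le (h2 ω s hs) (h4 ω s hs)
    _ = δ := by ring

theorem exists_norm_le_of_mem_waveSpan (hG : G.IsTree) (hq1 : 1 ≤ q) {x : V}
    {f : Boundary G o → ℝ → ℂ} (hf : f ∈ waveSpan G o q x) : ∃ K, 0 ≤ K ∧ ∀ ω s, ‖f ω s‖ ≤ K := by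
  induction hf using Submodule.span_induction with
  | mem f hf =>
    obtain ⟨z, rfl⟩ := hf
    exact ⟨_, by positivity, norm_planeWave_le hG hq1 x z⟩
  | zero => exact ⟨0, le_rfl, by simp⟩
  | add f g _ _ ihf ihg =>
    obtain ⟨K, hK0, hK⟩ := ihf
    obtain ⟨L, hL0, hL⟩ := ihg
    exact ⟨K + L, by positivity, fun ω s => norm_add_le_of_le (hK ω s) (hL ω s)⟩
  | smul a f _ ih =>
    obtain ⟨K, hK0, hK⟩ := ih
    refine ⟨‖a‖ * K, by positivity, fun ω s => ?_⟩
    rw [Pi.smul_apply, Pi.smul_apply, norm_smul]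
    exact mul_le_mul_of_nonneg_left (hK ω s) (norm_nonneg a)

/-- Plane waves are eigenfunctions of the adjacency operator with eigenvalue 2 √q cos(s log q), so
multiplication by the cosine is a finite sum over neighbours. -/
theorem cos_mul_mem_waveSpan [G.LocallyFinite] (hG : G.IsTree) (hq1 : 1 ≤ q)
    (hreg : G.IsRegularOfDegree (q + 1)) {x : V} {f : Boundary G o → ℝ → ℂ}
    (hf : f ∈ waveSpan G o q x) :
    (fun ω s => ((Real.cos (Real.log q * s) : ℝ) : ℂ) * f ω s) ∈ waveSpan G o q x := by
  induction hf using Submodule.span_induction with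
  | mem f hf =>
    obtain ⟨z, rfl⟩ := hf
    have hq0 : (q : ℂ) ≠ 0 := by
      have : q ≠ 0 := by omega
      exact_mod_cast this
    have h1 : (q : ℂ) ^ (1 / 2 : ℂ) ≠ 0 := by
      rw [Complex.cpow_def_of_ne_zero hq0]
      exact Complex.exp_ne_zero _
    have h2 : (fun (ω : Boundary G o) s => ((Real.cos (Real.log q * s) : ℝ) : ℂ) *
        planeWave q x z ω s) = (2 * (q : ℂ) ^ (1 / 2 : ℂ))⁻¹ •
          ∑ w ∈ G.neighborFinset z, planeWave q x w := by
      funext ω s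
      rw [Pi.smul_apply, Pi.smul_apply, Finset.sum_apply, Finset.sum_apply,
        sum_neighbors_planeWave hG hq1 hreg, smul_eq_mul]
      field_simp
    rw [h2]
    exact Submodule.smul_mem _ _ (Submodule.sum_mem _ fun w _ => Submodule.subset_span ⟨w, rfl⟩)
  | zero => simp only [Pi.zero_apply, mul_zero]; exact Submodule.zero_mem _
  | add f g _ _ ihf ihg =>
    simp only [Pi.add_apply, mul_add]
    exact Submodule.add_mem _ ihf ihg
  | smul a f _ ih =>
    simp only [Pi.smul_apply, smul_eq_mul, mul_left_comm _ a]
    exact Submodule.smul_mem _ a ih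

theorem polynomial_mul_mem_waveSpan [G.LocallyFinite] (hG : G.IsTree) (hq1 : 1 ≤ q)
    (hreg : G.IsRegularOfDegree (q + 1)) {x : V} (p : Polynomial ℝ)
    {f : Boundary G o → ℝ → ℂ} (hf : f ∈ waveSpan G o q x) :
    (fun ω s => ((p.eval (Real.cos (Real.log q * s)) : ℝ) : ℂ) * f ω s) ∈ waveSpan G o q x := by
  induction p using Polynomial.induction_on' with
  | add p r hp hr =>
    simp only [Polynomial.eval_add, Complex.ofReal_add, add_mul]
    exact Submodule.add_mem _ hp hr
  | monomial n a =>
    induction n with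
    | zero =>
      simp only [Polynomial.eval_monomial, pow_zero, mul_one]
      exact Submodule.smul_mem _ (a : ℂ) hf
    | succ n ih =>
      have h := cos_mul_mem_waveSpan hG hq1 hreg ih
      convert h using 3
      simp only [Polynomial.eval_monomial, pow_succ]
      push_cast
      ring

/-- Weierstrass approximation by polynomials in `cos (s log q)`. -/
theorem exists_polynomial_cos_near (hq : 2 ≤ q) {g : ℝ → ℝ} (hg : ContinuousOn g (Icc 0 (tau q)))
    {δ : ℝ} (hδ : 0 < δ) : ∃ p : Polynomial ℝ, ∀ s ∈ Icc 0 (tau q),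
      |p.eval (Real.cos (Real.log q * s)) - g s| < δ := by
  have hl := log_pos_of_two_le hq
  have hc : ContinuousOn (fun t => g (Real.arccos t / Real.log q)) (Icc (-1) 1) := by
    refine hg.comp (Real.continuous_arccos.div_const _).continuousOn fun t _ => ?_
    exact ⟨div_nonneg (Real.arccos_nonneg t) hl.le,
      div_le_div_of_nonneg_right (Real.arccos_le_pi t) hl.le⟩
  obtain ⟨p, hp⟩ := exists_polynomial_near_of_continuousOn (-1) 1 _ hc δ hδ
  refine ⟨p, fun s hs => ?_⟩
  have h1 := hp (Real.cos (Real.log q * s)) ⟨Real.neg_one_le_cos _, Real.cos_le_one _⟩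
  rwa [Real.arccos_cos (mul_nonneg hl.le hs.1), mul_div_cancel_left₀ _ hl.ne'] at h1
  have h2 := hs.2
  rw [tau, le_div_iff₀ hl] at h2
  linarith

/-- The span of the plane waves is a module over the polynomials in cos(s log q). These are
uniformly dense in the continuous functions because the cosine is injective on [0, τ]; this is where
the half period enters. -/
theorem IsWaveLimit.mul [G.LocallyFinite] (hG : G.IsTree) (hq : 2 ≤ q)
    (hreg : G.IsRegularOfDegree (q + 1)) {x : V} {F : Boundary G o → ℝ → ℂ}
    (hF : IsWaveLimit q x F) {g : ℝ → ℂ} (hg : ContinuousOn g (Icc 0 (tau q))) :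
    IsWaveLimit q x fun ω s => g s * F ω s := by
  have hq1 : 1 ≤ q := by omega
  obtain ⟨C, hC⟩ := isCompact_Icc.exists_bound_of_continuousOn hg
  have hC0 : 0 ≤ C := (norm_nonneg _).trans (hC 0 (left_mem_Icc.2 (tau_pos hq).le))
  refine isWaveLimit_of_approx fun δ hδ => ?_
  obtain ⟨f, hf, hFf⟩ := hF (δ / (C + 1)) (by positivity)
  refine ⟨fun ω s => g s * f ω s, fun δ hδ => ?_, fun ω s hs => ?_⟩
  · obtain ⟨K, hK0, hK⟩ := exists_norm_le_of_mem_waveSpan hG hq1 hf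
    obtain ⟨p, hp⟩ := exists_polynomial_cos_near hq
      (Complex.continuous_re.comp_continuousOn hg) (δ := δ / (2 * (K + 1))) (by positivity)
    obtain ⟨r, hr⟩ := exists_polynomial_cos_near hq
      (Complex.continuous_im.comp_continuousOn hg) (δ := δ / (2 * (K + 1))) (by positivity)
    refine ⟨_, Submodule.add_mem _ (polynomial_mul_mem_waveSpan hG hq1 hreg p hf)
      (Submodule.smul_mem _ Complex.I (polynomial_mul_mem_waveSpan hG hq1 hreg r hf)),
      fun ω s hs => ?_⟩
    have h1 := (hp s hs).le
    have h2 := (hr s hs).le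
    have e : g s * f ω s - ((fun ω s => ((p.eval (Real.cos (Real.log q * s)) : ℝ) : ℂ) * f ω s) +
        Complex.I • fun ω s => ((r.eval (Real.cos (Real.log q * s)) : ℝ) : ℂ) * f ω s) ω s =
        -(((p.eval (Real.cos (Real.log q * s)) - (g s).re : ℝ) : ℂ) +
          ((r.eval (Real.cos (Real.log q * s)) - (g s).im : ℝ) : ℂ) * Complex.I) * f ω s := by
      conv_lhs => rw [← Complex.re_add_im (g s)]
      simp only [Pi.add_apply, Pi.smul_apply, smul_eq_mul]
      push_cast
      ring
    rw [e, norm_mul, norm_neg]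
    have h3 : ‖((p.eval (Real.cos (Real.log q * s)) - (g s).re : ℝ) : ℂ) +
          ((r.eval (Real.cos (Real.log q * s)) - (g s).im : ℝ) : ℂ) * Complex.I‖ ≤
          δ / (K + 1) := by
      refine (norm_add_le _ _).trans ?_
      rw [norm_mul, Complex.norm_I, mul_one, Complex.norm_real, Complex.norm_real]
      refine (add_le_add h1 h2).trans (le_of_eq ?_)
      field_simp
      ring
    calc _ ≤ δ / (K + 1) * K := by gcongr; exact hK ω s
      _ ≤ δ := by
        rw [div_mul_eq_mul_div, div_le_iff₀ (by positivity)]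
        nlinarith
  · rw [← mul_sub, norm_mul]
    calc _ ≤ C * (δ / (C + 1)) := by
          gcongr
          · exact hC s hs
          · exact hFf ω s hs
      _ ≤ δ := by
        rw [← mul_div_assoc, div_le_iff₀ (by positivity)]
        nlinarith

/-- By `planeWave_sub` the indicator times a function D of s is a combination of two plane waves
with coefficients continuous in s. D has no zeros and can be divided out. -/
theorem isWaveLimit_indicator_cylinder [G.LocallyFinite] (hG : G.IsTree) (hq : 2 ≤ q)
    (hreg : G.IsRegularOfDegree (q + 1)) (x v : V) :
    IsWaveLimit q x fun (ω : Boundary G o) _ => (cylinder G o x v).indicator 1 ω := by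
  have hq1 : 1 ≤ q := by omega
  have hq2 : (1 : ℝ) < q := by exact_mod_cast hq
  by_cases hv : v = x
  · subst hv
    have : (fun (ω : Boundary G o) (_ : ℝ) =>
      (cylinder G o v v).indicator (1 : Boundary G o → ℂ) ω) =
        planeWave q v v := by
      funext ω s
      rw [indicator_of_mem (mem_cylinder_self hG.1 v ω), planeWave, sub_self, growth_zero]
      rfl
    rw [this]
    exact isWaveLimit_of_mem (Submodule.subset_span ⟨v, rfl⟩)
  · obtain ⟨p, hp1, hp2⟩ := exists_adj_dist_add_one hG.1 hv
    rw [G.dist_comm (u := p), G.dist_comm (u := v)] at hp2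
    set D : ℝ → ℂ := fun s => growth q (G.dist x v) s - growth q (G.dist x v - 2) s with hD
    -- The two terms of D have moduli q^(d/2) and q^(d/2 - 1), with d = d(x, v).
    have hD0 : ∀ s, D s ≠ 0 := by
      intro s h
      have h1 := congrArg norm (sub_eq_zero.1 h)
      rw [norm_growth, norm_growth] at h1
      have h2 := (Real.rpow_right_inj (by linarith) hq2.ne').1 h1
      push_cast at h2
      linarith
    have hDc : Continuous fun s => (D s)⁻¹ :=
      ((continuous_growth _).sub (continuous_growth _)).inv₀ hD0
    have h1 := (isWaveLimit_of_mem (G := G) (o := o) (q := q) (x := x)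
      (Submodule.subset_span ⟨v, rfl⟩)).add
      ((isWaveLimit_of_mem (G := G) (o := o) (q := q) (x := x)
        (Submodule.subset_span ⟨p, rfl⟩)).mul hG hq hreg
        (continuous_growth (q := q) (-1)).neg.continuousOn)
    have h2 := h1.mul hG hq hreg hDc.continuousOn
    convert h2 using 3 with ω s
    have h3 := planeWave_sub (o := o) hG hq1 hp1 hp2 ω s
    rw [Pi.neg_apply, neg_mul, ← sub_eq_add_neg, h3, ← mul_assoc]
    show _ = (D s)⁻¹ * D s * _
    rw [inv_mul_cancel₀ (hD0 s), one_mul]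

/-- The symbol is approximated by a step function in ω, constant on each cylinder of a fixed depth
n. -/
theorem isWaveLimit_of_oscillation [G.LocallyFinite] (hG : G.IsTree) (hq : 2 ≤ q)
    (hreg : G.IsRegularOfDegree (q + 1)) {x : V} {c : Boundary G o → ℝ → ℂ}
    (hc : ∀ ω, ContinuousOn (c ω) (Icc 0 (tau q))) {B : ℝ}
    (hosc : ∀ v, ∀ ω ∈ cylinder G o x v, ∀ ω' ∈ cylinder G o x v, ∀ s ∈ Icc 0 (tau q),
      ‖c ω s - c ω' s‖ ≤ B / (1 + (G.dist x v : ℝ))) :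
    IsWaveLimit q x c := by
  have hq1 : 1 ≤ q := by omega
  refine isWaveLimit_of_approx fun δ hδ => ?_
  have hlim : Tendsto (fun n : ℕ => B / (1 + (n : ℝ))) atTop (𝓝 0) :=
    (tendsto_atTop_add_const_left _ _ tendsto_natCast_atTop_atTop).const_div_atTop B
  obtain ⟨n, hn⟩ := (hlim.eventually (gt_mem_nhds hδ)).exists
  choose ξ hξ using fun v => cylinder_nonempty (o := o) hG hq1 hreg x v
  refine ⟨fun ω s => ∑ v ∈ (finite_sphere hG.1 x n).toFinset,
    c (ξ v) s * (cylinder G o x v).indicator 1 ω, IsWaveLimit.sum _ fun v _ =>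
      (isWaveLimit_indicator_cylinder hG hq hreg x v).mul hG hq hreg (hc (ξ v)), fun ω s hs => ?_⟩
  obtain ⟨p, hp, hω⟩ := exists_ray hG x ω
  show ‖c ω s - ∑ v ∈ (finite_sphere hG.1 x n).toFinset,
    c (ξ v) s * (cylinder G o x v).indicator 1 ω‖ ≤ δ
  rw [Finset.sum_eq_single (p n)]
  · rw [indicator_of_mem (hω n), Pi.one_apply, mul_one]
    have h := hosc (p n) ω (hω n) _ (hξ (p n)) s hs
    rw [hp] at h
    exact h.trans hn.le
  · intro v hv hne
    rw [indicator_of_notMem, mul_zero]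
    intro hωv
    refine hne (eq_of_mem_cylinder hG hωv (hω n) ?_)
    rw [hp]
    simpa using hv
  · intro h
    exact absurd (by simpa using hp n) h

end Approximation

/-! ### Exact composition for symbols independent of the vertex -/

section FrozenProduct

variable {V : Type*} {G : SimpleGraph V} {o : V} {q : ℕ}

theorem kernel_one [G.LocallyFinite] (hG : G.IsTree) (hq : 2 ≤ q)
    (hreg : G.IsRegularOfDegree (q + 1)) (x y : V) [Decidable (x = y)] :
    kernel q (fun (_ : Boundary G o) _ => 1) x y = if x = y then 1 else 0 := by
  have hq1 : 1 ≤ q := by omega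
  have := isProbabilityMeasure_nu (o := o) hG hq1 hreg x
  have h : ∀ j ∈ Finset.range (G.dist x y + 1), (q : ℂ) ^ j * ∫ ω in level G o x y j,
      coef q (fun _ => 1) (2 * (j : ℤ) - G.dist x y) ∂(nu q x) =
      levelWeight q (G.dist x y) j * ∫ s, wave q (2 * (j : ℤ) - G.dist x y) s ∂(plancherel q) := by
    intro j hj
    rw [setIntegral_const, Complex.real_smul, ← nu_real_level (o := o) hG hq1 hreg x y
      (Nat.lt_succ_iff.1 (Finset.mem_range.1 hj)), coef]
    simp only [mul_one]
    push_cast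
    ring
  rw [kernel_eq_sum hG hq1 _ x y fun m => integrable_const _, Finset.sum_congr rfl h,
    integral_sum_levelWeight hq]
  by_cases hxy : x = y
  · subst hxy
    simp
  · have := hG.1.pos_dist_of_ne hxy
    rw [if_neg hxy, if_neg (by omega), mul_zero]

theorem conj_growth (m : ℤ) (s : ℝ) : (starRingEnd ℂ) (growth q m s) =
    (((q : ℝ) ^ ((m : ℝ) / 2) : ℝ) : ℂ) * wave q m s := by
  rw [growth, map_mul, Complex.conj_ofReal, conj_wave, neg_neg]

/-- Kernels with different first arguments become matrix coefficients in one and the same Hilbert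
space: the density of ν_z with respect to ν_x is shared out between the two plane waves. With `c =
1` this is the orthonormality of the plane waves. -/
theorem integral_planeWave_mul [G.LocallyFinite] (hG : G.IsTree) (hq1 : 1 ≤ q)
    (hreg : G.IsRegularOfDegree (q + 1)) (x y z : V) (c : Boundary G o → ℝ → ℂ) :
    ∫ ω, ∫ s, (starRingEnd ℂ) (planeWave q x y ω s) * c ω s * planeWave q x z ω s
      ∂(plancherel q) ∂(nu q x) = kernel q c z y := by
  have hq0 : (0 : ℝ) < q := by exact_mod_cast hq1
  rw [kernel, integral_nu hG hq1 hreg x z]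
  refine integral_congr_ae (Eventually.of_forall fun ω => ?_)
  show ∫ s, _ ∂_ = _ * ∫ s, _ ∂_
  rw [← integral_const_mul]
  refine integral_congr_ae (Eventually.of_forall fun s => ?_)
  show _ = _ * (_ * _)
  rw [cpow_eq_wave hq1]
  obtain ⟨m, hm⟩ : ∃ m, height ω y - height ω x = m := ⟨_, rfl⟩
  obtain ⟨n, hn⟩ : ∃ n, height ω z - height ω x = n := ⟨_, rfl⟩
  show (starRingEnd ℂ) (growth q (height ω y - height ω x) s) * c ω s *
    growth q (height ω z - height ω x) s = _
  rw [conj_growth, growth, show height ω y - height ω z = m + -n by omega, hm, hn, wave_add]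
  have e : (q : ℝ) ^ ((m : ℝ) / 2) * (q : ℝ) ^ ((n : ℝ) / 2) =
      (q : ℝ) ^ n * (q : ℝ) ^ (((m + -n : ℤ) : ℝ) / 2) := by
    rw [← Real.rpow_intCast, ← Real.rpow_add hq0, ← Real.rpow_add hq0]
    congr 1
    push_cast
    ring
  have e' : (((q : ℝ) ^ ((m : ℝ) / 2) : ℝ) : ℂ) * (((q : ℝ) ^ ((n : ℝ) / 2) : ℝ) : ℂ) =
      (q : ℂ) ^ n * (((q : ℝ) ^ (((m + -n : ℤ) : ℝ) / 2) : ℝ) : ℂ) := by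
    rw [← Complex.ofReal_mul, e]
    push_cast
    rfl
  calc _ = ((((q : ℝ) ^ ((m : ℝ) / 2) : ℝ) : ℂ) * (((q : ℝ) ^ ((n : ℝ) / 2) : ℝ) : ℂ)) *
        (wave q m s * wave q (-n) s * c ω s) := by ring
    _ = _ := by rw [e']; ring

theorem planeWave_self (x : V) (ω : Boundary G o) (s : ℝ) : planeWave q x x ω s = 1 := by
  rw [planeWave, sub_self, growth_zero]

theorem ae_prod_mem_Icc [G.LocallyFinite] (hG : G.IsTree) (hq : 2 ≤ q)
    (hreg : G.IsRegularOfDegree (q + 1)) (x : V) :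
    ∀ᵐ p ∂((nu q x : Measure (Boundary G o)).prod (plancherel q)), p.2 ∈ Icc 0 (tau q) := by
  have := isProbabilityMeasure_nu (o := o) hG (by omega) hreg x
  have := isFiniteMeasure_plancherel hq
  exact Measure.quasiMeasurePreserving_snd.ae ae_mem_Icc_plancherel

theorem memLp_of_continuousOn [G.LocallyFinite] (hG : G.IsTree) (hq : 2 ≤ q)
    (hreg : G.IsRegularOfDegree (q + 1)) (x : V) {c : Boundary G o → ℝ → ℂ}
    (hc : ContinuousOn (fun p : Boundary G o × ℝ => c p.1 p.2) (univ ×ˢ Icc 0 (tau q))) {B : ℝ}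
    (hB : ∀ ω, ∀ s ∈ Icc 0 (tau q), ‖c ω s‖ ≤ B) :
    MemLp (fun p : Boundary G o × ℝ => c p.1 p.2) 2
      ((nu q x : Measure (Boundary G o)).prod (plancherel q)) := by
  have : Countable V := countable_of_locallyFinite hG.1
  have := secondCountable_boundary (G := G) (o := o)
  have := isProbabilityMeasure_nu (o := o) hG (by omega) hreg x
  have := isFiniteMeasure_plancherel hq
  have hac : (nu q x : Measure (Boundary G o)).prod (plancherel q) ≪
      ((nu q x : Measure (Boundary G o)).prod volume).restrict (univ ×ˢ Icc 0 (tau q)) := by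
    rw [← Measure.prod_restrict, Measure.restrict_univ]
    exact Measure.AbsolutelyContinuous.rfl.prod (withDensity_absolutelyContinuous _ _)
  refine MemLp.of_bound ((hc.aestronglyMeasurable
    (MeasurableSet.univ.prod measurableSet_Icc)).mono_ac hac) B ?_
  filter_upwards [ae_prod_mem_Icc hG hq hreg x] with p hp
  exact hB p.1 p.2 hp

theorem memLp_planeWave [G.LocallyFinite] (hG : G.IsTree) (hq : 2 ≤ q)
    (hreg : G.IsRegularOfDegree (q + 1)) (x z : V) :
    MemLp (fun p : Boundary G o × ℝ => planeWave q x z p.1 p.2) 2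
      ((nu q x : Measure (Boundary G o)).prod (plancherel q)) :=
  memLp_of_continuousOn hG hq hreg x (continuous_planeWave hG x z).continuousOn
    fun ω s _ => norm_planeWave_le hG (by omega) x z ω s

theorem inner_toLp_eq [G.LocallyFinite] (hG : G.IsTree) (hq : 2 ≤ q)
    (hreg : G.IsRegularOfDegree (q + 1)) (x : V) {f g : Boundary G o → ℝ → ℂ}
    (hf : MemLp (fun p : Boundary G o × ℝ => f p.1 p.2) 2
      ((nu q x : Measure (Boundary G o)).prod (plancherel q)))
    (hg : MemLp (fun p : Boundary G o × ℝ => g p.1 p.2) 2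
      ((nu q x : Measure (Boundary G o)).prod (plancherel q))) :
    inner ℂ hf.toLp hg.toLp =
      ∫ ω, ∫ s, (starRingEnd ℂ) (f ω s) * g ω s ∂(plancherel q) ∂(nu q x) := by
  have := isProbabilityMeasure_nu (o := o) hG (by omega) hreg x
  have := isFiniteMeasure_plancherel hq
  have hint : Integrable (fun p : Boundary G o × ℝ => (starRingEnd ℂ) (f p.1 p.2) * g p.1 p.2)
      ((nu q x : Measure (Boundary G o)).prod (plancherel q)) := by
    refine (L2.integrable_inner (𝕜 := ℂ) hf.toLp hg.toLp).congr ?_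
    filter_upwards [hf.coeFn_toLp, hg.coeFn_toLp] with p h1 h2
    rw [h1, h2, RCLike.inner_apply, mul_comm]
  rw [L2.inner_def, ← integral_prod _ hint]
  refine integral_congr_ae ?_
  filter_upwards [hf.coeFn_toLp, hg.coeFn_toLp] with p h1 h2
  rw [h1, h2, RCLike.inner_apply, mul_comm]

theorem IsWaveLimit.mem_closure [G.LocallyFinite] (hG : G.IsTree) (hq : 2 ≤ q)
    (hreg : G.IsRegularOfDegree (q + 1)) (x : V) {F : Boundary G o → ℝ → ℂ}
    (hF : IsWaveLimit q x F)
    (hFL : MemLp (fun p : Boundary G o × ℝ => F p.1 p.2) 2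
      ((nu q x : Measure (Boundary G o)).prod (plancherel q))) :
    hFL.toLp ∈ (Submodule.span ℂ (range fun z =>
      (memLp_planeWave (o := o) hG hq hreg x z).toLp)).topologicalClosure := by
  have := isProbabilityMeasure_nu (o := o) hG (by omega) hreg x
  have := isFiniteMeasure_plancherel hq
  have hspan : ∀ f ∈ waveSpan G o q x, ∃ h : MemLp (fun p : Boundary G o × ℝ => f p.1 p.2) 2
      ((nu q x : Measure (Boundary G o)).prod (plancherel q)),
      h.toLp ∈ Submodule.span ℂ (range fun z =>
        (memLp_planeWave (o := o) hG hq hreg x z).toLp) := by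
    intro f hf
    induction hf using Submodule.span_induction with
    | mem f hf =>
      obtain ⟨z, rfl⟩ := hf
      exact ⟨memLp_planeWave hG hq hreg x z, Submodule.subset_span ⟨z, rfl⟩⟩
    | zero =>
      exact ⟨MemLp.zero', by
        have : (MemLp.zero' : MemLp (fun _ : Boundary G o × ℝ => (0 : ℂ)) 2
          ((nu q x : Measure (Boundary G o)).prod (plancherel q))).toLp = 0 := MemLp.toLp_zero _
        exact this ▸ Submodule.zero_mem _⟩
    | add f g _ _ ihf ihg =>
      obtain ⟨hf, hf'⟩ := ihf
      obtain ⟨hg, hg'⟩ := ihg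
      exact ⟨hf.add hg, by
        have := MemLp.toLp_add hf hg
        exact this ▸ Submodule.add_mem _ hf' hg'⟩
    | smul a f _ ih =>
      obtain ⟨hf, hf'⟩ := ih
      exact ⟨hf.const_smul a, by
        have := MemLp.toLp_const_smul a hf
        exact this ▸ Submodule.smul_mem _ a hf'⟩
  rw [← SetLike.mem_coe, Submodule.topologicalClosure_coe, Metric.mem_closure_iff]
  intro δ hδ
  set M : ℝ := (measureUnivNNReal ((nu q x : Measure (Boundary G o)).prod (plancherel q)) : ℝ) ^
    ((2 : ENNReal).toReal⁻¹) with hM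
  have hM0 : 0 ≤ M := by positivity
  obtain ⟨f, hf, hFf⟩ := hF (δ / (2 * (M + 1))) (by positivity)
  obtain ⟨h, h'⟩ := hspan f hf
  refine ⟨h.toLp, h', ?_⟩
  rw [dist_eq_norm]
  have hb : ∀ᵐ p ∂((nu q x : Measure (Boundary G o)).prod (plancherel q)),
      ‖(hFL.toLp - h.toLp : Lp ℂ 2 _) p‖ ≤ δ / (2 * (M + 1)) := by
    filter_upwards [Lp.coeFn_sub hFL.toLp h.toLp, hFL.coeFn_toLp, h.coeFn_toLp,
      ae_prod_mem_Icc hG hq hreg x] with p e1 e2 e3 hp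
    rw [e1, Pi.sub_apply, e2, e3]
    exact hFf p.1 p.2 hp
  refine (Lp.norm_le_of_ae_bound (by positivity) hb).trans_lt ?_
  rw [← hM, ← mul_div_assoc, div_lt_iff₀ (by positivity)]
  nlinarith

/-- The composition formula for operators whose symbols do not depend on the vertex. -/
theorem hasSum_kernel_mul_kernel [G.LocallyFinite] (hG : G.IsTree) (hq : 2 ≤ q)
    (hreg : G.IsRegularOfDegree (q + 1)) {a b : Boundary G o → ℝ → ℂ} {A B : ℝ} {x : V}
    (ha : ContinuousOn (fun p : Boundary G o × ℝ => a p.1 p.2) (univ ×ˢ Icc 0 (tau q)))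
    (hA : ∀ ω, ∀ s ∈ Icc 0 (tau q), ‖a ω s‖ ≤ A)
    (hosc : ∀ v, ∀ ω ∈ cylinder G o x v, ∀ ω' ∈ cylinder G o x v, ∀ s ∈ Icc 0 (tau q),
      ‖a ω s - a ω' s‖ ≤ A / (1 + (G.dist x v : ℝ)))
    (hb : ContinuousOn (fun p : Boundary G o × ℝ => b p.1 p.2) (univ ×ˢ Icc 0 (tau q)))
    (hB : ∀ ω, ∀ s ∈ Icc 0 (tau q), ‖b ω s‖ ≤ B) (y : V) :
    HasSum (fun z => kernel q a x z * kernel q b z y)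
      (kernel q (fun ω s => a ω s * b ω s) x y) := by
  classical
  have hq1 : 1 ≤ q := by omega
  have hac : ∀ ω, ContinuousOn (a ω) (Icc 0 (tau q)) := fun ω =>
    ha.comp (continuous_const.prodMk continuous_id).continuousOn fun s hs => ⟨trivial, hs⟩
  have haL := memLp_of_continuousOn hG hq hreg x ha hA
  have hgL : MemLp (fun p : Boundary G o × ℝ => planeWave q x y p.1 p.2 *
      (starRingEnd ℂ) (b p.1 p.2)) 2 ((nu q x : Measure (Boundary G o)).prod (plancherel q)) := by
    refine memLp_of_continuousOn hG hq hreg x (c := fun ω s => planeWave q x y ω s *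
      (starRingEnd ℂ) (b ω s)) ((continuous_planeWave hG x y).continuousOn.mul
        (Complex.continuous_conj.comp_continuousOn hb))
        (B := (q : ℝ) ^ ((G.dist x y : ℝ) / 2) * B) fun ω s hs => ?_
    rw [norm_mul, RCLike.norm_conj]
    exact mul_le_mul (norm_planeWave_le hG hq1 x y ω s) (hB ω s hs) (norm_nonneg _)
      (by positivity)
  have horth : Orthonormal ℂ fun z => (memLp_planeWave (o := o) hG hq hreg x z).toLp := by
    rw [orthonormal_iff_ite]
    intro y z
    rw [inner_toLp_eq hG hq hreg]
    have h := integral_planeWave_mul (o := o) hG hq1 hreg x y z fun _ _ => 1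
    simp only [mul_one] at h
    rw [h, kernel_one hG hq hreg]
    simp only [eq_comm]
  have hlim := (isWaveLimit_of_oscillation hG hq hreg hac hosc).mem_closure hG hq hreg x haL
  have h := hasSum_inner_mul_inner_of_mem_closure horth hlim hgL.toLp
  -- The three inner products of Parseval's identity are kernels: `b` is carried by the vector e_y
  -- conj(b), and `a` is multiplied by e_x = 1.
  have e1 : ∀ z, inner ℂ hgL.toLp (memLp_planeWave (o := o) hG hq hreg x z).toLp =
      kernel q b z y := by
    intro z
    rw [← integral_planeWave_mul hG hq1 hreg x y z b]
    refine (inner_toLp_eq hG hq hreg x (f := fun ω s => planeWave q x y ω s *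
      (starRingEnd ℂ) (b ω s)) hgL _).trans ?_
    simp only [map_mul, Complex.conj_conj]
  have e2 : ∀ z, inner ℂ (memLp_planeWave (o := o) hG hq hreg x z).toLp haL.toLp =
      kernel q a x z := by
    intro z
    rw [← integral_planeWave_mul hG hq1 hreg x z x a, inner_toLp_eq hG hq hreg]
    simp only [planeWave_self, mul_one]
  have e3 : inner ℂ hgL.toLp haL.toLp = kernel q (fun ω s => a ω s * b ω s) x y := by
    rw [← integral_planeWave_mul hG hq1 hreg x y x]
    refine (inner_toLp_eq hG hq hreg x (f := fun ω s => planeWave q x y ω s *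
      (starRingEnd ℂ) (b ω s)) hgL haL).trans ?_
    simp only [map_mul, Complex.conj_conj, planeWave_self, mul_one, mul_assoc, mul_comm (b _ _)]
  rw [e3] at h
  simp only [e1, e2] at h
  exact h.congr_fun fun z => mul_comm _ _

end FrozenProduct

/-! ### Schur's test -/

section Schur

open scoped NNReal ENNReal

theorem sq_tsum_mul_le {ι : Type*} (f g : ι → ℝ≥0∞) :
    (∑' i, f i * g i) ^ 2 ≤ (∑' i, f i ^ 2) * ∑' i, g i ^ 2 := by
  let _ : MeasurableSpace ι := ⊤
  have h := ENNReal.lintegral_mul_le_Lp_mul_Lq (Measure.count : Measure ι)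
    (Real.holderConjugate_iff.2 ⟨by norm_num, by norm_num⟩ : Real.HolderConjugate 2 2)
    (f := f) (g := g) measurable_from_top.aemeasurable measurable_from_top.aemeasurable
  simp only [lintegral_count, Pi.mul_apply, ENNReal.rpow_ofNat] at h
  have h2 : ∀ a : ℝ≥0∞, (a ^ (1 / 2 : ℝ)) ^ 2 = a := fun a => by
    rw [← ENNReal.rpow_natCast, ← ENNReal.rpow_mul]
    norm_num
  calc _ ≤ ((∑' i, f i ^ 2) ^ (1 / 2 : ℝ) * (∑' i, g i ^ 2) ^ (1 / 2 : ℝ)) ^ 2 := by gcongr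
    _ = _ := by rw [mul_pow, h2, h2]

/-- Schur's test for a nonnegative kernel. -/
theorem tsum_sq_tsum_le_of_schur {V : Type*} (k : V → V → ℝ≥0) (w : V → ℝ≥0)
    (hw : ∀ x, w x ≠ 0) (M : ℝ≥0∞)
    (h1 : ∀ x, ∑' y, (k x y * w y : ℝ≥0∞) ≤ M * w x)
    (h2 : ∀ y, ∑' x, (k x y * w x : ℝ≥0∞) ≤ M * w y) (f : V → ℝ≥0) :
    ∑' x, (∑' y, (k x y * f y : ℝ≥0∞)) ^ 2 ≤ M ^ 2 * ∑' y, (f y : ℝ≥0∞) ^ 2 := by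
  have hpt : ∀ x, (∑' y, (k x y * f y : ℝ≥0∞)) ^ 2 ≤
      M * ∑' y, (w x * (k x y * ((f y ^ 2 / w y : ℝ≥0) : ℝ≥0∞)) : ℝ≥0∞) := by
    intro x
    -- The usual splitting for Cauchy–Schwarz: the first factor gives the weighted row sum, the
    -- second becomes a weighted column sum after the order of summation is exchanged.
    have e : ∀ y, (k x y * f y : ℝ≥0∞) = ((NNReal.sqrt (k x y * w y) : ℝ≥0) : ℝ≥0∞) *
        ((NNReal.sqrt (k x y * (f y ^ 2 / w y)) : ℝ≥0) : ℝ≥0∞) := by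
      intro y
      rw [← ENNReal.coe_mul, ← ENNReal.coe_mul, ← NNReal.sqrt_mul]
      congr 1
      rw [eq_comm, NNReal.sqrt_eq_iff_eq_sq]
      have := hw y
      field_simp
    have e1 : ∀ y, ((NNReal.sqrt (k x y * w y) : ℝ≥0) : ℝ≥0∞) ^ 2 = k x y * w y := by
      intro y
      rw [← ENNReal.coe_pow, NNReal.sq_sqrt, ENNReal.coe_mul]
    have e2 : ∀ y, ((NNReal.sqrt (k x y * (f y ^ 2 / w y)) : ℝ≥0) : ℝ≥0∞) ^ 2 =
        k x y * ((f y ^ 2 / w y : ℝ≥0) : ℝ≥0∞) := by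
      intro y
      rw [← ENNReal.coe_pow, NNReal.sq_sqrt, ENNReal.coe_mul]
    simp only [e]
    refine (sq_tsum_mul_le _ _).trans ?_
    simp only [e1, e2]
    rw [ENNReal.tsum_mul_left, ← mul_assoc]
    gcongr
    exact h1 x
  calc _ ≤ ∑' x, M * ∑' y, (w x * (k x y * ((f y ^ 2 / w y : ℝ≥0) : ℝ≥0∞)) : ℝ≥0∞) :=
        ENNReal.tsum_le_tsum hpt
    _ = M * ∑' y, ∑' x, (w x * (k x y * ((f y ^ 2 / w y : ℝ≥0) : ℝ≥0∞)) : ℝ≥0∞) := by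
        rw [ENNReal.tsum_mul_left, ENNReal.tsum_comm]
    _ = M * ∑' y, ((f y ^ 2 / w y : ℝ≥0) : ℝ≥0∞) * ∑' x, (k x y * w x : ℝ≥0∞) := by
        congr 2
        funext y
        rw [← ENNReal.tsum_mul_left]
        congr 1
        funext x
        ring
    _ ≤ M * ∑' y, ((f y ^ 2 / w y : ℝ≥0) : ℝ≥0∞) * (M * w y) := by
        gcongr with y
        exact h2 y
    _ = M * ∑' y, M * (f y : ℝ≥0∞) ^ 2 := by
        congr 2
        funext y
        rw [mul_left_comm, ← ENNReal.coe_mul, div_mul_cancel₀ _ (hw y), ENNReal.coe_pow]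
    _ = _ := by rw [ENNReal.tsum_mul_left, ← mul_assoc, pow_two]

theorem L2_enorm_sq {V : Type*} (f : L2 V) :
    ∑' y, ((‖f y‖₊ : ℝ≥0) : ℝ≥0∞) ^ 2 = ENNReal.ofReal (‖f‖ ^ 2) := by
  have h := lp.norm_rpow_eq_tsum (p := 2) (by norm_num) f
  have hs : Summable fun y => ‖f y‖ ^ (2 : ENNReal).toReal :=
    (lp.memℓp f).summable (by norm_num)
  norm_num at h hs
  rw [h, ENNReal.ofReal_tsum_of_nonneg (fun y => by positivity) hs]
  congr 1
  funext y
  rw [ENNReal.ofReal_pow (norm_nonneg _), ofReal_norm]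
  rfl

/-- **Schur's test**: a kernel with suitable row and column sums defines a bounded operator. -/
theorem exists_operator_of_schur {V : Type*} (K : V → V → ℂ) (w : V → ℝ≥0) (hw : ∀ x, w x ≠ 0)
    (M : ℝ≥0) (h1 : ∀ x, ∑' y, (‖K x y‖₊ * w y : ℝ≥0∞) ≤ M * w x)
    (h2 : ∀ y, ∑' x, (‖K x y‖₊ * w x : ℝ≥0∞) ≤ M * w y) :
    ∃ A : L2 V →L[ℂ] L2 V, ‖A‖ ≤ M ∧
      ∀ (f : L2 V) (x : V), HasSum (fun y => K x y * f y) (A f x) := by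
  have hsq : ∀ f : L2 V, ∑' x, (∑' y, (‖K x y‖₊ * ‖f y‖₊ : ℝ≥0∞)) ^ 2 ≤
      ENNReal.ofReal ((M * ‖f‖) ^ 2) := by
    intro f
    refine (tsum_sq_tsum_le_of_schur (fun x y => ‖K x y‖₊) w hw M h1 h2 fun y => ‖f y‖₊).trans ?_
    rw [L2_enorm_sq, mul_pow, ENNReal.ofReal_mul (by positivity),
      ENNReal.ofReal_pow M.coe_nonneg, ENNReal.ofReal_coe_nnreal]
  have hfin : ∀ (f : L2 V) x, ∑' y, (‖K x y‖₊ * ‖f y‖₊ : ℝ≥0∞) ≠ ∞ := by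
    intro f x h
    have h3 := (ENNReal.le_tsum (f := fun x => (∑' y, (‖K x y‖₊ * ‖f y‖₊ : ℝ≥0∞)) ^ 2) x).trans
      (hsq f)
    simp [h] at h3
  have hsum : ∀ (f : L2 V) x, Summable fun y => K x y * f y := by
    intro f x
    refine Summable.of_nnnorm ?_
    rw [← ENNReal.tsum_coe_ne_top_iff_summable]
    simpa only [nnnorm_mul, ENNReal.coe_mul] using hfin f x
  have hle : ∀ (f : L2 V) x, ((‖∑' y, K x y * f y‖₊ : ℝ≥0) : ℝ≥0∞) ≤
      ∑' y, (‖K x y‖₊ * ‖f y‖₊ : ℝ≥0∞) := by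
    intro f x
    have hs : Summable fun y => ‖K x y * f y‖₊ := by
      rw [← ENNReal.tsum_coe_ne_top_iff_summable]
      simpa only [nnnorm_mul, ENNReal.coe_mul] using hfin f x
    have h3 := nnnorm_tsum_le hs
    calc _ ≤ ((∑' y, ‖K x y * f y‖₊ : ℝ≥0) : ℝ≥0∞) := by exact_mod_cast h3
      _ = _ := by
        rw [ENNReal.coe_tsum hs]
        simp only [nnnorm_mul, ENNReal.coe_mul]
  have hsq' : ∀ f : L2 V, ∑' x, ENNReal.ofReal (‖∑' y, K x y * f y‖ ^ 2) ≤
      ENNReal.ofReal ((M * ‖f‖) ^ 2) := by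
    intro f
    refine le_trans (ENNReal.tsum_le_tsum fun x => ?_) (hsq f)
    rw [ENNReal.ofReal_pow (norm_nonneg _), ofReal_norm]
    gcongr
    exact hle f x
  have hsummable : ∀ f : L2 V, Summable fun x => ‖∑' y, K x y * f y‖ ^ 2 := by
    intro f
    have h3 := (hsq' f).trans_lt ENNReal.ofReal_lt_top
    have h4 := ENNReal.summable_toReal h3.ne
    refine h4.congr fun x => ?_
    rw [ENNReal.toReal_ofReal (by positivity)]
  have hmem : ∀ f : L2 V, Memℓp (fun x => ∑' y, K x y * f y) 2 := by
    intro f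
    rw [memℓp_gen_iff (by norm_num)]
    simpa using hsummable f
  let T : L2 V →ₗ[ℂ] L2 V :=
    { toFun := fun f => ⟨fun x => ∑' y, K x y * f y, hmem f⟩
      map_add' := fun f g => by
        ext x
        show ∑' y, K x y * (f + g) y = ∑' y, K x y * f y + ∑' y, K x y * g y
        rw [← (hsum f x).tsum_add (hsum g x)]
        simp [mul_add]
      map_smul' := fun a f => by
        ext x
        show ∑' y, K x y * (a • f) y = a * ∑' y, K x y * f y
        rw [← tsum_mul_left]
        congr 1
        funext y
        simp only [lp.coeFn_smul, Pi.smul_apply, smul_eq_mul]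
        ring }
  have hT : ∀ f, ‖T f‖ ≤ M * ‖f‖ := by
    intro f
    refine lp.norm_le_of_tsum_le (by norm_num) (by positivity) ?_
    have h3 : ∑' x, ‖∑' y, K x y * f y‖ ^ 2 ≤ (M * ‖f‖) ^ 2 := by
      rw [← ENNReal.ofReal_le_ofReal_iff (by positivity),
        ENNReal.ofReal_tsum_of_nonneg (fun x => by positivity) (hsummable f)]
      exact hsq' f
    have h4 : ∑' x, ‖T f x‖ ^ 2 ≤ (M * ‖f‖) ^ 2 := h3
    simpa using h4
  exact ⟨T.mkContinuous M hT, T.mkContinuous_norm_le M.2 hT, fun f x => (hsum f x).hasSum⟩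

end Schur

/-! ### Sums over the vertices of a tree -/

section TreeSums

open scoped NNReal ENNReal

variable {V : Type*} {G : SimpleGraph V} {o : V} {q : ℕ}

/-- Summation over a tree along a sequence of vertices from which the other vertices branch off. -/
theorem tsum_le_of_branches [G.LocallyFinite] (hG : G.IsTree) (hq1 : 1 ≤ q)
    (hreg : G.IsRegularOfDegree (q + 1)) (p : ℕ → V) (f : V → ℝ≥0∞) (g : ℕ → ℕ → ℝ≥0∞)
    (h : ∀ y, ∃ j k, G.dist (p j) y = k ∧ f y ≤ g j k) :
    ∑' y, f y ≤ ∑' j, ∑' k, 2 * (q : ℝ≥0∞) ^ k * g j k := by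
  classical
  have hpt : ∀ y, f y ≤ ∑' j, ∑' k, {y | G.dist (p j) y = k}.indicator (fun _ => g j k) y := by
    intro y
    obtain ⟨j, k, h1, h2⟩ := h y
    refine h2.trans (le_trans ?_ (ENNReal.le_tsum j))
    refine le_trans ?_ (ENNReal.le_tsum k)
    rw [indicator_of_mem (show y ∈ {y | G.dist (p j) y = k} from h1)]
  refine (ENNReal.tsum_le_tsum hpt).trans ?_
  rw [ENNReal.tsum_comm]
  refine ENNReal.tsum_le_tsum fun j => ?_
  rw [ENNReal.tsum_comm]
  refine ENNReal.tsum_le_tsum fun k => ?_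
  have hfin := finite_sphere hG.1 (p j) k
  rw [tsum_eq_sum (s := hfin.toFinset) fun y hy =>
    indicator_of_notMem (by simpa using hy) _]
  have h3 : ∑ y ∈ hfin.toFinset, {y | G.dist (p j) y = k}.indicator (fun _ => g j k) y ≤
      hfin.toFinset.card • g j k :=
    Finset.sum_le_card_nsmul _ _ _ fun y _ => indicator_le_self' (fun _ _ => zero_le) y
  refine h3.trans ?_
  rw [← Set.ncard_eq_toFinset_card _ hfin, nsmul_eq_mul]
  gcongr
  exact_mod_cast ncard_sphere_le hG hq1 hreg (p j) k

theorem exists_tsum_inv_sq_lt : ∃ S : ℝ≥0, ∑' j : ℕ, ∑' k : ℕ,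
    ENNReal.ofReal (1 / (1 + (j : ℝ)) ^ 2) * ENNReal.ofReal (1 / (1 + (k : ℝ)) ^ 2) ≤ S := by
  have hs : Summable fun j : ℕ => 1 / (1 + (j : ℝ)) ^ 2 := by
    have h := (summable_nat_add_iff 1).2 (Real.summable_one_div_nat_pow.2 (by norm_num : 1 < 2))
    refine h.congr fun j => ?_
    push_cast
    ring
  have h0 : ∀ j : ℕ, 0 ≤ 1 / (1 + (j : ℝ)) ^ 2 := fun j => by positivity
  refine ⟨((∑' j : ℕ, ENNReal.ofReal (1 / (1 + (j : ℝ)) ^ 2)) *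
    ∑' j : ℕ, ENNReal.ofReal (1 / (1 + (j : ℝ)) ^ 2)).toNNReal, ?_⟩
  rw [ENNReal.coe_toNNReal]
  · simp_rw [ENNReal.tsum_mul_left, ENNReal.tsum_mul_right]
    exact le_rfl
  · rw [← ENNReal.ofReal_tsum_of_nonneg h0 hs]
    exact ENNReal.mul_ne_top ENNReal.ofReal_ne_top ENNReal.ofReal_ne_top

/-- The factor q^(-k) cancels the growth of spheres; two convergent series remain. -/
theorem tsum_branch_weights_le (hq1 : 1 ≤ q) {S : ℝ≥0} (hS : ∑' j : ℕ, ∑' k : ℕ,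
    ENNReal.ofReal (1 / (1 + (j : ℝ)) ^ 2) * ENNReal.ofReal (1 / (1 + (k : ℝ)) ^ 2) ≤ S)
    {A : ℝ} (hA : 0 ≤ A) :
    ∑' j : ℕ, ∑' k : ℕ, 2 * (q : ℝ≥0∞) ^ k * ENNReal.ofReal
      (A * (((q : ℝ) ^ k)⁻¹ * (1 / (1 + (j : ℝ)) ^ 2 * (1 / (1 + (k : ℝ)) ^ 2)))) ≤
      ENNReal.ofReal (2 * S * A) := by
  have hq0 : (0 : ℝ) < q := by exact_mod_cast hq1
  have e : ∀ j k : ℕ, 2 * (q : ℝ≥0∞) ^ k * ENNReal.ofReal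
      (A * (((q : ℝ) ^ k)⁻¹ * (1 / (1 + (j : ℝ)) ^ 2 * (1 / (1 + (k : ℝ)) ^ 2)))) =
      ENNReal.ofReal (2 * A) * (ENNReal.ofReal (1 / (1 + (j : ℝ)) ^ 2) *
        ENNReal.ofReal (1 / (1 + (k : ℝ)) ^ 2)) := by
    intro j k
    have h1 : 2 * (q : ℝ≥0∞) ^ k = ENNReal.ofReal (2 * (q : ℝ) ^ k) := by
      rw [ENNReal.ofReal_mul (by norm_num), ENNReal.ofReal_pow hq0.le, ENNReal.ofReal_natCast]
      norm_num
    rw [h1, ← ENNReal.ofReal_mul (by positivity), ← ENNReal.ofReal_mul (by positivity),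
      ← ENNReal.ofReal_mul (by positivity)]
    congr 1
    field_simp
  simp_rw [e, ENNReal.tsum_mul_left]
  simp_rw [ENNReal.tsum_mul_left] at hS
  calc _ ≤ ENNReal.ofReal (2 * A) * S := by gcongr
    _ = _ := by
      rw [show 2 * (S : ℝ) * A = (2 * A) * S by ring,
        ENNReal.ofReal_mul (p := 2 * A) (by positivity), ENNReal.ofReal_coe_nnreal]

/-- Origin of the exponent 4 in the decay conditions: a summable square for the position j of the
branching vertex and another for the distance k from it. -/
theorem one_div_pow_four_le (j k : ℕ) : 1 / (1 + ((j + k : ℕ) : ℝ)) ^ 4 ≤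
    1 / (1 + (j : ℝ)) ^ 2 * (1 / (1 + (k : ℝ)) ^ 2) := by
  rw [one_div_mul_one_div]
  refine one_div_le_one_div_of_le (by positivity) ?_
  push_cast
  have hj : (0 : ℝ) ≤ j := Nat.cast_nonneg j
  have hk : (0 : ℝ) ≤ k := Nat.cast_nonneg k
  calc _ ≤ (1 + (j + k : ℝ)) ^ 2 * (1 + (j + k : ℝ)) ^ 2 := by gcongr <;> linarith
    _ = _ := by ring

/-- The rapidly decaying kernels satisfy the hypothesis of Schur's test, with weights
`q ^ (h_ω / 2)`. -/
theorem exists_tsum_decay_mul_weight_le [G.LocallyFinite] (hG : G.IsTree) (hq1 : 1 ≤ q)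
    (hreg : G.IsRegularOfDegree (q + 1)) (ω : Boundary G o) : ∃ S : ℝ, 0 ≤ S ∧ ∀ x : V,
      ∑' y, ENNReal.ofReal ((q : ℝ) ^ (-(G.dist x y : ℝ) / 2) / (1 + (G.dist x y : ℝ)) ^ 4 *
        (q : ℝ) ^ ((height ω y : ℝ) / 2)) ≤
          ENNReal.ofReal (S * (q : ℝ) ^ ((height ω x : ℝ) / 2)) := by
  obtain ⟨S, hS⟩ := exists_tsum_inv_sq_lt
  have hq0 : (0 : ℝ) < q := by exact_mod_cast hq1
  refine ⟨2 * S, by positivity, fun x => ?_⟩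
  obtain ⟨p, hp, hω⟩ := exists_ray hG x ω
  refine le_trans (tsum_le_of_branches hG hq1 hreg p _ _ fun y => ?_)
    (tsum_branch_weights_le hq1 hS (A := (q : ℝ) ^ ((height ω x : ℝ) / 2)) (by positivity))
  obtain ⟨m, h1, h2, h3⟩ := exists_median_boundary hG x y ω
  have hm : m = p (G.dist x m) := eq_of_mem_cylinder hG h2 (hω _) (by rw [hp])
  refine ⟨G.dist x m, G.dist m y, by rw [← hm], ENNReal.ofReal_le_ofReal ?_⟩
  have hh := height_sub_height hG.1 h2 h3
  rw [G.dist_comm (u := y)] at hh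
  have hh' : (height ω y : ℝ) = height ω x + G.dist x m - G.dist m y := by
    have : height ω y = height ω x + G.dist x m - G.dist m y := by omega
    exact_mod_cast congrArg (fun n : ℤ => (n : ℝ)) this
  -- With j steps along the ray and k steps off it, d(x, y) = j + k and h(y) = h(x) + j - k. The
  -- powers of q in j cancel, and the k steps leave exactly q^(-k).
  have e : (q : ℝ) ^ (-(G.dist x y : ℝ) / 2) * (q : ℝ) ^ ((height ω y : ℝ) / 2) =
      (q : ℝ) ^ ((height ω x : ℝ) / 2) * ((q : ℝ) ^ (G.dist m y))⁻¹ := by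
    rw [← Real.rpow_natCast, ← Real.rpow_neg hq0.le, ← Real.rpow_add hq0, ← Real.rpow_add hq0, hh',
      ← h1]
    congr 1
    push_cast
    ring
  calc _ = (q : ℝ) ^ (-(G.dist x y : ℝ) / 2) * (q : ℝ) ^ ((height ω y : ℝ) / 2) *
        (1 / (1 + ((G.dist x m + G.dist m y : ℕ) : ℝ)) ^ 4) := by rw [h1]; ring
    _ ≤ (q : ℝ) ^ ((height ω x : ℝ) / 2) * ((q : ℝ) ^ (G.dist m y))⁻¹ *
        (1 / (1 + (G.dist x m : ℝ)) ^ 2 * (1 / (1 + (G.dist m y : ℝ)) ^ 2)) := by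
        rw [e]
        gcongr
        exact one_div_pow_four_le _ _
    _ = _ := by ring

/-- The convolution of two rapidly decaying kernels decays rapidly. -/
theorem exists_tsum_decay_mul_decay_le [G.LocallyFinite] (hG : G.IsTree) (hq1 : 1 ≤ q)
    (hreg : G.IsRegularOfDegree (q + 1)) : ∃ S : ℝ, 0 ≤ S ∧ ∀ (N : ℕ) (x y : V),
      ∑' z, ENNReal.ofReal (((q : ℝ) ^ (-(G.dist x z : ℝ) / 2) /
          (1 + (G.dist x z : ℝ)) ^ (N + 4)) *
        ((q : ℝ) ^ (-(G.dist z y : ℝ) / 2) / (1 + (G.dist z y : ℝ)) ^ N)) ≤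
      ENNReal.ofReal (S * ((q : ℝ) ^ (-(G.dist x y : ℝ) / 2) / (1 + (G.dist x y : ℝ)) ^ N)) := by
  obtain ⟨S, hS⟩ := exists_tsum_inv_sq_lt
  have hq0 : (0 : ℝ) < q := by exact_mod_cast hq1
  refine ⟨2 * S, by positivity, fun N x y => ?_⟩
  have hex : ∀ j, ∃ p, j ≤ G.dist x y → G.dist x p = j ∧ G.dist x p + G.dist p y = G.dist x y := by
    intro j
    by_cases hj : j ≤ G.dist x y
    · obtain ⟨p, h1, h2⟩ := exists_dist_eq_of_le hG.1 x y hj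
      exact ⟨p, fun _ => ⟨h1, h2⟩⟩
    · exact ⟨x, fun h => absurd h hj⟩
  choose p hp using hex
  refine le_trans (tsum_le_of_branches hG hq1 hreg p _ _ fun z => ?_)
    (tsum_branch_weights_le hq1 hS
      (A := (q : ℝ) ^ (-(G.dist x y : ℝ) / 2) / (1 + (G.dist x y : ℝ)) ^ N) (by positivity))
  obtain ⟨m, h1, h2, h3⟩ := exists_median hG x y z
  have hpm := hp (G.dist x m) (by omega)
  have hm : m = p (G.dist x m) := eq_of_dist_eq hG h1 hpm.2 hpm.1.symm
  refine ⟨G.dist x m, G.dist m z, by rw [← hm], ENNReal.ofReal_le_ofReal ?_⟩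
  obtain ⟨j, hj⟩ : ∃ j, G.dist x m = j := ⟨_, rfl⟩
  obtain ⟨k, hk⟩ : ∃ k, G.dist m z = k := ⟨_, rfl⟩
  obtain ⟨i, hi⟩ : ∃ i, G.dist m y = i := ⟨_, rfl⟩
  have e1 : G.dist x z = j + k := by omega
  have e2 : G.dist z y = i + k := by rw [G.dist_comm, ← h3, G.dist_comm]; omega
  have e3 : G.dist x y = j + i := by omega
  rw [e1, e2, e3, hj, hk]
  have e : (q : ℝ) ^ (-((j + k : ℕ) : ℝ) / 2) * (q : ℝ) ^ (-((i + k : ℕ) : ℝ) / 2) =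
      (q : ℝ) ^ (-((j + i : ℕ) : ℝ) / 2) * ((q : ℝ) ^ k)⁻¹ := by
    rw [← Real.rpow_natCast, ← Real.rpow_neg hq0.le, ← Real.rpow_add hq0, ← Real.rpow_add hq0]
    congr 1
    push_cast
    ring
  -- From 1 + j + i ≤ (1 + j + k)(1 + i + k).
  have hle : 1 / ((1 + ((j + k : ℕ) : ℝ)) ^ N * (1 + ((i + k : ℕ) : ℝ)) ^ N) ≤
      1 / (1 + ((j + i : ℕ) : ℝ)) ^ N := by
    rw [← mul_pow]
    refine one_div_le_one_div_of_le (by positivity) ?_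
    gcongr
    push_cast
    have hj0 : (0 : ℝ) ≤ j := Nat.cast_nonneg j
    have hk0 : (0 : ℝ) ≤ k := Nat.cast_nonneg k
    have hi0 : (0 : ℝ) ≤ i := Nat.cast_nonneg i
    nlinarith [mul_nonneg (add_nonneg hj0 hk0) (add_nonneg hi0 hk0)]
  calc _ = ((q : ℝ) ^ (-((j + k : ℕ) : ℝ) / 2) * (q : ℝ) ^ (-((i + k : ℕ) : ℝ) / 2)) *
        (1 / ((1 + ((j + k : ℕ) : ℝ)) ^ N * (1 + ((i + k : ℕ) : ℝ)) ^ N)) *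
        (1 / (1 + ((j + k : ℕ) : ℝ)) ^ 4) := by
        rw [pow_add]
        field_simp
    _ ≤ ((q : ℝ) ^ (-((j + i : ℕ) : ℝ) / 2) * ((q : ℝ) ^ k)⁻¹) *
        (1 / (1 + ((j + i : ℕ) : ℝ)) ^ N) *
        (1 / (1 + (j : ℝ)) ^ 2 * (1 / (1 + (k : ℝ)) ^ 2)) := by
        rw [e]
        gcongr
        exact one_div_pow_four_le _ _
    _ = _ := by ring

/-- Rapidly decaying kernels define bounded operators. -/
theorem exists_operator_of_decay [G.LocallyFinite] (hG : G.IsTree) (hq1 : 1 ≤ q)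
    (hreg : G.IsRegularOfDegree (q + 1)) (o : V) : ∃ S : ℝ, 0 ≤ S ∧
      ∀ (K : V → V → ℂ) (C : ℝ), 0 ≤ C → (∀ x y, ‖K x y‖ ≤
        C * ((q : ℝ) ^ (-(G.dist x y : ℝ) / 2) / (1 + (G.dist x y : ℝ)) ^ 4)) →
      ∃ A : L2 V →L[ℂ] L2 V, ‖A‖ ≤ C * S ∧
        ∀ (f : L2 V) (x : V), HasSum (fun y => K x y * f y) (A f x) := by
  obtain ⟨ω, -⟩ := cylinder_nonempty (o := o) hG hq1 hreg o o
  have hq0 : (0 : ℝ) < q := by exact_mod_cast hq1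
  obtain ⟨S, hS0, hS⟩ := exists_tsum_decay_mul_weight_le hG hq1 hreg ω
  refine ⟨S, hS0, fun K C hC hK => ?_⟩
  set w : V → ℝ≥0 := fun x => ((q : ℝ) ^ ((height ω x : ℝ) / 2)).toNNReal with hw
  have hwr : ∀ x, (w x : ℝ) = (q : ℝ) ^ ((height ω x : ℝ) / 2) := fun x =>
    Real.coe_toNNReal _ (by positivity)
  have hterm : ∀ x y y', ‖K x y‖ ≤ C * ((q : ℝ) ^ (-(G.dist x y : ℝ) / 2) /
      (1 + (G.dist x y : ℝ)) ^ 4) → (‖K x y‖₊ * w y' : ℝ≥0∞) ≤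
      ENNReal.ofReal C * ENNReal.ofReal ((q : ℝ) ^ (-(G.dist x y : ℝ) / 2) /
        (1 + (G.dist x y : ℝ)) ^ 4 * (q : ℝ) ^ ((height ω y' : ℝ) / 2)) := by
    intro x y y' h
    rw [← ENNReal.ofReal_mul hC, ← ENNReal.coe_mul, ENNReal.le_ofReal_iff_toReal_le
      ENNReal.coe_ne_top (by positivity), ENNReal.coe_toReal, NNReal.coe_mul, coe_nnnorm, hwr,
      ← mul_assoc]
    gcongr
  have hM : ∀ x, ENNReal.ofReal C * ENNReal.ofReal (S * (q : ℝ) ^ ((height ω x : ℝ) / 2)) =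
      ((C * S).toNNReal : ℝ≥0∞) * w x := by
    intro x
    rw [← ENNReal.ofReal_mul hC, ← mul_assoc, ENNReal.ofReal_mul (by positivity)]
    rfl
  obtain ⟨A, hA1, hA2⟩ := exists_operator_of_schur K w
    (fun x h => by
      have := hwr x
      rw [h, NNReal.coe_zero] at this
      exact absurd this.symm (by positivity)) (C * S).toNNReal
    (fun x => by
      rw [← hM]
      refine (ENNReal.tsum_le_tsum fun y => hterm x y y (hK x y)).trans ?_
      rw [ENNReal.tsum_mul_left]
      gcongr
      exact hS x)
    (fun y => by
      rw [← hM]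
      refine (ENNReal.tsum_le_tsum fun x => hterm x y x (hK x y)).trans ?_
      rw [ENNReal.tsum_mul_left]
      gcongr
      simp_rw [G.dist_comm (v := y)]
      exact hS y)
  exact ⟨A, by rwa [Real.coe_toNNReal _ (by positivity)] at hA1, hA2⟩

end TreeSums

/-! ### Symbols at a single vertex -/

section LocalSymbols

variable {V : Type*} {G : SimpleGraph V} {o : V} {q : ℕ}

/-- The values `c ω s` at the vertex `x` of a symbol: flat in `s`, with derivatives of order at most
`N` bounded by `B`, and with oscillation at most `B / (1 + d(x, v)) ^ N` on `Ω(x, v)`. -/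
structure IsLocalSymbol (q N : ℕ) (B : ℝ) (x : V) (c : Boundary G o → ℝ → ℂ) : Prop where
  isFlat : ∀ ω, IsFlat q N B (c ω)
  osc : ∀ v, ∀ ω ∈ cylinder G o x v, ∀ ω' ∈ cylinder G o x v, ∀ s ∈ Icc 0 (tau q),
    ‖c ω s - c ω' s‖ ≤ B / (1 + (G.dist x v : ℝ)) ^ N

theorem IsLocalSymbol.min {N : ℕ} {B B' : ℝ} {x : V} {c : Boundary G o → ℝ → ℂ}
    (h : IsLocalSymbol q N B x c) (h' : IsLocalSymbol q N B' x c) :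
    IsLocalSymbol q N (min B B') x c := by
  rcases le_total B B' with hB | hB
  · rwa [min_eq_left hB]
  · rwa [min_eq_right hB]

theorem IsLocalSymbol.osc_one {N : ℕ} {B : ℝ} {x : V} {c : Boundary G o → ℝ → ℂ} (hq : 2 ≤ q)
    (hc : IsLocalSymbol q (N + 1) B x c) (v : V) {ω ω' : Boundary G o}
    (hω : ω ∈ cylinder G o x v) (hω' : ω' ∈ cylinder G o x v) {s : ℝ} (hs : s ∈ Icc 0 (tau q)) :
    ‖c ω s - c ω' s‖ ≤ B / (1 + (G.dist x v : ℝ)) := by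
  refine (hc.osc v ω hω ω' hω' s hs).trans ?_
  have := (hc.isFlat ω).nonneg hq
  gcongr
  exact le_self_pow₀ (by linarith [(Nat.cast_nonneg (G.dist x v) : (0 : ℝ) ≤ G.dist x v)])
    (by omega)

theorem IsFlat.sub (hq : 2 ≤ q) {N : ℕ} {B B' D : ℝ} {f g : ℝ → ℂ} (hf : IsFlat q N B f)
    (hg : IsFlat q N B' g) (h : ∀ k ≤ N, ∀ s ∈ Icc 0 (tau q),
      ‖iteratedDerivWithin k f (Icc 0 (tau q)) s - iteratedDerivWithin k g (Icc 0 (tau q)) s‖ ≤ D) :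
    IsFlat q N D fun s => f s - g s := by
  have e : ∀ k, ∀ s ∈ Icc 0 (tau q), iteratedDerivWithin k (fun s => f s - g s) (Icc 0 (tau q)) s =
      iteratedDerivWithin k f (Icc 0 (tau q)) s - iteratedDerivWithin k g (Icc 0 (tau q)) s :=
    fun k s hs => iteratedDerivWithin_sub hs (uniqueDiffOn_Icc_tau hq)
      ((hf.smooth s hs).of_le (by exact_mod_cast le_top))
      ((hg.smooth s hs).of_le (by exact_mod_cast le_top))
  have ht := (tau_pos hq).le
  refine ⟨hf.smooth.sub hg.smooth, fun k => ⟨?_, ?_⟩, fun k hk s hs => ?_⟩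
  · rw [e k 0 (left_mem_Icc.2 ht), (hf.flat k).1, (hg.flat k).1, sub_zero]
  · rw [e k _ (right_mem_Icc.2 ht), (hf.flat k).2, (hg.flat k).2, sub_zero]
  · rw [e k s hs]
    exact h k hk s hs

theorem integrable_coef [G.LocallyFinite] (hG : G.IsTree) (hq : 2 ≤ q)
    (hreg : G.IsRegularOfDegree (q + 1)) {N : ℕ} {B : ℝ} {x : V} {c : Boundary G o → ℝ → ℂ}
    (hc : IsLocalSymbol q (N + 1) B x c) (m : ℤ) :
    Integrable (fun ω => coef q (c ω) m) (nu q x) := by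
  have : Countable V := countable_of_locallyFinite hG.1
  have := secondCountable_boundary (G := G) (o := o)
  have := isProbabilityMeasure_nu (o := o) hG (by omega) hreg x
  obtain ⟨C, -, hC⟩ := exists_norm_coef_le hq 0
  refine Integrable.of_bound
    (continuous_coef hG hq (fun ω => (hc.isFlat ω).smooth.continuousOn) hc.osc
      m).aestronglyMeasurable
    (C * B) (Eventually.of_forall fun ω => ?_)
  have hf : IsFlat q 0 B (c ω) := ⟨(hc.isFlat ω).smooth, (hc.isFlat ω).flat,
    fun k hk => (hc.isFlat ω).bound k (by omega)⟩
  simpa using (hC B _ hf m).1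

theorem kernel_sub [G.LocallyFinite] (hG : G.IsTree) (hq : 2 ≤ q)
    (hreg : G.IsRegularOfDegree (q + 1)) {N : ℕ} {B B' : ℝ} {x : V}
    {c c' : Boundary G o → ℝ → ℂ} (hc : IsLocalSymbol q (N + 1) B x c)
    (hc' : IsLocalSymbol q (N + 1) B' x c') (y : V) :
    kernel q (fun ω s => c ω s - c' ω s) x y = kernel q c x y - kernel q c' x y := by
  have hq1 : 1 ≤ q := by omega
  have hI := fun m => integrable_coef hG hq hreg hc m
  have hI' := fun m => integrable_coef hG hq hreg hc' m
  have e : ∀ ω m, coef q (fun s => c ω s - c' ω s) m = coef q (c ω) m - coef q (c' ω) m := by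
    intro ω m
    simp only [coef, mul_sub]
    exact integral_sub (integrable_wave_mul hq (hc.isFlat ω).smooth.continuousOn _)
      (integrable_wave_mul hq (hc'.isFlat ω).smooth.continuousOn _)
  rw [kernel_eq_sum hG hq1 _ x y fun m => by
      simp only [e]
      exact (hI m).sub (hI' m),
    kernel_eq_sum hG hq1 _ x y hI, kernel_eq_sum hG hq1 _ x y hI', ← mul_sub,
    ← Finset.sum_sub_distrib]
  congr 1
  refine Finset.sum_congr rfl fun j _ => ?_
  rw [← mul_sub, ← integral_sub (hI _).integrableOn (hI' _).integrableOn]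
  simp only [e]

theorem cylinderAt_eq (hG : G.IsTree) {x v : V} {ω : Boundary G o} (h : ω ∈ cylinder G o x v) :
    cylinderAt x (G.dist x v) ω = cylinder G o x v := by
  ext ω'
  constructor
  · rintro ⟨y, hy, h1, h2⟩
    rwa [eq_of_mem_cylinder hG h h1 hy.symm]
  · exact fun h' => ⟨v, rfl, h, h'⟩

theorem average_eq_average (hG : G.IsTree) {x v : V} {ω ω' : Boundary G o}
    (h : ω ∈ cylinder G o x v) (h' : ω' ∈ cylinder G o x v) (η : Boundary G o → ℂ) :
    average q x (G.dist x v) η ω = average q x (G.dist x v) η ω' := by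
  rw [average, average, cylinderAt_eq hG h, cylinderAt_eq hG h']

theorem norm_sub_le_two_mul {a b e : ℂ} {δ : ℝ} (h : ‖a - e‖ ≤ δ) (h' : ‖b - e‖ ≤ δ) :
    ‖a - b‖ ≤ 2 * δ := by
  have := norm_sub_le (a - e) (b - e)
  rw [sub_sub_sub_cancel_right] at this
  linarith

/-- The average of order d(x, v) is constant on Ω(x, v), so the oscillation there is at most twice
the distance of the symbol from its average. -/
theorem IsSymbolFamily.exists_isLocalSymbol (hG : G.IsTree) {a : ℝ → V → Boundary G o → ℝ → ℂ}
    (ha : IsSymbolFamily q a) (N : ℕ) :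
    ∃ B, 0 ≤ B ∧ ∀ ε > 0, ∀ x, IsLocalSymbol q N B x (a ε x) := by
  choose C hC using ha.bounded
  obtain ⟨R, hR⟩ := ha.regular N
  have hle : ∀ k ≤ N, C k ≤ ∑ k ∈ Finset.range (N + 1), |C k| + 2 * |R| := by
    intro k hk
    have := Finset.single_le_sum (f := fun k => |C k|) (fun k _ => abs_nonneg _)
      (Finset.mem_range.2 (show k < N + 1 by omega))
    linarith [le_abs_self (C k), abs_nonneg R]
  have h0 : 0 ≤ ∑ k ∈ Finset.range (N + 1), |C k| := Finset.sum_nonneg fun k _ => abs_nonneg _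
  refine ⟨∑ k ∈ Finset.range (N + 1), |C k| + 2 * |R|, by positivity, fun ε hε x => ⟨fun ω =>
    ⟨ha.smooth ε hε x ω, fun k => ha.flat ε hε k x ω,
      fun k hk s hs => (hC k ε hε x ω s hs).trans (hle k hk)⟩, fun v ω hω ω' hω' s hs => ?_⟩⟩
  have h1 := hR ε hε (G.dist x v) x ω s hs
  have h2 := hR ε hε (G.dist x v) x ω' s hs
  rw [average_eq_average hG hω' hω] at h2
  refine (norm_sub_le_two_mul h1 h2).trans ?_
  rw [← mul_div_assoc]
  gcongr
  linarith [le_abs_self R]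

/-- The difference of the values of a semi-classical symbol at two vertices. -/
theorem IsSemiclassical.exists_isLocalSymbol_sub (hG : G.IsTree) (hq : 2 ≤ q)
    {b : ℝ → V → Boundary G o → ℝ → ℂ} (hb : IsSemiclassical q b) (N : ℕ) :
    ∃ (F : ℕ → ℝ) (C : ℝ), (∀ t, 0 ≤ F t) ∧ 0 ≤ C ∧ ∀ ε > 0, ∀ x z,
      IsLocalSymbol q N (min (ε * F (G.dist x z)) (C * (1 + (G.dist x z : ℝ)) ^ N)) z
        fun ω s => b ε z ω s - b ε x ω s := by
  obtain ⟨B, hB0, hB⟩ := hb.toIsSymbolFamily.exists_isLocalSymbol hG N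
  choose L hL using hb.lipschitz
  obtain ⟨R, hR⟩ := hb.cross N
  have h0 : 0 ≤ ∑ k ∈ Finset.range (N + 1), |L k| := Finset.sum_nonneg fun k _ => abs_nonneg _
  have hle : ∀ k ≤ N, L k ≤ ∑ k ∈ Finset.range (N + 1), |L k| := by
    intro k hk
    have := Finset.single_le_sum (f := fun k => |L k|) (fun k _ => abs_nonneg _)
      (Finset.mem_range.2 (show k < N + 1 by omega))
    linarith [le_abs_self (L k)]
  -- The first bound comes from the two semi-classical conditions and is of order ε; the second
  -- comes from `b` being bounded in S and does not involve ε.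
  refine ⟨fun t => (∑ k ∈ Finset.range (N + 1), |L k|) * t + 2 * |R t|, 2 * B,
    fun t => by positivity, by positivity, fun ε hε x z => IsLocalSymbol.min ⟨fun ω => ?_, ?_⟩
      ⟨fun ω => ?_, ?_⟩⟩
  · refine ((hB ε hε z).isFlat ω).sub hq ((hB ε hε x).isFlat ω) fun k hk s hs => ?_
    refine (hL k ε hε z x ω s hs).trans ?_
    rw [G.dist_comm]
    calc L k * ε * G.dist x z = ε * (L k * G.dist x z) := by ring
      _ ≤ ε * ((∑ k ∈ Finset.range (N + 1), |L k|) * G.dist x z + 2 * |R (G.dist x z)|) := by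
        have := hle k hk
        have h3 := abs_nonneg (R (G.dist x z))
        have h4 : L k * (G.dist x z : ℝ) ≤ (∑ k ∈ Finset.range (N + 1), |L k|) * G.dist x z := by
          gcongr
        gcongr
        linarith
  · intro v ω hω ω' hω' s hs
    have h1 := hR ε hε z x (G.dist z v) ω s hs
    have h2 := hR ε hε z x (G.dist z v) ω' s hs
    rw [average_eq_average hG hω' hω, average_eq_average hG hω' hω] at h2
    rw [sub_sub_sub_comm, G.dist_comm (u := z) (v := x)] at h1 h2
    refine (norm_sub_le_two_mul h1 h2).trans ?_
    rw [← mul_div_assoc, ← mul_div_assoc, mul_left_comm]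
    gcongr
    have h5 := le_abs_self (R (G.dist x z))
    have h6 : 0 ≤ (∑ k ∈ Finset.range (N + 1), |L k|) * (G.dist x z : ℝ) := by positivity
    linarith
  · refine ((hB ε hε z).isFlat ω).sub hq ((hB ε hε x).isFlat ω) fun k hk s hs => ?_
    refine (norm_sub_le _ _).trans ?_
    have h1 := ((hB ε hε z).isFlat ω).bound k hk s hs
    have h2 := ((hB ε hε x).isFlat ω).bound k hk s hs
    calc _ ≤ 2 * B := by linarith
      _ ≤ _ := le_mul_of_one_le_right (by positivity) (one_le_pow₀ (by
        linarith [(Nat.cast_nonneg (G.dist x z) : (0 : ℝ) ≤ G.dist x z)]))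
  · intro v ω hω ω' hω' s hs
    have hz := (hB ε hε z).osc v ω hω ω' hω' s hs
    -- The regularity of `b ε x` is known only for cylinders based at x. If v is not farther from z
    -- than x is, the trivial cylinder of depth 0 has to do.
    have hx : ‖b ε x ω s - b ε x ω' s‖ ≤ if G.dist x z < G.dist z v then
        B / (1 + (G.dist x v : ℝ)) ^ N else B / (1 + ((0 : ℕ) : ℝ)) ^ N := by
      split_ifs with h
      · have e := cylinder_eq_of_dist_lt (o := o) hG (x := z) (z := x) (v := v)
          (by rwa [G.dist_comm])
        exact (hB ε hε x).osc v ω (e ▸ hω) ω' (e ▸ hω') s hs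
      · have := (hB ε hε x).osc x ω (mem_cylinder_self hG.1 x ω) ω'
          (mem_cylinder_self hG.1 x ω') s hs
        rwa [SimpleGraph.dist_self] at this
    have t := hG.1.dist_triangle (u := z) (v := x) (w := v)
    rw [G.dist_comm (u := z) (v := x)] at t
    -- The change of base point from x to z loses a power of 1 + d(x, z), since 1 + d(z, v) ≤ (1 +
    -- d(x, z))(1 + k).
    have key : ∀ k : ℕ, G.dist z v ≤ G.dist x z + k → B / (1 + (k : ℝ)) ^ N ≤
        B * (1 + (G.dist x z : ℝ)) ^ N / (1 + (G.dist z v : ℝ)) ^ N := by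
      intro k hk
      rw [div_le_div_iff₀ (by positivity) (by positivity), mul_assoc, ← mul_pow]
      gcongr
      have hk' : (G.dist z v : ℝ) ≤ G.dist x z + k := by exact_mod_cast hk
      have h3 : 0 ≤ (G.dist x z : ℝ) * k := by positivity
      linarith
    have hx' : ‖b ε x ω s - b ε x ω' s‖ ≤
        B * (1 + (G.dist x z : ℝ)) ^ N / (1 + (G.dist z v : ℝ)) ^ N := by
      refine hx.trans ?_
      split_ifs with h
      · exact key _ t
      · exact key 0 (by omega)
    have hz' : ‖b ε z ω s - b ε z ω' s‖ ≤
        B * (1 + (G.dist x z : ℝ)) ^ N / (1 + (G.dist z v : ℝ)) ^ N :=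
      hz.trans (key _ (by omega))
    rw [sub_sub_sub_comm]
    refine (norm_sub_le _ _).trans ?_
    calc _ ≤ B * (1 + (G.dist x z : ℝ)) ^ N / (1 + (G.dist z v : ℝ)) ^ N +
        B * (1 + (G.dist x z : ℝ)) ^ N / (1 + (G.dist z v : ℝ)) ^ N := add_le_add hz' hx'
      _ = _ := by ring

end LocalSymbols

/-! ### Operators and their kernels -/

section KernelsOfOperators

variable {V : Type*} {G : SimpleGraph V} {o : V} {q : ℕ}

theorem opKernel_of_hasSum {K : V → V → ℂ} {A : L2 V →L[ℂ] L2 V}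
    (h : ∀ (f : L2 V) (x : V), HasSum (fun y => K x y * f y) (A f x)) (x y : V) :
    opKernel A x y = K x y := by
  classical
  refine (h (lp.single 2 y 1) x).unique ?_
  have h1 := hasSum_single (f := fun z => K x z * (lp.single 2 y (1 : ℂ) : L2 V) z) y
    fun z hz => by rw [lp.single_apply_ne _ _ _ hz, mul_zero]
  rw [lp.single_apply_self, mul_one] at h1
  convert h1

theorem opKernel_sub (A B : L2 V →L[ℂ] L2 V) (x y : V) :
    opKernel (A - B) x y = opKernel A x y - opKernel B x y := rfl

/-- An operator with the kernel of `Op(c)` extends `Op(c)`. -/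
theorem extends_op_of_opKernel {A : L2 V →L[ℂ] L2 V} {c : V → Boundary G o → ℝ → ℂ}
    (h : ∀ x y, opKernel A x y = kernel q (c x) x y) : Extends A (Op q c) := by
  classical
  intro u f hf x
  have e : f = ∑ y ∈ u.support, u y • (lp.single 2 y (1 : ℂ) : L2 V) := by
    ext z
    rw [lp.coeFn_sum, Finset.sum_apply, hf]
    simp only [lp.coeFn_smul, Pi.smul_apply, lp.single_apply, Pi.single_apply, smul_eq_mul,
      mul_ite, mul_one, mul_zero, Finset.sum_ite_eq, Finsupp.mem_support_iff]
    split_ifs with hz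
    · rfl
    · simpa using hz
  rw [e, map_sum, lp.coeFn_sum, Finset.sum_apply, Op]
  refine Finset.sum_congr rfl fun y _ => ?_
  have hk : A (lp.single 2 y (1 : ℂ)) x = kernel q (c x) x y := by
    rw [← h]
    unfold opKernel
    congr!
  rw [map_smul, lp.coeFn_smul, Pi.smul_apply, hk, smul_eq_mul, kernel, mul_comm,
    ← integral_mul_const]
  congr 1
  funext ω
  rw [← integral_mul_const]

end KernelsOfOperators

/-- The bound `ε F(t)`, combined with a uniform bound of polynomial growth, is small as `ε → 0`,
uniformly in `t`, relative to a faster polynomial growth. -/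
theorem exists_tendsto_zero_of_min {F : ℕ → ℝ} (hF : ∀ t, 0 ≤ F t) {C : ℝ} (hC : 0 ≤ C) (p : ℕ) :
    ∃ Θ : ℝ → ℝ, Tendsto Θ (𝓝[>] 0) (𝓝 0) ∧ ∀ ε > 0, 0 ≤ Θ ε ∧ ∀ t : ℕ,
      min (ε * F t) (C * (1 + (t : ℝ)) ^ p) ≤ Θ ε * (1 + (t : ℝ)) ^ (p + 1) := by
  set θ : ℝ → ℕ → ℝ := fun ε t =>
    min (ε * F t) (C * (1 + (t : ℝ)) ^ p) / (1 + (t : ℝ)) ^ (p + 1) with hθ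
  have hle : ∀ ε t, θ ε t ≤ C / (1 + (t : ℝ)) := by
    intro ε t
    calc θ ε t ≤ (C * (1 + (t : ℝ)) ^ p) / (1 + (t : ℝ)) ^ (p + 1) := by
          rw [hθ]
          dsimp only
          gcongr
          exact min_le_right _ _
      _ = _ := by rw [pow_succ]; field_simp
  have hleC : ∀ ε t, θ ε t ≤ C := fun ε t => (hle ε t).trans (div_le_self hC (by
    linarith [(Nat.cast_nonneg t : (0 : ℝ) ≤ t)]))
  have hbdd : ∀ ε, BddAbove (range (θ ε)) := fun ε => ⟨C, by
    rintro _ ⟨t, rfl⟩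
    exact hleC ε t⟩
  have hpos : ∀ ε > 0, ∀ t, 0 ≤ θ ε t := fun ε hε t =>
    div_nonneg (le_min (mul_nonneg hε.le (hF t)) (by positivity)) (by positivity)
  refine ⟨fun ε => ⨆ t, θ ε t, ?_, fun ε hε => ⟨Real.iSup_nonneg (hpos ε hε), fun t => ?_⟩⟩
  · rw [Metric.tendsto_nhds]
    intro δ hδ
    -- Beyond R the polynomial bound alone gives δ/2, for every ε; below R there are finitely many
    -- t, and each ε F(t) tends to 0.
    obtain ⟨R, hR⟩ := exists_nat_gt (C / (δ / 2))
    have hsmall : ∀ t ∈ Finset.range R, ∀ᶠ ε : ℝ in 𝓝[>] 0, ε * F t ≤ δ / 2 := by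
      intro t _
      have h1 : Tendsto (fun ε : ℝ => ε * F t) (𝓝[>] 0) (𝓝 0) := by
        have : Tendsto (fun ε : ℝ => ε * F t) (𝓝 0) (𝓝 (0 * F t)) :=
          tendsto_id.mul_const (F t)
        rw [zero_mul] at this
        exact this.mono_left nhdsWithin_le_nhds
      exact (h1.eventually (gt_mem_nhds (half_pos hδ))).mono fun ε h => h.le
    filter_upwards [(Finset.eventually_all _).2 hsmall, self_mem_nhdsWithin] with ε hε hε0
    rw [Real.dist_0_eq_abs, abs_of_nonneg (Real.iSup_nonneg (hpos ε hε0))]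
    refine lt_of_le_of_lt (ciSup_le fun t => ?_) (half_lt_self hδ)
    by_cases ht : t < R
    · calc θ ε t ≤ (ε * F t) / (1 + (t : ℝ)) ^ (p + 1) := by
            rw [hθ]
            dsimp only
            gcongr
            exact min_le_left _ _
        _ ≤ ε * F t := div_le_self (mul_nonneg (le_of_lt hε0) (hF t)) (one_le_pow₀ (by
            linarith [(Nat.cast_nonneg t : (0 : ℝ) ≤ t)]))
        _ ≤ δ / 2 := hε t (Finset.mem_range.2 ht)
    · refine (hle ε t).trans ?_
      have h2 : (R : ℝ) ≤ t := by exact_mod_cast not_lt.1 ht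
      rw [div_lt_iff₀ (half_pos hδ)] at hR
      rw [div_le_iff₀ (by positivity)]
      nlinarith
  · rw [← div_le_iff₀ (by positivity)]
    exact le_ciSup (hbdd ε) t

/-! ### The composition formula and its remainder -/

section Composition

variable {V : Type*} {G : SimpleGraph V} {o : V} {q : ℕ}

theorem IsSymbolFamily.exists_norm_kernel_le [G.LocallyFinite] (hG : G.IsTree) (hq : 2 ≤ q)
    (hreg : G.IsRegularOfDegree (q + 1)) {a : ℝ → V → Boundary G o → ℝ → ℂ}
    (ha : IsSymbolFamily q a) (N : ℕ) : ∃ C, 0 ≤ C ∧ ∀ ε > 0, ∀ x y, ‖kernel q (a ε x) x y‖ ≤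
      C * ((q : ℝ) ^ (-(G.dist x y : ℝ) / 2) / (1 + (G.dist x y : ℝ)) ^ N) := by
  obtain ⟨B, hB0, hB⟩ := ha.exists_isLocalSymbol hG (N + 1)
  obtain ⟨C, hC0, hC⟩ := TreePDO.exists_norm_kernel_le (o := o) hG hq hreg N
  exact ⟨C * B, by positivity, fun ε hε x y =>
    hC B x (a ε x) (hB ε hε x).isFlat (hB ε hε x).osc y⟩

theorem IsSymbolFamily.exists_operator [G.LocallyFinite] (hG : G.IsTree) (hq : 2 ≤ q)
    (hreg : G.IsRegularOfDegree (q + 1)) {a : ℝ → V → Boundary G o → ℝ → ℂ}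
    (ha : IsSymbolFamily q a) : ∃ A : ℝ → L2 V →L[ℂ] L2 V, ∀ ε > 0, ∀ (f : L2 V) (x : V),
      HasSum (fun y => kernel q (a ε x) x y * f y) (A ε f x) := by
  obtain ⟨C, hC0, hC⟩ := ha.exists_norm_kernel_le hG hq hreg 4
  obtain ⟨S, -, hS⟩ := exists_operator_of_decay hG (by omega : 1 ≤ q) hreg o
  have h : ∀ ε : ℝ, ∃ A : L2 V →L[ℂ] L2 V, ε > 0 → ∀ (f : L2 V) (x : V),
      HasSum (fun y => kernel q (a ε x) x y * f y) (A f x) := by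
    intro ε
    by_cases hε : ε > 0
    · obtain ⟨A, -, hA⟩ := hS (fun x y => kernel q (a ε x) x y) C hC0 (hC ε hε)
      exact ⟨A, fun _ => hA⟩
    · exact ⟨0, fun h => absurd h hε⟩
  choose A hA using h
  exact ⟨A, hA⟩

/-- The difference between composition and the operator of the product symbol, as a series. -/
theorem hasSum_kernel_mul_kernel_sub [G.LocallyFinite] (hG : G.IsTree) (hq : 2 ≤ q)
    (hreg : G.IsRegularOfDegree (q + 1)) {a b : ℝ → V → Boundary G o → ℝ → ℂ}
    (ha : IsSymbolFamily q a) (hb : IsSemiclassical q b) {A B : L2 V →L[ℂ] L2 V} {ε : ℝ}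
    (hε : 0 < ε) (hA : ∀ (f : L2 V) (x : V), HasSum (fun y => kernel q (a ε x) x y * f y) (A f x))
    (hB : ∀ (f : L2 V) (x : V), HasSum (fun y => kernel q (b ε x) x y * f y) (B f x)) (x y : V) :
    HasSum (fun z => kernel q (a ε x) x z * kernel q (fun ω s => b ε z ω s - b ε x ω s) z y)
      (opKernel (A ∘L B) x y - kernel q (fun ω s => a ε x ω s * b ε x ω s) x y) := by
  classical
  obtain ⟨Ba, -, hBa⟩ := ha.exists_isLocalSymbol hG 1
  obtain ⟨Bb, -, hBb⟩ := hb.toIsSymbolFamily.exists_isLocalSymbol hG 1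
  obtain ⟨F, C, -, -, hF⟩ := hb.exists_isLocalSymbol_sub hG hq 1
  have h1 := hasSum_kernel_mul_kernel hG hq hreg (x := x)
    (by simpa [partialS] using ha.continuous ε hε 0 x)
    (fun ω s hs => ((hBa ε hε x).isFlat ω).bound_zero hs)
    (fun v ω hω ω' hω' s hs => (hBa ε hε x).osc_one hq v hω hω' hs)
    (by simpa [partialS] using hb.continuous ε hε 0 x)
    (fun ω s hs => ((hBb ε hε x).isFlat ω).bound_zero hs) y
  have h2 : HasSum (fun z => kernel q (a ε x) x z * kernel q (b ε z) z y)
      (opKernel (A ∘L B) x y) := by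
    have h3 := hA (B (lp.single 2 y 1)) x
    have h4 : ∀ z, B (lp.single 2 y (1 : ℂ)) z = kernel q (b ε z) z y := by
      intro z
      rw [← opKernel_of_hasSum hB]
      unfold opKernel
      congr!
    simp only [h4] at h3
    unfold opKernel
    convert h3 using 1
    rw [ContinuousLinearMap.comp_apply]
  refine (h2.sub h1).congr_fun fun z => ?_
  -- The frozen b_x is written as b_z - (b_z - b_x), because both of these are known to be regular
  -- as seen from z.
  have h5 := kernel_sub hG hq hreg (hBb ε hε z) (hF ε hε x z) y
  simp only [sub_sub_cancel] at h5
  rw [← mul_sub, h5, sub_sub_cancel]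

/-- The remainder in the composition formula. -/
theorem exists_norm_remainder_le [G.LocallyFinite] (hG : G.IsTree) (hq : 2 ≤ q)
    (hreg : G.IsRegularOfDegree (q + 1)) {a b : ℝ → V → Boundary G o → ℝ → ℂ}
    (ha : IsSymbolFamily q a) (hb : IsSemiclassical q b) (N : ℕ) :
    ∃ Θ : ℝ → ℝ, Tendsto Θ (𝓝[>] 0) (𝓝 0) ∧ ∀ ε > 0, 0 ≤ Θ ε ∧ ∀ x y, ∀ D : ℂ,
      HasSum (fun z => kernel q (a ε x) x z * kernel q (fun ω s => b ε z ω s - b ε x ω s) z y) D →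
      ‖D‖ ≤ Θ ε * ((q : ℝ) ^ (-(G.dist x y : ℝ) / 2) / (1 + (G.dist x y : ℝ)) ^ N) := by
  have hq0 : (0 : ℝ) < q := by exact_mod_cast (by omega : 0 < q)
  -- N + 4 powers are for the convolution; N + 2 absorb the growth of b_z - b_x in d(x, z), whose
  -- local bound of order N + 1 is divided by one more power.
  obtain ⟨A, hA0, hA⟩ := ha.exists_norm_kernel_le hG hq hreg (N + 4 + (N + 1 + 1))
  obtain ⟨F, C, hF0, hC0, hF⟩ := hb.exists_isLocalSymbol_sub hG hq (N + 1)
  obtain ⟨E, hE0, hE⟩ := TreePDO.exists_norm_kernel_le (o := o) hG hq hreg N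
  obtain ⟨S, hS0, hS⟩ := exists_tsum_decay_mul_decay_le hG (by omega : 1 ≤ q) hreg
  obtain ⟨Θ, hΘ, hΘ'⟩ := exists_tendsto_zero_of_min hF0 hC0 (N + 1)
  refine ⟨fun ε => A * E * S * Θ ε, by simpa using hΘ.const_mul (A * E * S), fun ε hε => ?_⟩
  obtain ⟨hΘ0, hmin⟩ := hΘ' ε hε
  refine ⟨by positivity, fun x y D hD => ?_⟩
  have hterm : ∀ z, ‖kernel q (a ε x) x z * kernel q (fun ω s => b ε z ω s - b ε x ω s) z y‖ ≤
      (A * E * Θ ε) * ((q : ℝ) ^ (-(G.dist x z : ℝ) / 2) / (1 + (G.dist x z : ℝ)) ^ (N + 4) *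
        ((q : ℝ) ^ (-(G.dist z y : ℝ) / 2) / (1 + (G.dist z y : ℝ)) ^ N)) := by
    intro z
    have h1 := hA ε hε x z
    have h2 := hE _ z _ (hF ε hε x z).isFlat (hF ε hε x z).osc y
    have h3 := hmin (G.dist x z)
    rw [norm_mul]
    calc _ ≤ (A * ((q : ℝ) ^ (-(G.dist x z : ℝ) / 2) /
          (1 + (G.dist x z : ℝ)) ^ (N + 4 + (N + 1 + 1)))) *
        (E * (Θ ε * (1 + (G.dist x z : ℝ)) ^ (N + 1 + 1)) *
          ((q : ℝ) ^ (-(G.dist z y : ℝ) / 2) / (1 + (G.dist z y : ℝ)) ^ N)) := by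
          refine mul_le_mul h1 (h2.trans ?_) (norm_nonneg _) (by positivity)
          gcongr
      _ = _ := by
        rw [pow_add _ (N + 4)]
        field_simp
  have h1 : ‖D‖ₑ ≤ ENNReal.ofReal (A * E * Θ ε) * ENNReal.ofReal
      (S * ((q : ℝ) ^ (-(G.dist x y : ℝ) / 2) / (1 + (G.dist x y : ℝ)) ^ N)) := by
    rw [← hD.tsum_eq]
    refine enorm_tsum_le_tsum_enorm.trans (le_trans ?_
      (mul_le_mul_right (hS N x y) (ENNReal.ofReal (A * E * Θ ε))))
    rw [← ENNReal.tsum_mul_left]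
    refine ENNReal.tsum_le_tsum fun z => ?_
    rw [← ENNReal.ofReal_mul (by positivity), ← ofReal_norm]
    exact ENNReal.ofReal_le_ofReal (hterm z)
  rw [← ENNReal.ofReal_mul (by positivity), ← ofReal_norm,
    ENNReal.ofReal_le_ofReal_iff (by positivity)] at h1
  exact h1.trans_eq (by ring)

end Composition

end TreePDO

theorem mainTheorem4 {V : Type*} (G : SimpleGraph V) [G.LocallyFinite] (hG : G.IsTree)
    (q : ℕ) (hq : 2 ≤ q) (hreg : G.IsRegularOfDegree (q + 1)) (o : V)
    (a b : ℝ → V → TreePDO.Boundary G o → ℝ → ℂ)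
    (ha : TreePDO.IsSymbolFamily q a) (hb : TreePDO.IsSemiclassical q b) :
    ∃ A B P : ℝ → TreePDO.L2 V →L[ℂ] TreePDO.L2 V,
      (∀ ε > 0, TreePDO.Extends (A ε) (TreePDO.Op q (a ε)) ∧
        TreePDO.Extends (B ε) (TreePDO.Op q (b ε)) ∧
        TreePDO.Extends (P ε) (TreePDO.Op q (fun x ω s => a ε x ω s * b ε x ω s))) ∧
      TreePDO.IsNegligible G q (fun ε => A ε ∘L B ε - P ε) ∧
      Tendsto (fun ε => ‖A ε ∘L B ε - P ε‖) (𝓝[>] 0) (𝓝 0) := by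
  obtain ⟨A, hA⟩ := ha.exists_operator hG hq hreg
  obtain ⟨B, hB⟩ := hb.toIsSymbolFamily.exists_operator hG hq hreg
  have hR := fun ε hε => TreePDO.hasSum_kernel_mul_kernel_sub hG hq hreg ha hb hε
    (hA ε hε) (hB ε hε)
  obtain ⟨S, hS0, hS⟩ := TreePDO.exists_operator_of_decay hG (by omega : 1 ≤ q) hreg o
  -- N = 4 is the decay needed for Schur's test. The operator D with the remainder as its kernel is
  -- constructed first, and Op(ab) is then taken to be AB - D; so the product symbol itself never
  -- has to be shown to lie in S.
  obtain ⟨Θ, hΘ, hΘ'⟩ := TreePDO.exists_norm_remainder_le hG hq hreg ha hb 4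
  have h : ∀ ε : ℝ, ∃ D : TreePDO.L2 V →L[ℂ] TreePDO.L2 V, ε > 0 → ‖D‖ ≤ Θ ε * S ∧
      ∀ x y, TreePDO.opKernel D x y = TreePDO.opKernel (A ε ∘L B ε) x y -
        TreePDO.kernel q (fun ω s => a ε x ω s * b ε x ω s) x y := by
    intro ε
    by_cases hε : ε > 0
    · obtain ⟨D, hD, hD'⟩ := hS (fun x y => TreePDO.opKernel (A ε ∘L B ε) x y -
        TreePDO.kernel q (fun ω s => a ε x ω s * b ε x ω s) x y) (Θ ε) (hΘ' ε hε).1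
        fun x y => (hΘ' ε hε).2 x y _ (hR ε hε x y)
      exact ⟨D, fun _ => ⟨hD, TreePDO.opKernel_of_hasSum hD'⟩⟩
    · exact ⟨0, fun h => absurd h hε⟩
  choose D hD using h
  refine ⟨A, B, fun ε => A ε ∘L B ε - D ε, fun ε hε =>
    ⟨TreePDO.extends_op_of_opKernel (TreePDO.opKernel_of_hasSum (hA ε hε)),
      TreePDO.extends_op_of_opKernel (TreePDO.opKernel_of_hasSum (hB ε hε)),
      TreePDO.extends_op_of_opKernel fun x y => ?_⟩, ?_, ?_⟩
  · rw [TreePDO.opKernel_sub, (hD ε hε).2, sub_sub_cancel]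
  · intro N
    obtain ⟨C, hC, hC'⟩ := TreePDO.exists_norm_remainder_le hG hq hreg ha hb N
    refine ⟨C, hC, fun ε hε x y => ?_⟩
    simp only [sub_sub_cancel]
    rw [(hD ε hε).2]
    exact (hC' ε hε).2 x y _ (hR ε hε x y)
  · simp only [sub_sub_cancel]
    refine squeeze_zero_norm' ?_ (by simpa using hΘ.mul_const S)
    filter_upwards [self_mem_nhdsWithin] with ε hε
    rw [norm_norm]
    exact (hD ε hε).1
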